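/- Throughout, $\tau\in\mathbb H=\{\tau\in\mathbb C:\operatorname{Im}\tau>0\}$, $q=e^{2\pi i\tau}$, $q^r:=e^{2\pi i r\tau}$ for $r\in\mathbb Q$, $\zeta_n=e^{2\pi i/n}$, $(a;q)_\infty=\prod_{n\ge 0}(1-aq^n)$ and $(a)_\infty=(a;q)_\infty$. Define eight fifth order mock theta functions for $|q|<1$ by \begin{align*} f_0(q)&=\frac1{(q)_\infty}\sum_{n\ge0}\sum_{|j|\le n}(-1)^jq^{\frac52n^2+\frac12n-j^2}(1-q^{4n+2}),\\ f_1(q)&=\frac1{(q)_\infty}\sum_{n\ge0}\sum_{|j|\le n}(-1)^jq^{\frac52n^2+\frac32n-j^2}(1-q^{2n+1}),\\ F_0(q)&=\frac1{(q^2;q^2)_\infty}\sum_{n\ge0}\sum_{j=0}^{2n}(-1)^nq^{5n^2+2n-\frac12j^2-\frac12j}(1+q^{6n+3}),\\ F_1(q)&=\frac1{(q^2;q^2)_\infty}\sum_{n\ge0}\sum_{j=0}^{2n}(-1)^nq^{5n^2+4n-\frac12j^2-\frac12j}(1+q^{2n+1}),\\ 1+2\psi_0(q)&=\frac{(-q)_\infty}{(q)_\infty}\Bigl(1+2\sum_{n\ge1}(-1)^nq^{n^2+n}-2\sum_{n\ge1}\sum_{|j|<n}(-1)^jq^{\frac52n^2-\frac12n-\frac32j^2-\frac12j}(1-q^n)\Bigr),\\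 \psi_1(q)&=\frac{(-q)_\infty}{(q)_\infty}\sum_{n\ge0}\sum_{|j|\le n}(-1)^jq^{\frac52n^2+\frac32n-\frac32j^2-\frac12j}(1-q^{2n+1}),\\ \phi_0(q)&=\frac{(-q;q^2)_\infty}{(q^2;q^2)_\infty}\sum_{n\ge0}\sum_{|j|\le n}(-1)^jq^{5n^2+2n-3j^2-j}(1-q^{6n+3}),\\ \phi_1(q)&=q\,\frac{(-q;q^2)_\infty}{(q^2;q^2)_\infty}\sum_{n\ge0}\sum_{|j|\le n}(-1)^jq^{5n^2+4n-3j^2-j}(1-q^{2n+1}). \end{align*} Let $F_5=F_{5,1}+F_{5,2}:\mathbb H\to\mathbb C^6$, that is, $$F_5(\tau)=\begin{pmatrix} q^{-\frac1{60}}f_0(q)+2q^{-\frac1{60}}\psi_0(q)\\ q^{\frac{11}{60}}f_1(q)+2q^{\frac{11}{60}}\psi_1(q)\\ q^{-\frac1{240}}(-1+F_0(q^{\frac12}))+q^{-\frac1{240}}\phi_0(-q^{\frac12})\\ q^{\frac{71}{240}}F_1(q^{\frac12})-q^{-\frac{49}{240}}\phi_1(-q^{\frac12})\\ q^{-\frac1{240}}(-1+F_0(-q^{\frac12}))+q^{-\frac1{240}}\phi_0(q^{\frac12})\\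 q^{\frac{71}{240}}F_1(-q^{\frac12})+q^{-\frac{49}{240}}\phi_1(q^{\frac12}) \end{pmatrix},$$ where in each row the first summand is the component of $F_{5,1}$ and the second that of $F_{5,2}$. **Proposition.** $F_5$ is a (weakly holomorphic) vector-valued modular form of weight $1/2$ on $\operatorname{SL}_2(\mathbb Z)$: it is holomorphic on $\mathbb H$; there is a map $\rho:\operatorname{SL}_2(\mathbb Z)\to\operatorname{GL}_6(\mathbb C)$, for which $\gamma=\left(\begin{smallmatrix}a&b\\c&d\end{smallmatrix}\right)\mapsto(c\tau+d)^{1/2}\rho(\gamma)$ is a factor of automorphy, such that $F_5(\gamma\tau)=(c\tau+d)^{1/2}\rho(\gamma)F_5(\tau)$ for all $\gamma$ and $\tau$; and it is meromorphic at the cusp, i.e. its components are $O(e^{C\operatorname{Im}\tau})$ as $\operatorname{Im}\tau\to\infty$ for some constant $C$. Explicitly, $$F_5(\tau+1)=\begin{pmatrix}\zeta_{60}^{-1}&0&0&0&0&0\\0&\zeta_{60}^{11}&0&0&0&0\\0&0&0&0&\zeta_{240}^{-1}&0\\0&0&0&0&0&\zeta_{240}^{71}\\0&0&\zeta_{240}^{-1}&0&0&0\\0&0&0&\zeta_{240}^{71}&0&0\end{pmatrix}F_5(\tau),\qquad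 F_5\Bigl(-\frac1\tau\Bigr)=\sqrt{-i\tau}\,\frac2{\sqrt5}\,M_5\,F_5(\tau),$$ with $$M_5=\begin{pmatrix} 0&0&\sqrt2\sin\frac\pi5&\sqrt2\sin\frac{2\pi}5&0&0\\ 0&0&\sqrt2\sin\frac{2\pi}5&-\sqrt2\sin\frac\pi5&0&0\\ \frac1{\sqrt2}\sin\frac\pi5&\frac1{\sqrt2}\sin\frac{2\pi}5&0&0&0&0\\ \frac1{\sqrt2}\sin\frac{2\pi}5&-\frac1{\sqrt2}\sin\frac\pi5&0&0&0&0\\ 0&0&0&0&\sin\frac{2\pi}5&\sin\frac\pi5\\ 0&0&0&0&\sin\frac\pi5&-\sin\frac{2\pi}5 \end{pmatrix}$$ (square roots are principal). Moreover each of the six components $f$ of $F_5$ is a (weakly holomorphic) modular form of weight $1/2$ on some congruence subgroup $\Gamma\subseteq\Gamma_0(4)$: $f$ is holomorphic on $\mathbb H$, $f(\gamma\tau)=\frac{\theta(\gamma\tau)}{\theta(\tau)}f(\tau)$ for all $\gamma\in\Gamma$, where $\theta(\tau)=\sum_{n\in\mathbb Z}q^{n^2}$, and $f$ is meromorphic at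 all cusps, i.e. for every $\sigma=\left(\begin{smallmatrix}a&b\\c&d\end{smallmatrix}\right)\in\operatorname{SL}_2(\mathbb Z)$ one has $(c\tau+d)^{-1/2}f(\sigma\tau)=O(e^{C\operatorname{Im}\tau})$ as $\operatorname{Im}\tau\to\infty$ for some constant $C$. -/

import Mathlib

open scoped MatrixGroups Manifold UpperHalfPlane Matrix

noncomputable section

namespace MockTheta

/-! ### Fifth order mock theta functions, as functions of `q` on the open unit disc

They are defined by their Hecke-type double sums. All exponents of `q` below are nonnegative
integers; the integer divisions by `2` are exact. -/

/-- `(a; q)_∞ = ∏_{n ≥ 0} (1 - a q ^ n)`. -/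
def qPoch (a q : ℂ) : ℂ := ∏' n : ℕ, (1 - a * q ^ n)

/-- `f₀(q) = (q)_∞⁻¹ ∑_{n ≥ 0} ∑_{|j| ≤ n} (-1)^j q^{5n²/2 + n/2 - j²} (1 - q^{4n+2})`. -/
def f0 (q : ℂ) : ℂ :=
  (qPoch q q)⁻¹ * ∑' n : ℕ, ∑ j ∈ Finset.Icc (-(n : ℤ)) n,
    (-1 : ℂ) ^ j * q ^ ((5 * (n : ℤ) ^ 2 + n) / 2 - j ^ 2) * (1 - q ^ (4 * n + 2))

/-- `f₁(q) = (q)_∞⁻¹ ∑_{n ≥ 0} ∑_{|j| ≤ n} (-1)^j q^{5n²/2 + 3n/2 - j²} (1 - q^{2n+1})`. -/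
def f1 (q : ℂ) : ℂ :=
  (qPoch q q)⁻¹ * ∑' n : ℕ, ∑ j ∈ Finset.Icc (-(n : ℤ)) n,
    (-1 : ℂ) ^ j * q ^ ((5 * (n : ℤ) ^ 2 + 3 * n) / 2 - j ^ 2) * (1 - q ^ (2 * n + 1))

/-- `F₀(q) = (q²; q²)_∞⁻¹ ∑_{n ≥ 0} ∑_{0 ≤ j ≤ 2n}
(-1)^n q^{5n² + 2n - j²/2 - j/2} (1 + q^{6n+3})`. -/
def F0 (q : ℂ) : ℂ :=
  (qPoch (q ^ 2) (q ^ 2))⁻¹ * ∑' n : ℕ, ∑ j ∈ Finset.Icc (0 : ℤ) (2 * n),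
    (-1 : ℂ) ^ n * q ^ (5 * (n : ℤ) ^ 2 + 2 * n - (j ^ 2 + j) / 2) * (1 + q ^ (6 * n + 3))

/-- `F₁(q) = (q²; q²)_∞⁻¹ ∑_{n ≥ 0} ∑_{0 ≤ j ≤ 2n}
(-1)^n q^{5n² + 4n - j²/2 - j/2} (1 + q^{2n+1})`. -/
def F1 (q : ℂ) : ℂ :=
  (qPoch (q ^ 2) (q ^ 2))⁻¹ * ∑' n : ℕ, ∑ j ∈ Finset.Icc (0 : ℤ) (2 * n),
    (-1 : ℂ) ^ n * q ^ (5 * (n : ℤ) ^ 2 + 4 * n - (j ^ 2 + j) / 2) * (1 + q ^ (2 * n + 1))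

/-- `1 + 2 ψ₀(q) = (-q)_∞ (q)_∞⁻¹ (1 + 2 ∑_{n ≥ 1} (-1)^n q^{n²+n}
- 2 ∑_{n ≥ 1} ∑_{|j| < n} (-1)^j q^{5n²/2 - n/2 - 3j²/2 - j/2} (1 - q^n))`.
The term `n = 0` is an empty sum in the second series and is set to `0` in the first one. -/
def psi0 (q : ℂ) : ℂ :=
  (qPoch (-q) q / qPoch q q *
    (1 + 2 * (∑' n : ℕ, if 1 ≤ n then (-1 : ℂ) ^ n * q ^ (n ^ 2 + n) else 0)
      - 2 * ∑' n : ℕ, ∑ j ∈ Finset.Ioo (-(n : ℤ)) n,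
          (-1 : ℂ) ^ j * q ^ ((5 * (n : ℤ) ^ 2 - n) / 2 - (3 * j ^ 2 + j) / 2) * (1 - q ^ n))
    - 1) / 2

/-- `ψ₁(q) = (-q)_∞ (q)_∞⁻¹ ∑_{n ≥ 0} ∑_{|j| ≤ n}
(-1)^j q^{5n²/2 + 3n/2 - 3j²/2 - j/2} (1 - q^{2n+1})`. -/
def psi1 (q : ℂ) : ℂ :=
  qPoch (-q) q / qPoch q q * ∑' n : ℕ, ∑ j ∈ Finset.Icc (-(n : ℤ)) n,
    (-1 : ℂ) ^ j * q ^ ((5 * (n : ℤ) ^ 2 + 3 * n) / 2 - (3 * j ^ 2 + j) / 2)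
      * (1 - q ^ (2 * n + 1))

/-- `φ₀(q) = (-q; q²)_∞ (q²; q²)_∞⁻¹ ∑_{n ≥ 0} ∑_{|j| ≤ n}
(-1)^j q^{5n² + 2n - 3j² - j} (1 - q^{6n+3})`. -/
def phi0 (q : ℂ) : ℂ :=
  qPoch (-q) (q ^ 2) / qPoch (q ^ 2) (q ^ 2) * ∑' n : ℕ, ∑ j ∈ Finset.Icc (-(n : ℤ)) n,
    (-1 : ℂ) ^ j * q ^ (5 * (n : ℤ) ^ 2 + 2 * n - 3 * j ^ 2 - j) * (1 - q ^ (6 * n + 3))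

/-- `φ₁(q) = q (-q; q²)_∞ (q²; q²)_∞⁻¹ ∑_{n ≥ 0} ∑_{|j| ≤ n}
(-1)^j q^{5n² + 4n - 3j² - j} (1 - q^{2n+1})`. -/
def phi1 (q : ℂ) : ℂ :=
  q * (qPoch (-q) (q ^ 2) / qPoch (q ^ 2) (q ^ 2)) * ∑' n : ℕ,
    ∑ j ∈ Finset.Icc (-(n : ℤ)) n,
      (-1 : ℂ) ^ j * q ^ (5 * (n : ℤ) ^ 2 + 4 * n - 3 * j ^ 2 - j) * (1 - q ^ (2 * n + 1))

/-! ### The vectors `F_{5,1}`, `F_{5,2}`, `F₅` on the upper half plane -/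

/-- `q ^ r = exp (2 π i r τ)` for rational `r`. -/
def qPow (r : ℚ) (τ : ℍ) : ℂ := Complex.exp (2 * Real.pi * Complex.I * (r : ℂ) * (τ : ℂ))

/-- The vector `F_{5,1}`. -/
def F51 (τ : ℍ) : Fin 6 → ℂ :=
  ![qPow (-1 / 60) τ * f0 (qPow 1 τ),
    qPow (11 / 60) τ * f1 (qPow 1 τ),
    qPow (-1 / 240) τ * (-1 + F0 (qPow (1 / 2) τ)),
    qPow (71 / 240) τ * F1 (qPow (1 / 2) τ),
    qPow (-1 / 240) τ * (-1 + F0 (-qPow (1 / 2) τ)),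
    qPow (71 / 240) τ * F1 (-qPow (1 / 2) τ)]

/-- The vector `F_{5,2}`. -/
def F52 (τ : ℍ) : Fin 6 → ℂ :=
  ![2 * qPow (-1 / 60) τ * psi0 (qPow 1 τ),
    2 * qPow (11 / 60) τ * psi1 (qPow 1 τ),
    qPow (-1 / 240) τ * phi0 (-qPow (1 / 2) τ),
    -(qPow (-49 / 240) τ * phi1 (-qPow (1 / 2) τ)),
    qPow (-1 / 240) τ * phi0 (qPow (1 / 2) τ),
    qPow (-49 / 240) τ * phi1 (qPow (1 / 2) τ)]

/-- `F₅ = F_{5,1} + F_{5,2}`. -/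
def F5 (τ : ℍ) : Fin 6 → ℂ := F51 τ + F52 τ

/-! ### The matrices -/

/-- `ζ_n = exp (2 π i / n)`. -/
def zeta (n : ℕ) : ℂ := Complex.exp (2 * Real.pi * Complex.I / n)

/-- The matrix of `τ ↦ τ + 1`. -/
def T5 : Matrix (Fin 6) (Fin 6) ℂ :=
  !![zeta 60 ^ (-1 : ℤ), 0, 0, 0, 0, 0;
     0, zeta 60 ^ (11 : ℤ), 0, 0, 0, 0;
     0, 0, 0, 0, zeta 240 ^ (-1 : ℤ), 0;
     0, 0, 0, 0, 0, zeta 240 ^ (71 : ℤ);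
     0, 0, zeta 240 ^ (-1 : ℤ), 0, 0, 0;
     0, 0, 0, zeta 240 ^ (71 : ℤ), 0, 0]

/-- `sin (π / 5)` as a complex number. -/
def s1 : ℂ := (Real.sin (Real.pi / 5) : ℝ)

/-- `sin (2 π / 5)` as a complex number. -/
def s2 : ℂ := (Real.sin (2 * Real.pi / 5) : ℝ)

/-- `√2` as a complex number. -/
def r2 : ℂ := (Real.sqrt 2 : ℝ)

/-- The matrix `M₅`. -/
def M5 : Matrix (Fin 6) (Fin 6) ℂ :=
  !![0, 0, r2 * s1, r2 * s2, 0, 0;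
     0, 0, r2 * s2, -(r2 * s1), 0, 0;
     1 / r2 * s1, 1 / r2 * s2, 0, 0, 0, 0;
     1 / r2 * s2, -(1 / r2 * s1), 0, 0, 0, 0;
     0, 0, 0, 0, s2, s1;
     0, 0, 0, 0, s1, -s2]

/-! ### Modular forms of weight `1/2` -/

/-- `(c τ + d) ^ (1/2)`, principal branch, for `γ = (a b; c d)`. -/
def halfFactor (γ : SL(2, ℤ)) (τ : ℍ) : ℂ :=
  (((γ 1 0 : ℤ) : ℂ) * (τ : ℂ) + ((γ 1 1 : ℤ) : ℂ)) ^ (1 / 2 : ℂ)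

/-- `ρ` is a (matrix valued) multiplier system of weight `1/2` on `SL(2, ℤ)`, that is,
`γ ↦ (c τ + d) ^ (1/2) ρ(γ)` is a factor of automorphy. -/
def IsMultiplierSystem {n : ℕ} (ρ : SL(2, ℤ) → GL (Fin n) ℂ) : Prop :=
  ∀ (γ δ : SL(2, ℤ)) (τ : ℍ),
    halfFactor (γ * δ) τ • (ρ (γ * δ) : Matrix (Fin n) (Fin n) ℂ) =
      (halfFactor γ (δ • τ) * halfFactor δ τ) •
        ((ρ γ : Matrix (Fin n) (Fin n) ℂ) * (ρ δ : Matrix (Fin n) (Fin n) ℂ))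

/-- `F` is a (weakly holomorphic) vector-valued modular form of weight `1/2` on `SL(2, ℤ)` with
multiplier system `ρ`: holomorphic on the upper half plane, meromorphic at the cusp. -/
structure IsVectorModularForm {n : ℕ} (ρ : SL(2, ℤ) → GL (Fin n) ℂ) (F : ℍ → Fin n → ℂ) :
    Prop where
  multiplier : IsMultiplierSystem ρ
  holo : ∀ i, MDifferentiable 𝓘(ℂ) 𝓘(ℂ) (fun τ => F τ i)
  transform : ∀ (γ : SL(2, ℤ)) (τ : ℍ),
    F (γ • τ) = halfFactor γ τ • ((ρ γ : Matrix (Fin n) (Fin n) ℂ) *ᵥ F τ)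
  meromorphic_cusp : ∃ C : ℝ, ∀ i,
    (fun τ => F τ i) =O[UpperHalfPlane.atImInfty] (fun τ => Real.exp (C * τ.im))

/-- The theta series `θ(τ) = ∑_{n ∈ ℤ} q ^ (n²)`, `q = exp (2 π i τ)`. -/
def theta (τ : ℍ) : ℂ := jacobiTheta (2 * (τ : ℂ))

/-- `f` is a (weakly holomorphic) modular form of weight `1/2` on the congruence subgroup
`Γ ⊆ Γ₀(4)`: it is holomorphic on the upper half plane, satisfies
`f(γ τ) = θ(γ τ) / θ(τ) · f(τ)` for `γ ∈ Γ` (the theta series has no zeros), and is meromorphic at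
every cusp. -/
structure IsModularFormHalf (Γ : Subgroup SL(2, ℤ)) (f : ℍ → ℂ) : Prop where
  congruence : CongruenceSubgroup.IsCongruenceSubgroup Γ
  le_Gamma0 : Γ ≤ CongruenceSubgroup.Gamma0 4
  holo : MDifferentiable 𝓘(ℂ) 𝓘(ℂ) f
  transform : ∀ γ ∈ Γ, ∀ τ : ℍ, f (γ • τ) * theta τ = theta (γ • τ) * f τ
  meromorphic_cusps : ∀ σ : SL(2, ℤ), ∃ C : ℝ,
    (fun τ => (halfFactor σ τ)⁻¹ * f (σ • τ))
      =O[UpperHalfPlane.atImInfty] (fun τ => Real.exp (C * τ.im))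

end MockTheta

end

/-! In every row of `F5` the two summands are the two halves of one bilateral series. For a suitable
b, split the sum over all integers n of q^(n²) (b q^(n+1); q)_∞, or of q^(n²+n) (b q^(n+1); q)_∞, at
n = 0. Up to the factor (bq; q)_∞, and an elementary factor when b = p, the terms with n ≥ 0 give
f₀, f₁, F₀ or F₁. Reversing the finite products turns those with n < 0 into the companion ψ or φ
(`tsum_bilateral_eq`). On the other hand, Euler's expansion of the infinite product and completion
of the square turn the same series into theta constants times the series ∑ q^(n²+cn) / (q; q)_(2n+e)
(`hasSum_bilateral_zero`, `hasSum_bilateral_one`). Rogers' identities modulo 20 make the latter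
theta series divided by (q; q)_∞. So each component is a sum of products of two theta series of
weight 1/2, divided by an eta quotient of weight 1/2 (`F5_eq_thetaVec`), and the mock behaviour has
cancelled.

The functions are given by Hecke double sums, so their Eulerian forms are needed first. These come
from Bailey's lemma (`tsum_mul_baileySum`): conjugate pairs follow from a limiting ₆φ₅ sum
(`tsum_wpTerm`) and a contiguous version of it (`tsum_wpTerm'`), and the indefinite double sums
arise by solving a first order recurrence for the inverse transform of 1/(b; q)_(j+1)
(`baileySum_inv_poch_rec`). Rogers' identities use the same lemma, with an inverse transform that is
zero or a signed monomial.

The translation formula is read off from the exponents of q; the inversion formula is Jacobi's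
transformation applied to every theta series. Since S and T generate SL(2, ℤ), each γ acts on `F5`
by some matrix. The factor (cτ+d)^(1/2) is a cocycle up to sign, and linear independence of the six
components makes the matrices unique, so they form a multiplier system
(`exists_isVectorModularForm`).

For the individual components, all the theta series involved acquire the same multiplier under
Γ(3600), by a Gauss sum computation at a prime supplied by Dirichlet's theorem (`exists_lth_smul`).
A quotient of weight 1 by weight 1/2 therefore transforms exactly like θ. -/

noncomputable section

namespace MockTheta
open Filter Topology Finset

/-! ### Finite and infinite `q`-Pochhammer symbols -/

/-- `(a; q)_n`. -/
def poch (a q : ℂ) (n : ℕ) : ℂ := ∏ i ∈ range n, (1 - a * q ^ i)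

@[simp] lemma poch_zero (a q : ℂ) : poch a q 0 = 1 := by simp [poch]

lemma poch_succ (a q : ℂ) (n : ℕ) : poch a q (n + 1) = poch a q n * (1 - a * q ^ n) := by
  simp [poch, prod_range_succ]

lemma poch_succ' (a q : ℂ) (n : ℕ) : poch a q (n + 1) = (1 - a) * poch (a * q) q n := by
  simp only [poch, prod_range_succ', pow_zero, mul_one]
  rw [mul_comm]
  congr 1
  exact prod_congr rfl fun i _ => by ring

lemma poch_add (a q : ℂ) (m n : ℕ) : poch a q (m + n) = poch a q m * poch (a * q ^ m) q n := by
  simp only [poch, prod_range_add]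
  congr 1
  exact prod_congr rfl fun i _ => by ring

lemma poch_ne_zero {a q : ℂ} (h : ∀ i, a * q ^ i ≠ 1) (n : ℕ) : poch a q n ≠ 0 :=
  prod_ne_zero_iff.2 fun i _ => sub_ne_zero.2 (h i).symm

lemma mul_pow_ne_one {a q : ℂ} (hq : ‖q‖ < 1) (ha : ‖a‖ < 1) (i : ℕ) : a * q ^ i ≠ 1 := by
  intro h
  have : ‖a * q ^ i‖ < 1 := by
    rw [norm_mul, norm_pow]
    calc ‖a‖ * ‖q‖ ^ i ≤ ‖a‖ * 1 := by gcongr; exact pow_le_one₀ (norm_nonneg _) hq.le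
      _ < 1 := by simpa
  rw [h] at this
  simp at this

lemma poch_ne_zero' {a q : ℂ} (hq : ‖q‖ < 1) (ha : ‖a‖ < 1) (n : ℕ) : poch a q n ≠ 0 :=
  poch_ne_zero (mul_pow_ne_one hq ha) n

lemma one_sub_pow_ne_zero {q : ℂ} (hq : ‖q‖ < 1) (n : ℕ) : 1 - q ^ (n + 1) ≠ 0 := by
  have := mul_pow_ne_one hq hq n
  rw [sub_ne_zero, pow_succ']
  exact this.symm

lemma summable_norm_mul_pow {q : ℂ} (hq : ‖q‖ < 1) (a : ℂ) : Summable fun n : ℕ => ‖-(a * q ^ n)‖ := by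
  simp only [norm_neg, norm_mul, norm_pow]
  exact (summable_geometric_of_lt_one (norm_nonneg _) hq).mul_left _

lemma multipliable_poch {q : ℂ} (hq : ‖q‖ < 1) (a : ℂ) : Multipliable fun n : ℕ => 1 - a * q ^ n := by
  simpa [sub_eq_add_neg] using multipliable_one_add_of_summable (summable_norm_mul_pow hq a)

lemma tendsto_poch {q : ℂ} (hq : ‖q‖ < 1) (a : ℂ) :
    Tendsto (poch a q) atTop (𝓝 (qPoch a q)) :=
  (multipliable_poch hq a).hasProd.tendsto_prod_nat

lemma qPoch_eq {q : ℂ} (hq : ‖q‖ < 1) (a : ℂ) (n : ℕ) :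
    qPoch a q = poch a q n * qPoch (a * q ^ n) q := by
  refine tendsto_nhds_unique ((tendsto_add_atTop_iff_nat n).2 (tendsto_poch hq a)) ?_
  have := (tendsto_poch hq (a * q ^ n)).const_mul (poch a q n)
  refine this.congr fun m => ?_
  rw [add_comm, poch_add]

lemma qPoch_ne_zero {a q : ℂ} (hq : ‖q‖ < 1) (h : ∀ i, a * q ^ i ≠ 1) : qPoch a q ≠ 0 := by
  have := tprod_one_add_ne_zero_of_summable (f := fun n : ℕ => -(a * q ^ n))
    (fun i => by rw [← sub_eq_add_neg]; exact sub_ne_zero.2 (h i).symm) (summable_norm_mul_pow hq a)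
  simpa [qPoch, sub_eq_add_neg] using this

lemma qPoch_ne_zero' {a q : ℂ} (hq : ‖q‖ < 1) (ha : ‖a‖ < 1) : qPoch a q ≠ 0 :=
  qPoch_ne_zero hq (mul_pow_ne_one hq ha)

@[simp] lemma qPoch_zero_left (q : ℂ) : qPoch 0 q = 1 := by simp [qPoch]

@[simp] lemma poch_zero_left (q : ℂ) (n : ℕ) : poch 0 q n = 1 := by simp [poch]

lemma norm_poch_le {q : ℂ} (hq : ‖q‖ < 1) (a : ℂ) (n : ℕ) :
    ‖poch a q n‖ ≤ Real.exp (‖a‖ * (1 - ‖q‖)⁻¹) := by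
  calc ‖poch a q n‖ ≤ ∏ i ∈ range n, ‖1 - a * q ^ i‖ := by rw [poch, norm_prod]
    _ ≤ ∏ i ∈ range n, Real.exp (‖a‖ * ‖q‖ ^ i) := by
        refine prod_le_prod (fun _ _ => norm_nonneg _) fun i _ => ?_
        calc ‖1 - a * q ^ i‖ ≤ ‖(1 : ℂ)‖ + ‖a * q ^ i‖ := norm_sub_le _ _
          _ = ‖a‖ * ‖q‖ ^ i + 1 := by rw [norm_one, norm_mul, norm_pow, add_comm]
          _ ≤ _ := Real.add_one_le_exp _
    _ = Real.exp (‖a‖ * ∑ i ∈ range n, ‖q‖ ^ i) := by rw [← Real.exp_sum, mul_sum]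
    _ ≤ _ := by
        rw [Real.exp_le_exp]
        gcongr
        rw [← tsum_geometric_of_lt_one (norm_nonneg _) hq]
        exact (summable_geometric_of_lt_one (norm_nonneg _) hq).sum_le_tsum _
          fun _ _ => by positivity

/-! ### Uniform bounds, Gaussian summability and telescoping. -/

lemma exists_norm_poch_le {q : ℂ} (hq : ‖q‖ < 1) (a : ℂ) :
    ∃ C, 0 < C ∧ ∀ N n, ‖poch (a * q ^ N) q n‖ ≤ C := by
  refine ⟨_, Real.exp_pos (‖a‖ * (1 - ‖q‖)⁻¹), fun N n => (norm_poch_le hq _ n).trans ?_⟩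
  rw [Real.exp_le_exp]
  have : 0 < 1 - ‖q‖ := by linarith
  gcongr
  rw [norm_mul, norm_pow]
  exact mul_le_of_le_one_right (norm_nonneg _) (pow_le_one₀ (norm_nonneg _) hq.le)

/-- The inverses 1/(a)_n converge, since the infinite product does not vanish, and are therefore
bounded; then 1/(a q^N)_n = (a)_N / (a)_(N+n). Uniformity in N is what dominated convergence
requires when the parameters are shifted to 0. -/
lemma exists_norm_inv_poch_le {a q : ℂ} (hq : ‖q‖ < 1) (ha : ∀ i, a * q ^ i ≠ 1) :
    ∃ C, 0 < C ∧ ∀ N n, ‖(poch (a * q ^ N) q n)⁻¹‖ ≤ C := by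
  obtain ⟨C₁, hC₁, h₁⟩ := exists_norm_poch_le hq a
  have := ((tendsto_poch hq a).inv₀ (qPoch_ne_zero hq ha)).norm.bddAbove_range
  obtain ⟨C₂, hC₂⟩ := this
  have h₂ : ∀ n, ‖(poch a q n)⁻¹‖ ≤ C₂ := fun n => hC₂ ⟨n, rfl⟩
  have hC₂' : 0 ≤ C₂ := (norm_nonneg _).trans (h₂ 0)
  refine ⟨C₁ * (C₂ + 1), by positivity, fun N n => ?_⟩
  have : (poch (a * q ^ N) q n)⁻¹ = poch a q N * (poch a q (N + n))⁻¹ := by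
    rw [poch_add]
    field_simp [poch_ne_zero ha N]
  rw [this, norm_mul]
  have h3 := h₁ 0 N
  simp only [pow_zero, mul_one] at h3
  have := h₂ (N + n)
  gcongr
  linarith

lemma summable_pow_sq_mul_pow {r : ℝ} (h0 : 0 ≤ r) (h1 : r < 1) (A : ℝ) :
    Summable fun m : ℕ => r ^ (m * (m - 1)) * A ^ m := by
  refine summable_of_ratio_norm_eventually_le (r := 1 / 2) (by norm_num) ?_
  have : Tendsto (fun m : ℕ => (r ^ 2) ^ m * |A|) atTop (𝓝 (0 * |A|)) :=
    (tendsto_pow_atTop_nhds_zero_of_lt_one (by positivity) (by nlinarith)).mul_const _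
  rw [zero_mul] at this
  filter_upwards [this.eventually_le_const (by norm_num : (0 : ℝ) < 1 / 2)] with m hm
  have e : r ^ ((m + 1) * (m + 1 - 1)) * A ^ (m + 1)
      = ((r ^ 2) ^ m * A) * (r ^ (m * (m - 1)) * A ^ m) := by
    have : (m + 1) * (m + 1 - 1) = 2 * m + m * (m - 1) := by
      rcases m with _ | m
      · rfl
      · simp only [Nat.add_sub_cancel]; ring
    rw [this, pow_add, pow_mul, pow_succ]; ring
  rw [e, norm_mul]
  gcongr
  rw [norm_mul, Real.norm_eq_abs A, Real.norm_of_nonneg (by positivity)]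
  exact hm

lemma hasSum_of_telescoping {f g : ℕ → ℂ} (hf : Summable f) (h : ∀ m, f m = g (m + 1) - g m)
    (h0 : g 0 = 0) (hg : Tendsto g atTop (𝓝 0)) : ∑' m, f m = 0 := by
  refine tendsto_nhds_unique hf.hasSum.tendsto_sum_nat ?_
  simp only [h, sum_range_sub, h0, sub_zero]
  exact hg

/-! ### A limiting case of the very-well-poised `₆φ₅` summation -/

/-- `q ^ (m (m - 1)) ∏_{i < m} (w - x q ^ i)`. -/
def wpNum (x w q : ℂ) (m : ℕ) : ℂ := q ^ (m * (m - 1)) * ∏ i ∈ range m, (w - x * q ^ i)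

@[simp] lemma wpNum_zero (x w q : ℂ) : wpNum x w q 0 = 1 := by simp [wpNum]

lemma wpNum_succ (x w q : ℂ) (m : ℕ) :
    wpNum x w q (m + 1) = wpNum x w q m * (q ^ (2 * m) * (w - x * q ^ m)) := by
  have : (m + 1) * (m + 1 - 1) = 2 * m + m * (m - 1) := by
    rcases m with _ | m
    · rfl
    · simp only [Nat.add_sub_cancel]; ring
  rw [wpNum, wpNum, prod_range_succ, this, pow_add]
  ring

lemma wpNum_mul (x w q : ℂ) (m : ℕ) : wpNum (x * q) (w * q) q m = q ^ m * wpNum x w q m := by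
  induction m with
  | zero => simp
  | succ m ih => rw [wpNum_succ, wpNum_succ, ih]; ring

lemma norm_wpNum_le (x w q : ℂ) (hq : ‖q‖ < 1) (m : ℕ) :
    ‖wpNum x w q m‖ ≤ ‖q‖ ^ (m * (m - 1)) * (‖w‖ + ‖x‖) ^ m := by
  rw [wpNum, norm_mul, norm_pow, norm_prod]
  gcongr
  calc _ ≤ ∏ i ∈ range m, (‖w‖ + ‖x‖) := by
        refine prod_le_prod (fun _ _ => norm_nonneg _) fun i _ => (norm_sub_le _ _).trans ?_
        rw [norm_mul, norm_pow]
        gcongr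
        exact mul_le_of_le_one_right (norm_nonneg _) (pow_le_one₀ (norm_nonneg _) hq.le)
    _ = _ := by simp

/-- Summand of the well-poised series. -/
def wpTerm (x w q : ℂ) (m : ℕ) : ℂ :=
  wpNum (x * q) w q m / poch w q m * (1 - x * q ^ (2 * m)) * (poch x q m / poch q q m)

lemma exists_norm_wpTerm_le {q x w : ℂ} (hq : ‖q‖ < 1) (hw : ∀ i, w * q ^ i ≠ 1) :
    ∃ C A : ℝ, 0 ≤ A ∧ 0 ≤ C ∧ ∀ N m, ‖wpTerm (x * q ^ N) (w * q ^ N) q m‖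
      ≤ C * (‖q‖ ^ (m * (m - 1)) * A ^ m) := by
  obtain ⟨C₁, hC₁, h₁⟩ := exists_norm_inv_poch_le hq hw
  obtain ⟨C₂, hC₂, h₂⟩ := exists_norm_poch_le hq x
  obtain ⟨C₃, hC₃, h₃⟩ := exists_norm_inv_poch_le hq (mul_pow_ne_one hq hq)
  refine ⟨C₁ * (1 + ‖x‖) * (C₂ * C₃), ‖w‖ + ‖x‖, by positivity, by positivity, fun N m => ?_⟩
  have hN : ‖q‖ ^ N ≤ 1 := pow_le_one₀ (norm_nonneg _) hq.le
  have hxN : ‖x * q ^ N‖ ≤ ‖x‖ := by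
    rw [norm_mul, norm_pow]; exact mul_le_of_le_one_right (norm_nonneg _) hN
  have hwN : ‖w * q ^ N‖ ≤ ‖w‖ := by
    rw [norm_mul, norm_pow]; exact mul_le_of_le_one_right (norm_nonneg _) hN
  have e1 : ‖wpNum (x * q ^ N * q) (w * q ^ N) q m‖ ≤ ‖q‖ ^ (m * (m - 1)) * (‖w‖ + ‖x‖) ^ m := by
    refine (norm_wpNum_le _ _ _ hq m).trans ?_
    gcongr
    rw [norm_mul]
    exact (mul_le_of_le_one_right (norm_nonneg _) hq.le).trans hxN
  have e2 : ‖1 - x * q ^ N * q ^ (2 * m)‖ ≤ 1 + ‖x‖ := by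
    refine (norm_sub_le _ _).trans ?_
    rw [norm_one, norm_mul, norm_pow q (2 * m)]
    gcongr
    exact (mul_le_of_le_one_right (norm_nonneg _) (pow_le_one₀ (norm_nonneg _) hq.le)).trans hxN
  have e3 := h₃ 0 m
  simp only [pow_zero, mul_one] at e3
  have e4 := h₁ N m
  have e5 := h₂ N m
  rw [wpTerm, div_eq_mul_inv, div_eq_mul_inv, norm_mul, norm_mul, norm_mul, norm_mul]
  calc _ ≤ (‖q‖ ^ (m * (m - 1)) * (‖w‖ + ‖x‖) ^ m) * C₁ * (1 + ‖x‖) * (C₂ * C₃) := by gcongr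
    _ = _ := by ring

lemma summable_wpTerm {q x w : ℂ} (hq : ‖q‖ < 1) (hw : ∀ i, w * q ^ i ≠ 1) :
    Summable (wpTerm x w q) := by
  obtain ⟨C, A, hA, hC, h⟩ := exists_norm_wpTerm_le (x := x) hq hw
  refine Summable.of_norm_bounded ((summable_pow_sq_mul_pow (norm_nonneg q) hq A).mul_left C)
    fun m => ?_
  simpa using h 0 m

lemma tendsto_wpNum_mul {q x w : ℂ} (hq : ‖q‖ < 1) {u : ℕ → ℂ} {C : ℝ} (hu : ∀ m, ‖u m‖ ≤ C) :
    Tendsto (fun m => u m * wpNum x w q m) atTop (𝓝 0) := by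
  have h := (summable_pow_sq_mul_pow (norm_nonneg q) hq (‖w‖ + ‖x‖)).tendsto_atTop_zero.const_mul C
  rw [mul_zero] at h
  refine squeeze_zero_norm (fun m => ?_) h
  rw [norm_mul]
  have : 0 ≤ C := (norm_nonneg _).trans (hu 0)
  exact mul_le_mul (hu m) (norm_wpNum_le _ _ _ hq m) (norm_nonneg _) this

lemma shift_ne_one {q w : ℂ} (hw : ∀ i, w * q ^ i ≠ 1) (i : ℕ) : w * q * q ^ i ≠ 1 := by
  have := hw (i + 1)
  rwa [pow_succ', ← mul_assoc] at this

lemma exists_bound_inv_mul {q x w : ℂ} (hq : ‖q‖ < 1) (hw : ∀ i, w * q ^ i ≠ 1) :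
    ∃ C, ∀ m, ‖(1 - q ^ m) * (poch x q m / poch q q m) * (poch w q m)⁻¹‖ ≤ C := by
  obtain ⟨C₁, hC₁, h₁⟩ := exists_norm_inv_poch_le hq hw
  obtain ⟨C₂, hC₂, h₂⟩ := exists_norm_poch_le hq x
  obtain ⟨C₃, hC₃, h₃⟩ := exists_norm_inv_poch_le hq (mul_pow_ne_one hq hq)
  refine ⟨2 * (C₂ * C₃) * C₁, fun m => ?_⟩
  have e1 := h₁ 0 m
  have e2 := h₂ 0 m
  have e3 := h₃ 0 m
  simp only [pow_zero, mul_one] at e1 e2 e3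
  have e4 : ‖1 - q ^ m‖ ≤ 2 := by
    refine (norm_sub_le _ _).trans ?_
    rw [norm_one, norm_pow]
    have := pow_le_one₀ (n := m) (norm_nonneg q) hq.le
    linarith
  rw [norm_mul, norm_mul, div_eq_mul_inv, norm_mul]
  gcongr

/-- The difference of the two sides telescopes term by term, with an explicit hypergeometric
certificate. -/
lemma tsum_wpTerm_shift {q x w : ℂ} (hq : ‖q‖ < 1) (hw : ∀ i, w * q ^ i ≠ 1) :
    (1 - w) * ∑' m, wpTerm x w q m = (1 - x) * ∑' m, wpTerm (x * q) (w * q) q m := by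
  have s1 := summable_wpTerm (x := x) hq hw
  have s2 := summable_wpTerm (x := x * q) hq (shift_ne_one hw)
  rw [← sub_eq_zero, ← tsum_mul_left, ← tsum_mul_left,
    ← (s1.mul_left _).tsum_sub (s2.mul_left _)]
  -- The factor 1 - q^m makes the certificate vanish at m = 0, and the Gaussian factor in `wpNum`
  -- makes it vanish at infinity.
  refine hasSum_of_telescoping (g := fun m => -(1 - w) * ((1 - q ^ m) * (poch x q m / poch q q m)
    * (poch w q m)⁻¹ * wpNum (x * q) w q m)) ((s1.mul_left _).sub (s2.mul_left _)) ?_ (by simp) ?_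
  · intro m
    have hw0 : 1 - w ≠ 0 := sub_ne_zero.2 (by simpa using (hw 0).symm)
    have hwm : 1 - w * q ^ m ≠ 0 := sub_ne_zero.2 (hw m).symm
    have hp := poch_ne_zero hw m
    have hQ := poch_ne_zero' hq hq m
    have hq1 := one_sub_pow_ne_zero hq m
    rw [pow_succ'] at hq1
    have e1 : poch (w * q) q m = poch w q m * (1 - w * q ^ m) / (1 - w) := by
      rw [eq_div_iff hw0, mul_comm, ← poch_succ', poch_succ]
    have e2 : (1 - x) * poch (x * q) q m = poch x q m * (1 - x * q ^ m) := by
      rw [← poch_succ', poch_succ]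
    have e3 : (1 - x) * wpTerm (x * q) (w * q) q m = wpNum (x * q * q) (w * q) q m
        / poch (w * q) q m * (1 - x * q * q ^ (2 * m)) *
        ((1 - x) * poch (x * q) q m / poch q q m) := by
      rw [wpTerm]; ring
    rw [e3, e2, e1, wpNum_mul, wpTerm, wpNum_succ, poch_succ, poch_succ, poch_succ, two_mul,
      pow_add, pow_succ']
    generalize q ^ m = u at *
    field_simp
    ring
  · obtain ⟨C, hC⟩ := exists_bound_inv_mul (x := x) hq hw
    simpa using (tendsto_wpNum_mul (x := x * q) (w := w) hq hC).const_mul (-(1 - w))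

/-- In the ₆φ₅ sum take a = x and b = xq/w, and let the other two parameters tend to infinity.
Clearing w from the numerator keeps w = 0 admissible. Iterating the shift gives (w)_N S(x, w) =
(x)_N S(x q^N, w q^N), and the last sum tends to S(0, 0) = 1. -/
theorem tsum_wpTerm {q x w : ℂ} (hq : ‖q‖ < 1) (hw : ∀ i, w * q ^ i ≠ 1) :
    ∑' m, wpTerm x w q m = qPoch x q / qPoch w q := by
  have key : ∀ N, poch w q N * ∑' m, wpTerm x w q m
      = poch x q N * ∑' m, wpTerm (x * q ^ N) (w * q ^ N) q m := by
    intro N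
    induction N with
    | zero => simp
    | succ N ih =>
      have := tsum_wpTerm_shift (x := x * q ^ N) (w := w * q ^ N) hq
        (fun i => by rw [mul_assoc, ← pow_add]; exact hw _)
      rw [poch_succ, poch_succ, mul_right_comm, ih, mul_assoc, mul_comm _ (1 - w * q ^ N), this,
        pow_succ, mul_assoc (poch x q N), mul_assoc x, mul_assoc w]
  have lim : Tendsto (fun N => ∑' m, wpTerm (x * q ^ N) (w * q ^ N) q m) atTop (𝓝 1) := by
    obtain ⟨C, A, hA, hC, h⟩ := exists_norm_wpTerm_le (x := x) hq hw
    have := tendsto_tsum_of_dominated_convergence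
      (f := fun N m => wpTerm (x * q ^ N) (w * q ^ N) q m) (g := fun m => if m = 0 then (1 : ℂ) else 0)
      (𝓕 := atTop) ((summable_pow_sq_mul_pow (norm_nonneg q) hq A).mul_left C) ?_
      (Eventually.of_forall h)
    · simpa using this
    · have hz : ∀ y : ℂ, Tendsto (fun N : ℕ => y * q ^ N) atTop (𝓝 0) := fun y => by
        simpa using (tendsto_pow_atTop_nhds_zero_of_norm_lt_one hq).const_mul y
      -- Near (0, 0) the denominator (w)_m is close to 1, so each summand has a limit there; only m
      -- = 0 survives, since `wpNum` at (0, 0) contains a zero factor when m > 0.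
      have cont : ∀ m, ContinuousAt (fun z : ℂ × ℂ => wpTerm z.1 z.2 q m) (0, 0) := by
        intro m
        unfold wpTerm wpNum poch
        refine ContinuousAt.mul (ContinuousAt.mul (ContinuousAt.div ?_ ?_ (by simp)) ?_) ?_ <;>
          fun_prop
      intro m
      have h1 := (cont m).tendsto.comp ((hz x).prodMk_nhds (hz w))
      refine h1.congr' (Eventually.of_forall fun _ => rfl) |>.trans ?_
      have : wpTerm 0 0 q m = if m = 0 then (1 : ℂ) else 0 := by
        rcases m with _ | m
        · simp [wpTerm]
        · simp [wpTerm, wpNum]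
      simp [this]
  have h1 := (tendsto_poch hq w).mul_const (∑' m, wpTerm x w q m)
  have h2 := (tendsto_poch hq x).mul lim
  rw [eq_div_iff (qPoch_ne_zero hq hw), mul_comm]
  simpa using tendsto_nhds_unique h1 (h2.congr fun N => (key N).symm)

/-- Summand of the contiguous series. -/
def wpTerm' (x w q : ℂ) (m : ℕ) : ℂ :=
  (wpNum x w q m / poch w q m + x * q ^ m * (wpNum x w q (m + 1) / poch w q (m + 1)))
    * (poch x q m / poch q q m)

lemma summable_wpTerm' {q x w : ℂ} (hq : ‖q‖ < 1) (hw : ∀ i, w * q ^ i ≠ 1) :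
    Summable (wpTerm' x w q) := by
  obtain ⟨C₁, hC₁, h₁⟩ := exists_norm_inv_poch_le hq hw
  obtain ⟨C₂, hC₂, h₂⟩ := exists_norm_poch_le hq x
  obtain ⟨C₃, hC₃, h₃⟩ := exists_norm_inv_poch_le hq (mul_pow_ne_one hq hq)
  have s := summable_pow_sq_mul_pow (norm_nonneg q) hq (‖w‖ + ‖x‖)
  refine Summable.of_norm_bounded (((s.mul_right C₁).add
    (((summable_nat_add_iff 1).2 s |>.mul_right C₁).mul_left ‖x‖)).mul_right (C₂ * C₃)) fun m => ?_
  have e1 := h₁ 0 m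
  have e1' := h₁ 0 (m + 1)
  have e2 := h₂ 0 m
  have e3 := h₃ 0 m
  simp only [pow_zero, mul_one] at e1 e1' e2 e3
  have a1 := norm_wpNum_le x w q hq m
  have a2 := norm_wpNum_le x w q hq (m + 1)
  rw [wpTerm', norm_mul, div_eq_mul_inv, div_eq_mul_inv, div_eq_mul_inv, norm_mul (poch x q m)]
  refine mul_le_mul ((norm_add_le _ _).trans (add_le_add ?_ ?_)) (by gcongr) (by positivity)
    (by positivity)
  · rw [norm_mul]; gcongr
  · rw [norm_mul, norm_mul, norm_mul, norm_pow]
    refine mul_le_mul (mul_le_of_le_one_right (norm_nonneg _) (pow_le_one₀ (norm_nonneg _) hq.le))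
      (mul_le_mul a2 e1' (norm_nonneg _) (by positivity)) (by positivity) (norm_nonneg _)

/-- Multiplied by 1 - w, the summand differs from `wpTerm x (w * q) q` by a telescoping term, so the
evaluation reduces to the previous one at wq. This variant yields the conjugate pairs whose weights
carry factors such as 1 - q^(4n+2) or 1 - p^(6n+3). -/
theorem tsum_wpTerm' {q x w : ℂ} (hq : ‖q‖ < 1) (hw : ∀ i, w * q ^ i ≠ 1) :
    ∑' m, wpTerm' x w q m = qPoch x q / qPoch w q := by
  have s1 := summable_wpTerm' (x := x) hq hw
  have s2 := summable_wpTerm (x := x) hq (shift_ne_one hw)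
  have hw0 : 1 - w ≠ 0 := sub_ne_zero.2 (by simpa using (hw 0).symm)
  have key : (1 - w) * ∑' m, wpTerm' x w q m = ∑' m, wpTerm x (w * q) q m := by
    rw [← sub_eq_zero, ← tsum_mul_left, ← (s1.mul_left _).tsum_sub s2]
    refine hasSum_of_telescoping (g := fun m => -(1 - w) * ((1 - q ^ m) *
      (poch x q m / poch q q m) * (poch w q m)⁻¹ * wpNum x w q m))
      ((s1.mul_left _).sub s2) ?_ (by simp) ?_
    · intro m
      have hwm : 1 - w * q ^ m ≠ 0 := sub_ne_zero.2 (hw m).symm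
      have hp := poch_ne_zero hw m
      have hQ := poch_ne_zero' hq hq m
      have hq1 := one_sub_pow_ne_zero hq m
      rw [pow_succ'] at hq1
      have e1 : poch (w * q) q m = poch w q m * (1 - w * q ^ m) / (1 - w) := by
        rw [eq_div_iff hw0, mul_comm, ← poch_succ', poch_succ]
      rw [wpTerm, wpTerm', wpNum_mul, wpNum_succ, e1, poch_succ, poch_succ, poch_succ, two_mul,
        pow_add, pow_succ']
      generalize q ^ m = u at *
      have hq2 : 1 - u * q ≠ 0 := by rwa [mul_comm]
      field_simp
      ring
    · obtain ⟨C, hC⟩ := exists_bound_inv_mul (x := x) hq hw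
      have := (tendsto_wpNum_mul (x := x) (w := w) hq hC).const_mul (-(1 - w))
      simpa using this
  rw [tsum_wpTerm hq (shift_ne_one hw)] at key
  have := qPoch_eq hq w 1
  simp only [poch_succ, poch_zero, pow_zero, mul_one, one_mul, pow_one] at this
  have h2 := qPoch_ne_zero hq (shift_ne_one hw)
  rw [this]
  field_simp
  rw [eq_div_iff h2] at key
  linear_combination key

end MockTheta
namespace MockTheta
open Filter Topology Finset

/-! ### Bailey inversion -/

lemma choose_two_succ (m : ℕ) : (m + 1).choose 2 = m.choose 2 + m := by
  rw [Nat.choose_succ_succ' m 1, Nat.choose_one_right, add_comm]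

lemma choose_two_add (a b : ℕ) : (a + b).choose 2 = a.choose 2 + b.choose 2 + a * b := by
  induction b with
  | zero => simp
  | succ b ih => rw [← add_assoc, choose_two_succ, choose_two_succ, ih]; ring

lemma mul_pred_eq (m : ℕ) : m * (m - 1) = 2 * m.choose 2 := by
  rw [Nat.choose_two_right, Nat.mul_div_cancel' (Nat.even_mul_pred_self m).two_dvd]

lemma sq_eq_choose_two (m : ℕ) : m ^ 2 = 2 * m.choose 2 + m := by
  induction m with
  | zero => rfl
  | succ m ih => rw [choose_two_succ]; linarith

/-- The kernel of Bailey's inversion. -/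
def baileyKer (e : ℕ) (q : ℂ) (j m : ℕ) : ℂ :=
  (-1) ^ m * q ^ m.choose 2 * (poch q q (2 * j + e + m) / poch q q m)

/-- The inverse Bailey transform of a sequence. -/
def baileySum (e : ℕ) (q : ℂ) (β : ℕ → ℂ) (n : ℕ) : ℂ :=
  ∑ p ∈ antidiagonal n, baileyKer e q p.1 p.2 * β p.1

lemma baileyKer_eq (e : ℕ) (q : ℂ) (j m : ℕ) : baileyKer e q j m =
    poch q q (2 * j + e) * ((-1) ^ m * q ^ m.choose 2 *
      (poch (q ^ (2 * j + e + 1)) q m / poch q q m)) := by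
  rw [baileyKer, poch_add, pow_succ' q (2 * j + e)]; ring

lemma exists_norm_baileyKer_le {q : ℂ} (hq : ‖q‖ < 1) (e : ℕ) :
    ∃ C, 0 < C ∧ ∀ j m, ‖baileyKer e q j m‖ ≤ C := by
  obtain ⟨C₂, hC₂, h₂⟩ := exists_norm_poch_le hq q
  obtain ⟨C₃, hC₃, h₃⟩ := exists_norm_inv_poch_le hq (mul_pow_ne_one hq hq)
  refine ⟨C₂ * C₃, by positivity, fun j m => ?_⟩
  have e2 := h₂ 0 (2 * j + e + m)
  have e3 := h₃ 0 m
  simp only [pow_zero, mul_one] at e2 e3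
  rw [baileyKer, norm_mul, div_eq_mul_inv, norm_mul (poch q q _)]
  have : ‖(-1) ^ m * q ^ m.choose 2‖ ≤ 1 := by
    simpa using pow_le_one₀ (norm_nonneg _) hq.le
  calc _ ≤ 1 * (C₂ * C₃) := by gcongr
    _ = _ := one_mul _

/-- Bailey's lemma is an interchange of summation over pairs (j, m) with n = j + m. The double
series converges absolutely because the kernel and β are bounded while γ decays geometrically. The
parameter e corresponds to a = q^(e+1) in the usual notation; the factor 1 - a q^(2n) of the
classical α_n is carried by γ. -/
theorem tsum_mul_baileySum {q : ℂ} (hq : ‖q‖ < 1) (e : ℕ) {γ β δ : ℕ → ℂ} {C s B : ℝ}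
    (hs0 : 0 ≤ s) (hs1 : s < 1) (hγ : ∀ n, ‖γ n‖ ≤ C * s ^ n) (hβ : ∀ j, ‖β j‖ ≤ B)
    (hδ : ∀ j, ∑' m, γ (j + m) * baileyKer e q j m = δ j) :
    ∑' n, γ n * baileySum e q β n = ∑' j, δ j * β j := by
  obtain ⟨D, hD, hker⟩ := exists_norm_baileyKer_le hq e
  have hC : 0 ≤ C := by simpa using (norm_nonneg _).trans (hγ 0)
  have hB : 0 ≤ B := (norm_nonneg _).trans (hβ 0)
  have hsum : Summable fun p : ℕ × ℕ => γ (p.1 + p.2) * baileyKer e q p.1 p.2 * β p.1 := by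
    have hg := summable_geometric_of_lt_one hs0 hs1
    refine Summable.of_norm_bounded (g := fun p : ℕ × ℕ => (C * D * B) * (s ^ p.1 * s ^ p.2))
      ((hg.mul_of_nonneg hg (fun _ => by positivity) (fun _ => by positivity)).mul_left _)
      fun p => ?_
    rw [norm_mul, norm_mul]
    calc _ ≤ (C * s ^ (p.1 + p.2)) * D * B := by
          gcongr
          · exact hγ _
          · exact hker _ _
          · exact hβ _
      _ = _ := by rw [pow_add]; ring
  have h1 := hsum.tsum_prod
  simp only [tsum_mul_right, hδ] at h1
  rw [← h1, ← HasAntidiagonal.sigmaAntidiagonalEquivProd.tsum_eq]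
  refine Eq.trans (tsum_congr fun n => ?_) (Summable.tsum_sigma'
    (fun n => (hasSum_fintype _).summable)
      (HasAntidiagonal.sigmaAntidiagonalEquivProd.summable_iff.2 hsum)).symm
  rw [tsum_fintype, baileySum, mul_sum, ← sum_coe_sort (antidiagonal n)]
  refine sum_congr rfl fun p _ => ?_
  have := mem_antidiagonal.1 p.2
  simp only [Function.comp_apply, HasAntidiagonal.sigmaAntidiagonalEquivProd_apply]
  rw [this, mul_assoc]

lemma poch_mul_qPoch {q : ℂ} (hq : ‖q‖ < 1) (n : ℕ) :
    poch q q n * qPoch (q ^ (n + 1)) q = qPoch q q := by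
  rw [qPoch_eq hq q n, pow_succ']

/-- With x = q^(2j+e+1) the kernel contributes (x)_m / (q)_m together with (q)_(2j+e), and
(q)_(2j+e) (x)_∞ = (q)_∞. The weight γ only has to supply the rest of the well-poised summand. -/
lemma tsum_baileyKer_of_wpTerm {q : ℂ} (hq : ‖q‖ < 1) {e j : ℕ} {γ : ℕ → ℂ} {A w : ℂ}
    (hw : ∀ i, w * q ^ i ≠ 1)
    (h : ∀ m, γ m * ((-1) ^ m * q ^ m.choose 2) = A * (wpNum (q ^ (2 * j + e + 1) * q) w q m
      / poch w q m * (1 - q ^ (2 * j + e + 1) * q ^ (2 * m)))) :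
    ∑' m, γ m * baileyKer e q j m = A * (qPoch q q / qPoch w q) := by
  have : ∀ m, γ m * baileyKer e q j m
      = A * poch q q (2 * j + e) * wpTerm (q ^ (2 * j + e + 1)) w q m := by
    intro m
    rw [baileyKer_eq, wpTerm]
    linear_combination (poch q q (2 * j + e) * (poch (q ^ (2 * j + e + 1)) q m / poch q q m)) * h m
  rw [tsum_congr this, tsum_mul_left, tsum_wpTerm hq hw, ← poch_mul_qPoch hq (2 * j + e)]
  ring

lemma tsum_baileyKer_of_wpTerm' {q : ℂ} (hq : ‖q‖ < 1) {e j : ℕ} {γ : ℕ → ℂ} {A w : ℂ}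
    (hw : ∀ i, w * q ^ i ≠ 1)
    (h : ∀ m, γ m * ((-1) ^ m * q ^ m.choose 2) = A * (wpNum (q ^ (2 * j + e + 1)) w q m
      / poch w q m + q ^ (2 * j + e + 1) * q ^ m *
      (wpNum (q ^ (2 * j + e + 1)) w q (m + 1) / poch w q (m + 1)))) :
    ∑' m, γ m * baileyKer e q j m = A * (qPoch q q / qPoch w q) := by
  have : ∀ m, γ m * baileyKer e q j m
      = A * poch q q (2 * j + e) * wpTerm' (q ^ (2 * j + e + 1)) w q m := by
    intro m
    rw [baileyKer_eq, wpTerm']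
    linear_combination (poch q q (2 * j + e) * (poch (q ^ (2 * j + e + 1)) q m / poch q q m)) * h m
  rw [tsum_congr this, tsum_mul_left, tsum_wpTerm' hq hw, ← poch_mul_qPoch hq (2 * j + e)]
  ring

/-! ### The conjugate Bailey pairs -/

lemma wpNum_zero_mid (x q : ℂ) (m : ℕ) :
    wpNum x 0 q m = (-1) ^ m * q ^ m.choose 2 * (q ^ (2 * m.choose 2) * x ^ m) := by
  induction m with
  | zero => simp
  | succ m ih => rw [wpNum_succ, ih, choose_two_succ]; ring

/-- Each factor w - w r q^i is w (1 - r q^i). In the applications r is w, or differs from it by one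
power of the base, so that (r)_m cancels (w)_m up to at most two linear factors. -/
lemma wpNum_mul_mid (w r q : ℂ) (m : ℕ) :
    wpNum (w * r) w q m = q ^ (2 * m.choose 2) * w ^ m * poch r q m := by
  induction m with
  | zero => simp
  | succ m ih => rw [wpNum_succ, ih, choose_two_succ, poch_succ]; ring

lemma poch_mul_q (r q : ℂ) (m : ℕ) : (1 - r) * poch (r * q) q m = poch r q m * (1 - r * q ^ m) := by
  rw [← poch_succ', poch_succ]

section conjugate
variable {q : ℂ} (hq : ‖q‖ < 1)
include hq

lemma conj_bailey₁ (e j : ℕ) :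
    ∑' m, (q ^ ((j + m) ^ 2 + (1 + e) * (j + m)) * (1 - q ^ (2 * (j + m) + e + 1)))
      * baileyKer e q j m = q ^ (j ^ 2 + (1 + e) * j) * qPoch q q := by
  have := tsum_baileyKer_of_wpTerm (e := e) (j := j) (w := 0) (A := q ^ (j ^ 2 + (1 + e) * j)) hq
    (γ := fun m => (q ^ ((j + m) ^ 2 + (1 + e) * (j + m)) * (1 - q ^ (2 * (j + m) + e + 1))))
    (by simp) (fun m => by
      have : (j + m) ^ 2 + (1 + e) * (j + m)
          = j ^ 2 + (1 + e) * j + ((2 * j + e + 1) * m + m + 2 * m.choose 2) := by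
        nlinarith [sq_eq_choose_two m]
      rw [wpNum_zero_mid, this]
      simp only [poch_zero_left]
      ring)
  simpa using this

lemma conj_bailey₂ (e j : ℕ) :
    ∑' m, (q ^ ((j + m) ^ 2 + e * (j + m)) * (1 - q ^ (4 * (j + m) + 2 * e + 2)))
      * baileyKer e q j m = q ^ (j ^ 2 + e * j) * qPoch q q := by
  have := tsum_baileyKer_of_wpTerm' (e := e) (j := j) (w := 0) (A := q ^ (j ^ 2 + e * j)) hq
    (γ := fun m => (q ^ ((j + m) ^ 2 + e * (j + m)) * (1 - q ^ (4 * (j + m) + 2 * e + 2))))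
    (by simp) (fun m => by
      have : (j + m) ^ 2 + e * (j + m)
          = j ^ 2 + e * j + ((2 * j + e + 1) * m + 2 * m.choose 2) := by
        nlinarith [sq_eq_choose_two m]
      rw [wpNum_zero_mid, wpNum_zero_mid, this, choose_two_succ]
      simp only [poch_zero_left]
      ring)
  simpa using this

omit hq in
lemma neg_pow_mul_pow_ne_one {p : ℂ} (hp : ‖p‖ < 1) {q : ℂ} (hq : ‖q‖ < 1) (k i : ℕ) :
    -p ^ (k + 1) * q ^ i ≠ 1 :=
  mul_pow_ne_one hq (by simpa using pow_lt_one₀ (norm_nonneg _) hp (Nat.succ_ne_zero k)) i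

omit hq in
lemma poch_neg_mul_qPoch {p q : ℂ} (hq : ‖q‖ < 1) (j : ℕ) :
    poch (-p) q j * qPoch (-(p * q ^ j)) q = qPoch (-p) q := by
  rw [qPoch_eq hq (-p) j, neg_mul]

/-- Here w = -q^(j+1) satisfies w² = xq, so numerator and denominator cancel completely. Since
(-q)_j (w)_∞ = (-q)_∞, the evaluation produces (-q)_j. -/
lemma conj_bailey₃ (j : ℕ) :
    ∑' m, (q ^ (j + m + 1).choose 2 * (1 - q ^ (2 * (j + m) + 1))) * baileyKer 0 q j m
      = q ^ (j + 1).choose 2 * poch (-q) q j * (qPoch q q / qPoch (-q) q) := by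
  have hw := neg_pow_mul_pow_ne_one hq hq j
  have h1 := qPoch_ne_zero hq hw
  have h2 : qPoch (-q) q ≠ 0 := qPoch_ne_zero' hq (by simpa using hq)
  have := tsum_baileyKer_of_wpTerm (e := 0) (j := j) (w := -q ^ (j + 1)) hq
    (γ := fun m => q ^ (j + m + 1).choose 2 * (1 - q ^ (2 * (j + m) + 1)))
    (A := q ^ (j + 1).choose 2) hw (fun m => by
      have hp := poch_ne_zero hw m
      have e1 : q ^ (2 * j + 0 + 1) * q = -q ^ (j + 1) * -q ^ (j + 1) := by ring
      rw [e1, wpNum_mul_mid, add_right_comm j m 1, choose_two_add, mul_div_cancel_right₀ _ hp]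
      rw [neg_pow (q ^ (j + 1))]
      ring)
  rw [this, ← poch_neg_mul_qPoch (p := q) hq j, ← pow_succ']
  have h3 : poch (-q) q j ≠ 0 := poch_ne_zero' hq (by simpa using hq) j
  field_simp

/-- In the contiguous sum take w = -q^(j+1) and x = w · (-q^j). The quotient (-q^j)_m / (-q^(j+1))_m
leaves the single denominator 1 + q^(j+m), which is why inverses appear in the weight. -/
lemma conj_bailey₄ (j : ℕ) :
    ∑' m, (2 * q ^ (j + m + 1).choose 2 * ((1 + q ^ (j + m))⁻¹
        - q ^ (3 * (j + m) + 2) * (1 + q ^ (j + m + 1))⁻¹)) * baileyKer 0 q j m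
      = q ^ (j + 1).choose 2 * poch (-1) q j * (qPoch q q / qPoch (-q) q) := by
  have hw := neg_pow_mul_pow_ne_one hq hq j
  have h1 := qPoch_ne_zero hq hw
  have h2 : qPoch (-q) q ≠ 0 := qPoch_ne_zero' hq (by simpa using hq)
  have hne : ∀ k, 1 + q ^ k ≠ 0 := by
    intro k
    rcases k with _ | k
    · norm_num
    · have := neg_pow_mul_pow_ne_one hq hq k 0
      intro h
      apply this
      linear_combination -h
  have := tsum_baileyKer_of_wpTerm' (e := 0) (j := j) (w := -q ^ (j + 1)) hq
    (γ := fun m => 2 * q ^ (j + m + 1).choose 2 * ((1 + q ^ (j + m))⁻¹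
        - q ^ (3 * (j + m) + 2) * (1 + q ^ (j + m + 1))⁻¹))
    (A := 2 * q ^ (j + 1).choose 2 * (1 + q ^ j)⁻¹) hw (fun m => by
      have hp := poch_ne_zero hw m
      have hp1 := poch_ne_zero hw (m + 1)
      have e1 : q ^ (2 * j + 0 + 1) = -q ^ (j + 1) * -q ^ j := by ring
      have e2 : ∀ m, poch (-q ^ j) q m / poch (-q ^ (j + 1)) q m
          = (1 + q ^ j) * (1 + q ^ (j + m))⁻¹ := by
        intro m
        rw [div_eq_iff (poch_ne_zero hw m), mul_right_comm, eq_mul_inv_iff_mul_eq₀ (hne _)]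
        have := poch_mul_q (-q ^ j) q m
        rw [neg_mul, ← pow_succ, sub_neg_eq_add, neg_mul, ← pow_add, sub_neg_eq_add] at this
        exact this.symm
      rw [e1, wpNum_mul_mid, wpNum_mul_mid, mul_div_assoc, mul_div_assoc, e2, e2,
        add_right_comm j m 1, choose_two_add, choose_two_succ m, neg_pow (q ^ (j + 1)),
        neg_pow (q ^ (j + 1))]
      have a1 := hne j
      have a2 := hne (j + m)
      have a3 := hne (j + m + 1)
      rw [add_right_comm j m 1] at a3
      rw [← add_assoc j m 1, add_right_comm j m 1]
      field_simp
      ring)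
  rw [this, ← poch_neg_mul_qPoch (p := q) hq j, ← pow_succ']
  have h3 : poch (-q) q j ≠ 0 := poch_ne_zero' hq (by simpa using hq) j
  have h4 : poch (-1) q j * (1 + q ^ j) = 2 * poch (-q) q j := by
    have := poch_mul_q (-1) q j
    simp only [neg_mul, one_mul, sub_neg_eq_add] at this
    rw [← this]; norm_num
  have a1 := hne j
  field_simp
  linear_combination -(q ^ (j + 1).choose 2 * qPoch q q) * h4

end conjugate

section conjugate_sqrt
variable {p : ℂ} (hp : ‖p‖ < 1)
include hp

lemma norm_sq_lt_one : ‖p ^ 2‖ < 1 := by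
  rw [norm_pow]; exact pow_lt_one₀ (norm_nonneg _) hp two_ne_zero

/-- In base p², with w = -p^(2j+3) and second factor -p^(2j+1), the incomplete cancellation leaves
1/(1 + p^(2n+1)), where n = j + m. This is absorbed by 1 - p^(4n+2) = (1 - p^(2n+1)) (1 + p^(2n+1)).
-/
lemma conj_bailey₅ (j : ℕ) :
    ∑' m, (p ^ ((j + m) ^ 2 + 2 * (j + m)) * (1 - p ^ (2 * (j + m) + 1)))
        * baileyKer 0 (p ^ 2) j m
      = p ^ (j ^ 2 + 2 * j) * poch (-p) (p ^ 2) j *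
        (qPoch (p ^ 2) (p ^ 2) / qPoch (-p) (p ^ 2)) := by
  have hq := norm_sq_lt_one hp
  have hw := neg_pow_mul_pow_ne_one hp hq (2 * j + 2)
  have hr := neg_pow_mul_pow_ne_one hp hq (2 * j)
  have h2 : qPoch (-p) (p ^ 2) ≠ 0 := qPoch_ne_zero' hq (by simpa using hp)
  have hr0 : 1 + p ^ (2 * j + 1) ≠ 0 := by
    intro h; apply hr 0; linear_combination -h
  have := tsum_baileyKer_of_wpTerm (e := 0) (j := j) (w := -p ^ (2 * j + 3)) hq
    (γ := fun m => p ^ ((j + m) ^ 2 + 2 * (j + m)) * (1 - p ^ (2 * (j + m) + 1)))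
    (A := p ^ (j ^ 2 + 2 * j) * (1 + p ^ (2 * j + 1))⁻¹) hw (fun m => by
      have hpm := poch_ne_zero hr m
      have hrm : 1 + p ^ (2 * j + 1) * (p ^ 2) ^ m ≠ 0 := by
        intro h; apply hr m; linear_combination -h
      have e1 : (p ^ 2) ^ (2 * j + 0 + 1) * p ^ 2 = -p ^ (2 * j + 3) * -p ^ (2 * j + 1) := by ring
      have e2 : poch (-p ^ (2 * j + 3)) (p ^ 2) m = poch (-p ^ (2 * j + 1)) (p ^ 2) m
          * (1 + p ^ (2 * j + 1) * (p ^ 2) ^ m) / (1 + p ^ (2 * j + 1)) := by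
        rw [eq_div_iff hr0]
        have := poch_mul_q (-p ^ (2 * j + 1)) (p ^ 2) m
        rw [show -p ^ (2 * j + 1) * p ^ 2 = -p ^ (2 * j + 3) by ring] at this
        linear_combination this
      rw [e1, wpNum_mul_mid, e2, neg_pow (p ^ (2 * j + 3))]
      have : (j + m) ^ 2 + 2 * (j + m) = j ^ 2 + 2 * j + (2 * j * m + 2 * m.choose 2 + 3 * m) := by
        nlinarith [sq_eq_choose_two m]
      rw [this]
      field_simp
      ring)
  rw [this, ← poch_neg_mul_qPoch (p := p) hq (j + 1), poch_succ]
  have h3 : poch (-p) (p ^ 2) j ≠ 0 := poch_ne_zero' hq (by simpa using hp) j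
  rw [show p * (p ^ 2) ^ (j + 1) = p ^ (2 * j + 3) by ring,
    show 1 - -p * (p ^ 2) ^ j = 1 + p ^ (2 * j + 1) by ring]
  have h1 := qPoch_ne_zero hq hw
  rw [show 2 * j + 2 + 1 = 2 * j + 3 by ring] at h1
  field_simp

lemma conj_bailey₆ (j : ℕ) :
    ∑' m, (p ^ ((j + m) ^ 2) * (1 - p ^ (6 * (j + m) + 3))) * baileyKer 0 (p ^ 2) j m
      = p ^ (j ^ 2) * poch (-p) (p ^ 2) j * (qPoch (p ^ 2) (p ^ 2) / qPoch (-p) (p ^ 2)) := by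
  have hq := norm_sq_lt_one hp
  have hw := neg_pow_mul_pow_ne_one hp hq (2 * j)
  have h2 : qPoch (-p) (p ^ 2) ≠ 0 := qPoch_ne_zero' hq (by simpa using hp)
  have := tsum_baileyKer_of_wpTerm' (e := 0) (j := j) (w := -p ^ (2 * j + 1)) hq
    (γ := fun m => p ^ ((j + m) ^ 2) * (1 - p ^ (6 * (j + m) + 3)))
    (A := p ^ (j ^ 2)) hw (fun m => by
      have e1 : (p ^ 2) ^ (2 * j + 0 + 1) = -p ^ (2 * j + 1) * -p ^ (2 * j + 1) := by ring
      rw [e1, wpNum_mul_mid, wpNum_mul_mid, mul_div_cancel_right₀ _ (poch_ne_zero hw m),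
        mul_div_cancel_right₀ _ (poch_ne_zero hw (m + 1)), neg_pow (p ^ (2 * j + 1)),
        neg_pow (p ^ (2 * j + 1)), choose_two_succ]
      have : (j + m) ^ 2 = j ^ 2 + (2 * j * m + 2 * m.choose 2 + m) := by
        nlinarith [sq_eq_choose_two m]
      rw [this]
      ring)
  rw [this, ← poch_neg_mul_qPoch (p := p) hq j]
  have h3 : poch (-p) (p ^ 2) j ≠ 0 := poch_ne_zero' hq (by simpa using hp) j
  rw [show p * (p ^ 2) ^ j = p ^ (2 * j + 1) by ring]
  have h1 := qPoch_ne_zero hq hw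
  field_simp

end conjugate_sqrt

end MockTheta
namespace MockTheta
open Filter Topology Finset

/-! ### The inverse Bailey transform of `1 / (b)_{j + 1}` -/

lemma sum_Icc_neg_succ (f : ℤ → ℂ) (n : ℕ) :
    ∑ j ∈ Icc (-((n + 1 : ℕ) : ℤ)) (n + 1 : ℕ), f j
      = ∑ j ∈ Icc (-(n : ℤ)) n, f j + (f (n + 1) + f (-(n + 1))) := by
  have : Icc (-((n + 1 : ℕ) : ℤ)) (n + 1 : ℕ)
      = insert ((n : ℤ) + 1) (insert (-((n : ℤ) + 1)) (Icc (-(n : ℤ)) n)) := by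
    ext j; simp only [mem_Icc, mem_insert]; push_cast; omega
  rw [this, sum_insert, sum_insert]
  · ring
  · simp only [mem_Icc]; omega
  · simp only [mem_Icc, mem_insert]; omega

lemma sum_Icc_zero_succ (f : ℤ → ℂ) (n : ℕ) :
    ∑ j ∈ Icc (0 : ℤ) (2 * ((n + 1 : ℕ) : ℤ)), f j
      = ∑ j ∈ Icc (0 : ℤ) (2 * n), f j + (f (2 * n + 1) + f (2 * n + 2)) := by
  have : Icc (0 : ℤ) (2 * ((n + 1 : ℕ) : ℤ))
      = insert (2 * (n : ℤ) + 1) (insert (2 * (n : ℤ) + 2) (Icc (0 : ℤ) (2 * n))) := by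
    ext j; simp only [mem_Icc, mem_insert]; push_cast; omega
  rw [this, sum_insert, sum_insert]
  · ring
  · simp only [mem_Icc]; omega
  · simp only [mem_Icc, mem_insert]; omega

lemma baileySum_eq_range (e : ℕ) (q : ℂ) (β : ℕ → ℂ) (n : ℕ) :
    baileySum e q β n = ∑ j ∈ range (n + 1), baileyKer e q j (n - j) * β j :=
  Nat.sum_antidiagonal_eq_sum_range_succ (fun j m => baileyKer e q j m * β j) n

/-- Creative telescoping in j. The single parameter b covers all the Bailey pairs needed for the
mock theta functions: b = 0, b = -1, and b = p in base p². In each case the two coefficients become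
proportional to consecutive values of one sequence, so the recurrence can be solved as a finite sum.
-/
theorem baileySum_inv_poch_rec {q b : ℂ} (hq : ‖q‖ < 1) (hb : ∀ i, b * q ^ i ≠ 1) (n : ℕ) :
    (1 - b * q ^ (n + 1)) * baileySum 0 q (fun j => (poch b q (j + 1))⁻¹) (n + 1)
      + q ^ (3 * n + 2) * (b - q ^ (n + 1)) * baileySum 0 q (fun j => (poch b q (j + 1))⁻¹) n
      = (-1) ^ (n + 1) * q ^ (n + 2).choose 2 * (1 + q ^ (n + 1)) := by
  -- The certificate. Its value at j = 0 produces the inhomogeneous term, and its value at j = n + 1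
  -- cancels the top summand, which occurs only in the transform at n + 1.
  set G : ℕ → ℂ := fun j => -q ^ (n + 1 - j) * (1 - q ^ (2 * n + 2)) * ((-1) ^ (n + 1 - j) *
    q ^ (n + 1 - j).choose 2 * poch q q (n + j)) / (poch q q (n + 1 - j) * poch b q j) with hG
  have step : ∀ j ∈ range (n + 1), (1 - b * q ^ (n + 1)) *
      (baileyKer 0 q j (n + 1 - j) * (poch b q (j + 1))⁻¹) + q ^ (3 * n + 2) * (b - q ^ (n + 1)) *
      (baileyKer 0 q j (n - j) * (poch b q (j + 1))⁻¹) = G (j + 1) - G j := by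
    intro j hj
    obtain ⟨m, rfl⟩ := Nat.exists_eq_add_of_le (Nat.lt_succ_iff.1 (mem_range.1 hj))
    have e1 : j + m + 1 - j = m + 1 := by omega
    have e2 : j + m - j = m := by omega
    have e3 : j + m + 1 - (j + 1) = m := by omega
    have e4 : 2 * j + 0 + (m + 1) = 2 * j + m + 1 := by omega
    have e5 : j + m + (j + 1) = 2 * j + m + 1 := by omega
    have e6 : j + m + j = 2 * j + m := by omega
    simp only [hG, baileyKer, e1, e2, e3, e4, e5, e6]
    have h1 : poch b q j ≠ 0 := poch_ne_zero hb j
    have h2 : poch q q m ≠ 0 := poch_ne_zero' hq hq m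
    have h3 := one_sub_pow_ne_zero hq m
    have h4 : 1 - b * q ^ j ≠ 0 := sub_ne_zero.2 (hb j).symm
    rw [poch_succ q q m, poch_succ q q (2 * j + m), poch_succ b, choose_two_succ]
    rw [pow_succ'] at h3
    have h5 : 1 - q ^ m * q ≠ 0 := by rwa [mul_comm]
    simp only [mul_add, pow_add, pow_mul, pow_succ, pow_zero]
    field_simp
    ring_nf
  have last : (1 - b * q ^ (n + 1)) * (baileyKer 0 q (n + 1) (n + 1 - (n + 1)) *
      (poch b q (n + 1 + 1))⁻¹) = -G (n + 1) := by
    have h1 : poch b q (n + 1) ≠ 0 := poch_ne_zero hb _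
    have h4 : 1 - b * q ^ (n + 1) ≠ 0 := sub_ne_zero.2 (hb _).symm
    have e5 : n + (n + 1) = 2 * n + 1 := by omega
    have e4 : 2 * (n + 1) = 2 * n + 1 + 1 := by omega
    simp only [hG, baileyKer, Nat.sub_self, pow_zero, poch_zero, Nat.choose_zero_succ, add_zero, e5,
      e4]
    rw [poch_succ b q (n + 1), poch_succ q q (2 * n + 1)]
    field_simp
    ring
  have first : G 0 = -((-1) ^ (n + 1) * q ^ (n + 2).choose 2 * (1 + q ^ (n + 1))) := by
    have h2 : poch q q n ≠ 0 := poch_ne_zero' hq hq n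
    have h3 := one_sub_pow_ne_zero hq n
    simp only [hG, Nat.sub_zero, poch_zero, add_zero, mul_one]
    rw [poch_succ, choose_two_succ (n + 1)]
    rw [show q * q ^ n = q ^ (n + 1) by ring, show q ^ (2 * n + 2) = q ^ (n + 1) * q ^ (n + 1) by ring]
    field_simp
    ring
  rw [baileySum_eq_range, baileySum_eq_range, sum_range_succ _ (n + 1), mul_add, mul_sum, mul_sum,
    add_right_comm, ← sum_add_distrib, sum_congr rfl step, sum_range_sub, last, first]
  ring

lemma baileySum_zero (e : ℕ) (q : ℂ) (β : ℕ → ℂ) : baileySum e q β 0 = poch q q e * β 0 := by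
  simp [baileySum, baileyKer]

lemma two_mul_choose_cast (n : ℕ) : 2 * ((n.choose 2 : ℕ) : ℤ) = (n : ℤ) ^ 2 - n := by
  have := sq_eq_choose_two n
  zify at this
  linarith

lemma exists_three_mul_sq_add (j : ℤ) : ∃ k, 3 * j ^ 2 + j = 2 * k := by
  have : Even (3 * j ^ 2 + j) := by
    have := Int.even_mul_succ_self j
    have h2 : 3 * j ^ 2 + j = j * (j + 1) + 2 * j ^ 2 := by ring
    rw [h2]; exact this.add (even_two_mul _)
  obtain ⟨k, hk⟩ := this
  exact ⟨k, by omega⟩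

lemma mul_zpow_sum {ι : Type*} {q : ℂ} (hq0 : q ≠ 0) (s : Finset ι) (u : ι → ℂ) (c : ℤ) (d : ι → ℤ) :
    ∑ j ∈ s, u j * q ^ (c - d j) = q ^ c * ∑ j ∈ s, u j * q ^ (-d j) := by
  rw [mul_sum]
  refine sum_congr rfl fun j _ => ?_
  rw [sub_eq_add_neg, zpow_add₀ hq0]; ring

/-! ### Closed forms of the inverse transforms: the source of the inner sums over j. -/

section closed
variable {q : ℂ} (hq0 : q ≠ 0) (hq : ‖q‖ < 1)
include hq0 hq

/-- For b = 0 the recurrence reads K_(n+1) = q^(4n+3) K_n plus two monomials. Since 2(n+1)² + (n+1)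
= 4n + 3 + (2n² + n), these monomials are exactly the terms j = n + 1 and j = -(n + 1). -/
lemma baileySum_one (n : ℕ) : baileySum 0 q (fun _ => 1) n =
    q ^ (2 * n ^ 2 + n) * ∑ j ∈ Icc (-(n : ℤ)) n, (-1 : ℂ) ^ j * q ^ (-((3 * j ^ 2 + j) / 2)) := by
  induction n with
  | zero => simp [baileySum_zero]
  | succ n ih =>
    have := baileySum_inv_poch_rec (b := 0) hq (by simp) n
    simp only [poch_zero_left, inv_one, zero_mul, sub_zero, one_mul, zero_sub] at this
    rw [sum_Icc_neg_succ, mul_add, mul_add]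
    have e1 : q ^ (2 * (n + 1) ^ 2 + (n + 1)) * ((-1 : ℂ) ^ ((n : ℤ) + 1) *
        q ^ (-((3 * ((n : ℤ) + 1) ^ 2 + ((n : ℤ) + 1)) / 2)))
        = (-1) ^ (n + 1) * q ^ (n + 2).choose 2 := by
      rw [mul_left_comm, ← zpow_natCast q, ← zpow_add₀ hq0, ← zpow_natCast q, ← zpow_natCast (-1 : ℂ)]
      congr 2
      obtain ⟨k, hk⟩ := exists_three_mul_sq_add ((n : ℤ) + 1)
      have := two_mul_choose_cast (n + 2)
      rw [hk, Int.mul_ediv_cancel_left _ two_ne_zero]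
      push_cast at *
      linarith
    have e2 : q ^ (2 * (n + 1) ^ 2 + (n + 1)) * ((-1 : ℂ) ^ (-((n : ℤ) + 1)) *
        q ^ (-((3 * (-((n : ℤ) + 1)) ^ 2 + (-((n : ℤ) + 1))) / 2)))
        = (-1) ^ (n + 1) * q ^ (n + 2).choose 2 * q ^ (n + 1) := by
      rw [mul_left_comm, ← zpow_natCast q, ← zpow_add₀ hq0, mul_assoc, ← pow_add, ← zpow_natCast q,
        ← zpow_natCast (-1 : ℂ), zpow_neg, ← inv_zpow]
      congr 2
      · norm_num
      obtain ⟨k, hk⟩ := exists_three_mul_sq_add (-((n : ℤ) + 1))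
      have := two_mul_choose_cast (n + 2)
      rw [hk, Int.mul_ediv_cancel_left _ two_ne_zero]
      push_cast at *
      linarith
    rw [e1, e2]
    have e3 : 2 * (n + 1) ^ 2 + (n + 1) = (4 * n + 3) + (2 * n ^ 2 + n) := by ring
    rw [e3, pow_add, mul_assoc, ← ih]
    linear_combination this

/-- The case b = -1, using (-1)_(j+1) = 2 (-q)_j. The factor 1 + q^(n+1) is then common to the whole
recurrence and cancels. -/
lemma baileySum_inv_poch_neg (n : ℕ) : baileySum 0 q (fun j => (poch (-q) q j)⁻¹) n =
    q ^ (n ^ 2 + (n + 1).choose 2) * ∑ j ∈ Icc (-(n : ℤ)) n, (-1 : ℂ) ^ j * q ^ (-(j ^ 2)) := by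
  have hne : ∀ i, 1 + q ^ (i + 1) ≠ 0 := fun i h => by
    have := neg_pow_mul_pow_ne_one hq hq i 0
    apply this; linear_combination -h
  have hb : ∀ i, (-1 : ℂ) * q ^ i ≠ 1 := by
    intro i h
    rcases i with _ | i
    · norm_num at h
    · apply hne i; linear_combination -h
  have e0 : ∀ n, baileySum 0 q (fun j => (poch (-q) q j)⁻¹) n
      = 2 * baileySum 0 q (fun j => (poch (-1) q (j + 1))⁻¹) n := by
    intro n
    rw [baileySum, baileySum, mul_sum]
    refine sum_congr rfl fun p _ => ?_
    rw [poch_succ', mul_inv, neg_mul, one_mul]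
    norm_num
    ring
  induction n with
  | zero => simp [baileySum_zero]
  | succ n ih =>
    have := baileySum_inv_poch_rec (b := -1) hq hb n
    have hn := hne n
    have key : baileySum 0 q (fun j => (poch (-q) q j)⁻¹) (n + 1)
        = q ^ (3 * n + 2) * baileySum 0 q (fun j => (poch (-q) q j)⁻¹) n
          + 2 * ((-1) ^ (n + 1) * q ^ (n + 2).choose 2) := by
      rw [e0, e0]
      refine mul_left_cancel₀ hn ?_
      linear_combination 2 * this
    rw [sum_Icc_neg_succ, mul_add, mul_add]
    have e1 : q ^ ((n + 1) ^ 2 + (n + 1 + 1).choose 2) * ((-1 : ℂ) ^ ((n : ℤ) + 1) *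
        q ^ (-(((n : ℤ) + 1) ^ 2))) = (-1) ^ (n + 1) * q ^ (n + 2).choose 2 := by
      rw [mul_left_comm, ← zpow_natCast q, ← zpow_add₀ hq0, ← zpow_natCast q, ← zpow_natCast (-1 : ℂ)]
      congr 2
      push_cast; ring
    have e2 : q ^ ((n + 1) ^ 2 + (n + 1 + 1).choose 2) * ((-1 : ℂ) ^ (-((n : ℤ) + 1)) *
        q ^ (-((-((n : ℤ) + 1)) ^ 2))) = (-1) ^ (n + 1) * q ^ (n + 2).choose 2 := by
      rw [neg_sq, zpow_neg, ← inv_zpow, show ((-1 : ℂ))⁻¹ = -1 by norm_num, e1]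
    rw [e1, e2, key, ih, choose_two_succ (n + 1)]
    ring

end closed

/-- For b = p in base p² one has b - p^(2n+2) = p (1 - p^(2n+1)), so the natural unknown of the
recurrence is (1 - p^(2n+1)) K_n. -/
lemma baileySum_inv_poch_sqrt {p : ℂ} (hp0 : p ≠ 0) (hp : ‖p‖ < 1) (n : ℕ) :
    (1 - p ^ (2 * n + 1)) * baileySum 0 (p ^ 2) (fun j => (poch p (p ^ 2) (j + 1))⁻¹) n =
    (-1) ^ n * p ^ (3 * n ^ 2 + 2 * n) * ∑ j ∈ Icc (0 : ℤ) (2 * n), p ^ (-((j ^ 2 + j) / 2)) := by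
  have hq := norm_sq_lt_one hp
  have hb := mul_pow_ne_one hq hp
  induction n with
  | zero =>
    have := sub_ne_zero.2 (hb 0).symm
    simp only [pow_zero, mul_one] at this
    simp [baileySum_zero, poch_succ, this]
  | succ n ih =>
    have := baileySum_inv_poch_rec hq hb n
    rw [sum_Icc_zero_succ, mul_assoc, mul_add (p ^ _), mul_add (p ^ _)]
    have e1 : p ^ (3 * (n + 1) ^ 2 + 2 * (n + 1)) * p ^ (-(((2 * (n : ℤ) + 1) ^ 2 + (2 * n + 1)) / 2))
        = (p ^ 2) ^ ((n + 2).choose 2) * (p ^ 2) ^ (n + 1) := by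
      rw [← zpow_natCast p, ← zpow_add₀ hp0, ← pow_mul, ← pow_mul, ← zpow_natCast p (2 * (n + 1)),
        ← zpow_natCast p (2 * _), ← zpow_add₀ hp0]
      congr 1
      have h := two_mul_choose_cast (n + 2)
      rw [show ((2 * (n : ℤ) + 1) ^ 2 + (2 * n + 1)) = 2 * (2 * n ^ 2 + 3 * n + 1) by ring,
        Int.mul_ediv_cancel_left _ two_ne_zero]
      push_cast at *
      linarith
    have e2 : p ^ (3 * (n + 1) ^ 2 + 2 * (n + 1)) * p ^ (-(((2 * (n : ℤ) + 2) ^ 2 + (2 * n + 2)) / 2))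
        = (p ^ 2) ^ ((n + 2).choose 2) := by
      rw [← zpow_natCast p, ← zpow_add₀ hp0, ← pow_mul, ← zpow_natCast p]
      congr 1
      have h := two_mul_choose_cast (n + 2)
      rw [show ((2 * (n : ℤ) + 2) ^ 2 + (2 * n + 2)) = 2 * (2 * n ^ 2 + 5 * n + 3) by ring,
        Int.mul_ediv_cancel_left _ two_ne_zero]
      push_cast at *
      linarith
    rw [e1, e2]
    have e3 : p ^ (3 * (n + 1) ^ 2 + 2 * (n + 1)) = p ^ (6 * n + 5) * p ^ (3 * n ^ 2 + 2 * n) := by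
      ring
    rw [e3]
    linear_combination this - p ^ (6 * n + 5) * ih

end MockTheta
namespace MockTheta
open Filter Topology Finset

/-! ### Eulerian forms of the mock theta functions -/

lemma norm_pow_mul_le {p u : ℂ} {C : ℝ} {k n : ℕ} (hp : ‖p‖ < 1) (hk : n ≤ k) (hu : ‖u‖ ≤ C) :
    ‖p ^ k * u‖ ≤ C * ‖p‖ ^ n := by
  have : 0 ≤ C := (norm_nonneg _).trans hu
  rw [norm_mul, norm_pow, mul_comm]
  exact mul_le_mul hu (pow_le_pow_of_le_one (norm_nonneg _) hp.le hk) (by positivity) this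

lemma norm_one_sub_pow_le {p : ℂ} (hp : ‖p‖ < 1) (k : ℕ) : ‖1 - p ^ k‖ ≤ 2 := by
  refine (norm_sub_le _ _).trans ?_
  rw [norm_one, norm_pow]
  have := pow_le_one₀ (n := k) (norm_nonneg p) hp.le
  linarith

lemma le_choose_two_succ (n : ℕ) : n ≤ (n + 1).choose 2 := by
  rw [choose_two_succ]; omega

lemma exists_norm_inv_poch_le' {a q : ℂ} (hq : ‖q‖ < 1) (ha : ‖a‖ < 1) :
    ∃ C, ∀ n, ‖(poch a q n)⁻¹‖ ≤ C := by
  obtain ⟨C, -, h⟩ := exists_norm_inv_poch_le hq (mul_pow_ne_one hq ha)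
  exact ⟨C, fun n => by simpa using h 0 n⟩

lemma exists_norm_poch_le' {q : ℂ} (hq : ‖q‖ < 1) (a : ℂ) : ∃ C, ∀ n, ‖poch a q n‖ ≤ C := by
  obtain ⟨C, -, h⟩ := exists_norm_poch_le hq a
  exact ⟨C, fun n => by simpa using h 0 n⟩

section euler
variable {q : ℂ} (hq0 : q ≠ 0) (hq : ‖q‖ < 1)
include hq0 hq

/-- The inner sum over j is, up to a power of q, the inverse transform of 1/(-q)_j. The double sum
is therefore ∑ γ_n K_n with γ from `conj_bailey₂`, and Bailey's lemma evaluates it as ∑ δ_j β_j. The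
other Eulerian forms follow the same pattern. -/
lemma tsum_hecke_f0 : ∑' n : ℕ, ∑ j ∈ Icc (-(n : ℤ)) n,
    (-1 : ℂ) ^ j * q ^ ((5 * (n : ℤ) ^ 2 + n) / 2 - j ^ 2) * (1 - q ^ (4 * n + 2))
      = qPoch q q * ∑' n, q ^ n ^ 2 * (poch (-q) q n)⁻¹ := by
  obtain ⟨B, hB⟩ := exists_norm_inv_poch_le' hq (a := -q) (by simpa using hq)
  have := tsum_mul_baileySum hq 0 (norm_nonneg q) hq (γ := fun n => q ^ n ^ 2 * (1 - q ^ (4 * n + 2)))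
    (C := 2) (fun n => norm_pow_mul_le hq (by nlinarith) (norm_one_sub_pow_le hq _)) hB
    (fun j => by simpa using conj_bailey₂ hq 0 j)
  rw [← tsum_mul_left, tsum_congr (fun n => ?_), this]
  · exact tsum_congr fun n => by ring
  · rw [baileySum_inv_poch_neg hq0 hq, ← sum_mul, mul_zpow_sum hq0]
    have : q ^ ((5 * (n : ℤ) ^ 2 + n) / 2) = q ^ n ^ 2 * q ^ (n ^ 2 + (n + 1).choose 2) := by
      rw [← pow_add, ← zpow_natCast]
      congr 1
      have := two_mul_choose_cast (n + 1)
      push_cast at *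
      ring_nf at this ⊢
      omega
    rw [this]; ring

lemma tsum_hecke_f1 : ∑' n : ℕ, ∑ j ∈ Icc (-(n : ℤ)) n,
    (-1 : ℂ) ^ j * q ^ ((5 * (n : ℤ) ^ 2 + 3 * n) / 2 - j ^ 2) * (1 - q ^ (2 * n + 1))
      = qPoch q q * ∑' n, q ^ (n ^ 2 + n) * (poch (-q) q n)⁻¹ := by
  obtain ⟨B, hB⟩ := exists_norm_inv_poch_le' hq (a := -q) (by simpa using hq)
  have := tsum_mul_baileySum hq 0 (norm_nonneg q) hq
    (γ := fun n => q ^ (n ^ 2 + n) * (1 - q ^ (2 * n + 1)))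
    (C := 2) (fun n => norm_pow_mul_le hq (by nlinarith) (norm_one_sub_pow_le hq _)) hB
    (fun j => by simpa using conj_bailey₁ hq 0 j)
  rw [← tsum_mul_left, tsum_congr (fun n => ?_), this]
  · exact tsum_congr fun n => by ring
  · rw [baileySum_inv_poch_neg hq0 hq, ← sum_mul, mul_zpow_sum hq0]
    have : q ^ ((5 * (n : ℤ) ^ 2 + 3 * n) / 2) = q ^ (n ^ 2 + n) * q ^ (n ^ 2 + (n + 1).choose 2) := by
      rw [← pow_add, ← zpow_natCast]
      congr 1
      have := two_mul_choose_cast (n + 1)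
      push_cast at *
      ring_nf at this ⊢
      omega
    rw [this]; ring

theorem f0_eq : f0 q = ∑' n, q ^ n ^ 2 * (poch (-q) q n)⁻¹ := by
  rw [f0, tsum_hecke_f0 hq0 hq, inv_mul_cancel_left₀ (qPoch_ne_zero' hq hq)]

theorem f1_eq : f1 q = ∑' n, q ^ (n ^ 2 + n) * (poch (-q) q n)⁻¹ := by
  rw [f1, tsum_hecke_f1 hq0 hq, inv_mul_cancel_left₀ (qPoch_ne_zero' hq hq)]

theorem psi1_eq : psi1 q = ∑' n, q ^ (n + 1).choose 2 * poch (-q) q n := by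
  have := tsum_mul_baileySum hq 0 (norm_nonneg q) hq (β := fun _ => 1) (B := 1)
    (γ := fun n => q ^ (n + 1).choose 2 * (1 - q ^ (2 * n + 1)))
    (C := 2) (fun n => norm_pow_mul_le hq (le_choose_two_succ n) (norm_one_sub_pow_le hq _))
    (by simp) (conj_bailey₃ hq)
  simp only [mul_one, tsum_mul_right] at this
  have h1 := qPoch_ne_zero' hq hq
  have h2 := qPoch_ne_zero' (a := -q) hq (by simpa using hq)
  rw [psi1, tsum_congr (fun n => ?_), this]
  · field_simp
  · rw [baileySum_one hq0 hq, ← sum_mul, mul_zpow_sum hq0]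
    have : q ^ ((5 * (n : ℤ) ^ 2 + 3 * n) / 2) = q ^ (n + 1).choose 2 * q ^ (2 * n ^ 2 + n) := by
      rw [← pow_add, ← zpow_natCast]
      congr 1
      have := two_mul_choose_cast (n + 1)
      push_cast at *
      ring_nf at this ⊢
      omega
    rw [this]; ring

omit hq0 in
lemma exists_norm_inv_one_add_pow_le : ∃ C, ∀ k, ‖(1 + q ^ k)⁻¹‖ ≤ C := by
  have hb : ∀ i, (-1 : ℂ) * q ^ i ≠ 1 := by
    intro i h
    rcases i with _ | i
    · norm_num at h
    · have := neg_pow_mul_pow_ne_one hq hq i 0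
      apply this; linear_combination h
  obtain ⟨C, -, h⟩ := exists_norm_inv_poch_le hq hb
  refine ⟨C, fun k => ?_⟩
  have := h k 1
  rwa [poch_succ, poch_zero, pow_zero, one_mul, mul_one, neg_mul, one_mul, sub_neg_eq_add] at this

/-- `conj_bailey₄` leaves denominators 1 + q^n that are absent from the Hecke sum. They disappear
after a summation by parts, because the recurrence for K produces the factors 1 + q^(n+1) and 1 -
q^(2n+2). -/
theorem psi0_eq : 1 + 2 * psi0 q = ∑' n, q ^ (n + 1).choose 2 * poch (-1) q n := by
  obtain ⟨C, hC⟩ := exists_norm_inv_one_add_pow_le hq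
  have hC0 : 0 ≤ C := (norm_nonneg _).trans (hC 0)
  have hne : ∀ k, 1 + q ^ k ≠ 0 := by
    intro k h
    rcases k with _ | k
    · norm_num at h
    · have := neg_pow_mul_pow_ne_one hq hq k 0
      apply this; linear_combination -h
  set g : ℕ → ℂ := fun n => q ^ (n + 1).choose 2 * (2 * (1 + q ^ n)⁻¹) with hg
  set K := baileySum 0 q (fun _ => 1) with hK
  have hgC : ∀ n, ‖g n‖ ≤ (2 * C) * ‖q‖ ^ n := fun n => by
    refine norm_pow_mul_le hq (le_choose_two_succ n) ?_
    rw [norm_mul, Complex.norm_two]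
    gcongr
    exact hC n
  have hγ : ∀ n, 2 * q ^ (n + 1).choose 2 * ((1 + q ^ n)⁻¹
        - q ^ (3 * n + 2) * (1 + q ^ (n + 1))⁻¹) = g n - q ^ (2 * n + 1) * g (n + 1) := by
    intro n
    simp only [hg]
    rw [choose_two_succ (n + 1)]
    ring
  have hpow : ∀ k, ‖q ^ k‖ ≤ 1 := fun k => by
    rw [norm_pow]; exact pow_le_one₀ (norm_nonneg _) hq.le
  have := tsum_mul_baileySum hq 0 (norm_nonneg q) hq (β := fun _ => 1) (B := 1)
    (γ := fun n => g n - q ^ (2 * n + 1) * g (n + 1)) (C := 4 * C) (fun n => by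
      refine (norm_sub_le _ _).trans ?_
      have h1 := hgC n
      have h2 : ‖q ^ (2 * n + 1) * g (n + 1)‖ ≤ 1 * ((2 * C) * ‖q‖ ^ n) := by
        rw [norm_mul]
        refine mul_le_mul (hpow _) ((hgC _).trans ?_) (norm_nonneg _) zero_le_one
        gcongr ?_ * ?_
        exact pow_le_pow_of_le_one (norm_nonneg _) hq.le (Nat.le_succ n)
      linarith)
    (by simp) (fun j => by simp only [← hγ]; exact conj_bailey₄ hq j)
  simp only [mul_one, tsum_mul_right, ← hK] at this
  have h1 := qPoch_ne_zero' hq hq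
  have h2 := qPoch_ne_zero' (a := -q) hq (by simpa using hq)
  have hKb : ∃ D, ∀ n, ‖K n‖ ≤ D * (n + 1) := by
    obtain ⟨D, hD, h⟩ := exists_norm_baileyKer_le hq 0
    refine ⟨D, fun n => ?_⟩
    rw [hK, baileySum_eq_range]
    refine (norm_sum_le _ _).trans ?_
    calc _ ≤ ∑ _j ∈ range (n + 1), D := sum_le_sum fun j _ => by simpa using h j (n - j)
      _ = _ := by simp [mul_comm]
  obtain ⟨D, hD⟩ := hKb
  have hD0 : 0 ≤ D := by simpa using (norm_nonneg _).trans (hD 0)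
  have sgK : Summable fun n => g n * K n := by
    have : Summable fun n : ℕ => (2 * C * D) * ((n : ℝ) ^ 1 * ‖q‖ ^ n + ‖q‖ ^ n) :=
      ((summable_pow_mul_geometric_of_norm_lt_one 1 (by simpa using hq)).add
        (summable_geometric_of_lt_one (norm_nonneg _) hq)).mul_left _
    refine Summable.of_norm_bounded this fun n => ?_
    rw [norm_mul]
    calc _ ≤ ((2 * C) * ‖q‖ ^ n) * (D * (n + 1)) := by gcongr; exacts [hgC n, hD n]
      _ = _ := by ring
  have sgK' : Summable fun n => q ^ (2 * n + 1) * g (n + 1) * K n := by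
    have : Summable fun n : ℕ => (2 * C * D) * ((n : ℝ) ^ 1 * ‖q‖ ^ n + ‖q‖ ^ n) :=
      ((summable_pow_mul_geometric_of_norm_lt_one 1 (by simpa using hq)).add
        (summable_geometric_of_lt_one (norm_nonneg _) hq)).mul_left _
    refine Summable.of_norm_bounded this fun n => ?_
    rw [norm_mul, norm_mul]
    calc _ ≤ 1 * ((2 * C) * ‖q‖ ^ n) * (D * (n + 1)) := by
          gcongr
          · exact hpow _
          · refine (hgC _).trans ?_
            gcongr ?_ * ?_
            exact pow_le_pow_of_le_one (norm_nonneg _) hq.le (Nat.le_succ n)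
          · exact hD n
      _ = _ := by ring
  set S₁ : ℕ → ℂ := fun n => if 1 ≤ n then (-1 : ℂ) ^ n * q ^ (n ^ 2 + n) else 0 with hS₁
  set S₂ : ℕ → ℂ := fun n => ∑ j ∈ Ioo (-(n : ℤ)) n,
          (-1 : ℂ) ^ j * q ^ ((5 * (n : ℤ) ^ 2 - n) / 2 - (3 * j ^ 2 + j) / 2) * (1 - q ^ n) with hS₂
  have sS₁ : Summable S₁ := by
    refine Summable.of_norm_bounded (summable_geometric_of_lt_one (norm_nonneg _) hq) fun n => ?_
    simp only [hS₁]
    split_ifs with h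
    · rw [norm_mul, norm_pow, norm_neg, norm_one, one_pow, one_mul, norm_pow]
      exact pow_le_pow_of_le_one (norm_nonneg _) hq.le (by nlinarith)
    · simp
  -- The inhomogeneous term of the recurrence gives the single theta-like series. The remainder,
  -- proportional to q^(4n+3) - q^(2n+1), gives the double series after division by 1 + q^(n+1).
  have hrec : ∀ n, g (n + 1) * K (n + 1) - q ^ (2 * n + 1) * g (n + 1) * K n
      = 2 * S₁ (n + 1) - 2 * S₂ (n + 1) := by
    intro n
    have hr := baileySum_inv_poch_rec (b := 0) hq (by simp) n
    simp only [poch_zero_left, inv_one, zero_mul, sub_zero, one_mul, zero_sub, ← hK] at hr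
    have eS₁ : S₁ (n + 1) = (-1) ^ (n + 1) * (q ^ (n + 2).choose 2 * q ^ (n + 2).choose 2) := by
      simp only [hS₁, if_pos (Nat.le_add_left 1 n)]
      rw [← pow_add]
      congr 2
      have := two_mul_choose_cast (n + 2)
      zify
      push_cast at *
      linarith
    have eS₂ : S₂ (n + 1) = q ^ (n + 2).choose 2 * q ^ (2 * n + 1) * K n * (1 - q ^ (n + 1)) := by
      simp only [hS₂]
      have : Ioo (-((n + 1 : ℕ) : ℤ)) (n + 1 : ℕ) = Icc (-(n : ℤ)) n := by
        ext j; simp only [mem_Ioo, mem_Icc]; push_cast; omega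
      rw [this, ← sum_mul, mul_zpow_sum hq0, hK, baileySum_one hq0 hq]
      have : q ^ ((5 * ((n + 1 : ℕ) : ℤ) ^ 2 - (n + 1 : ℕ)) / 2)
          = q ^ (n + 2).choose 2 * q ^ (2 * n + 1) * q ^ (2 * n ^ 2 + n) := by
        rw [← pow_add, ← pow_add, ← zpow_natCast]
        congr 1
        have := two_mul_choose_cast (n + 2)
        push_cast at *
        ring_nf at this ⊢
        omega
      rw [this]; ring
    rw [eS₁, eS₂]
    simp only [hg]
    have hn := hne (n + 1)
    field_simp
    linear_combination hr
  have hg0 : g 0 * K 0 = 1 := by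
    simp [hg, hK, baileySum_zero]
    norm_num
  have sS₂ : Summable S₂ := by
    rw [← summable_nat_add_iff 1]
    have : ∀ n, S₂ (n + 1) = S₁ (n + 1) - (g (n + 1) * K (n + 1) - q ^ (2 * n + 1) * g (n + 1) * K n) / 2 := by
      intro n
      rw [hrec]; ring
    rw [summable_congr this]
    exact ((summable_nat_add_iff 1).2 sS₁).sub
      ((((summable_nat_add_iff 1).2 sgK).sub sgK').div_const 2)
  -- Summation by parts: shift the index in ∑ g n K n; the term n = 0 contributes the 1.
  have abel : ∑' n, (g n - q ^ (2 * n + 1) * g (n + 1)) * K n = 1 + 2 * ∑' n, S₁ n - 2 * ∑' n, S₂ n := by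
    have e1 : ∑' n, (g n - q ^ (2 * n + 1) * g (n + 1)) * K n
        = ∑' n, g n * K n - ∑' n, q ^ (2 * n + 1) * g (n + 1) * K n := by
      rw [← sgK.tsum_sub sgK']
      exact tsum_congr fun n => by ring
    rw [e1, sgK.tsum_eq_zero_add, hg0, add_sub_assoc,
      ← ((summable_nat_add_iff 1).2 sgK).tsum_sub sgK', tsum_congr hrec,
      (((summable_nat_add_iff 1).2 sS₁).mul_left 2).tsum_sub
        (((summable_nat_add_iff 1).2 sS₂).mul_left 2), tsum_mul_left, tsum_mul_left,
      sS₁.tsum_eq_zero_add, sS₂.tsum_eq_zero_add]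
    simp [hS₁, hS₂]
    ring
  rw [abel] at this
  rw [psi0]
  have e : 1 + 2 * (∑' n, S₁ n) - 2 * ∑' n, S₂ n = (∑' n, q ^ (n + 1).choose 2 * poch (-1) q n)
      * (qPoch q q / qPoch (-q) q) := this
  simp only [hS₁, hS₂] at e
  rw [e]
  field_simp
  ring

end euler

section euler_sqrt
variable {p : ℂ} (hp0 : p ≠ 0) (hp : ‖p‖ < 1)
include hp0 hp

theorem phi0_eq : phi0 p = ∑' n, p ^ n ^ 2 * poch (-p) (p ^ 2) n := by
  have hq := norm_sq_lt_one hp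
  have hq0 : p ^ 2 ≠ 0 := pow_ne_zero 2 hp0
  have := tsum_mul_baileySum hq 0 (norm_nonneg p) hp (β := fun _ => 1) (B := 1)
    (γ := fun n => p ^ n ^ 2 * (1 - p ^ (6 * n + 3)))
    (C := 2) (fun n => norm_pow_mul_le hp (by nlinarith) (norm_one_sub_pow_le hp _))
    (by simp) (conj_bailey₆ hp)
  simp only [mul_one, tsum_mul_right] at this
  have h1 := qPoch_ne_zero' hq hq
  have h2 := qPoch_ne_zero' (a := -p) hq (by simpa using hp)
  rw [phi0, tsum_congr (fun n => ?_), this]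
  · field_simp
  · rw [baileySum_one hq0 hq, ← sum_mul]
    simp only [sub_sub]
    rw [mul_zpow_sum hp0]
    have : p ^ (5 * (n : ℤ) ^ 2 + 2 * n) = p ^ n ^ 2 * (p ^ 2) ^ (2 * n ^ 2 + n) := by
      rw [← pow_mul, ← pow_add, ← zpow_natCast]
      congr 1
      push_cast
      ring
    rw [this]
    have e : ∀ j : ℤ, (p ^ 2) ^ (-((3 * j ^ 2 + j) / 2)) = p ^ (-(3 * j ^ 2 + j)) := by
      intro j
      rw [← zpow_natCast p 2, ← zpow_mul]
      congr 1
      obtain ⟨k, hk⟩ := exists_three_mul_sq_add j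
      rw [hk]
      push_cast
      omega
    simp only [e]
    ring

theorem phi1_eq : phi1 p = p * ∑' n, p ^ (n ^ 2 + 2 * n) * poch (-p) (p ^ 2) n := by
  have hq := norm_sq_lt_one hp
  have hq0 : p ^ 2 ≠ 0 := pow_ne_zero 2 hp0
  have := tsum_mul_baileySum hq 0 (norm_nonneg p) hp (β := fun _ => 1) (B := 1)
    (γ := fun n => p ^ (n ^ 2 + 2 * n) * (1 - p ^ (2 * n + 1)))
    (C := 2) (fun n => norm_pow_mul_le hp (by nlinarith) (norm_one_sub_pow_le hp _))
    (by simp) (conj_bailey₅ hp)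
  simp only [mul_one, tsum_mul_right] at this
  have h1 := qPoch_ne_zero' hq hq
  have h2 := qPoch_ne_zero' (a := -p) hq (by simpa using hp)
  rw [phi1, tsum_congr (fun n => ?_), this]
  · field_simp
  · rw [baileySum_one hq0 hq, ← sum_mul]
    simp only [sub_sub]
    rw [mul_zpow_sum hp0]
    have : p ^ (5 * (n : ℤ) ^ 2 + 4 * n) = p ^ (n ^ 2 + 2 * n) * (p ^ 2) ^ (2 * n ^ 2 + n) := by
      rw [← pow_mul, ← pow_add, ← zpow_natCast]
      congr 1
      push_cast
      ring
    rw [this]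
    have e : ∀ j : ℤ, (p ^ 2) ^ (-((3 * j ^ 2 + j) / 2)) = p ^ (-(3 * j ^ 2 + j)) := by
      intro j
      rw [← zpow_natCast p 2, ← zpow_mul]
      congr 1
      obtain ⟨k, hk⟩ := exists_three_mul_sq_add j
      rw [hk]
      push_cast
      omega
    simp only [e]
    ring

omit hp0 hp in
lemma summable_mul_baileyKer {q : ℂ} (hq : ‖q‖ < 1) (e j : ℕ) {γ : ℕ → ℂ} {C s : ℝ}
    (hs0 : 0 ≤ s) (hs1 : s < 1) (hγ : ∀ n, ‖γ n‖ ≤ C * s ^ n) :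
    Summable fun m => γ (j + m) * baileyKer e q j m := by
  obtain ⟨D, hD, hker⟩ := exists_norm_baileyKer_le hq e
  have hC : 0 ≤ C := by simpa using (norm_nonneg _).trans (hγ 0)
  refine Summable.of_norm_bounded (((summable_nat_add_iff j).2
    (summable_geometric_of_lt_one hs0 hs1)).mul_left (C * D)) fun m => ?_
  rw [norm_mul]
  calc _ ≤ (C * s ^ (j + m)) * D := by gcongr; exacts [hγ _, hker _ _]
    _ = _ := by rw [add_comm j m]; ring

/-- The available transform is that of 1/(p; p²)_(j+1), one factor too long. Subtracting p times the
weight of `conj_bailey₁` from that of `conj_bailey₂` multiplies δ_j by 1 - p^(2j+1), which removes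
the surplus factor. -/
theorem F0_eq : F0 p = ∑' n, (p ^ 2) ^ n ^ 2 * (poch p (p ^ 2) n)⁻¹ := by
  have hq := norm_sq_lt_one hp
  have hb := mul_pow_ne_one hq hp
  obtain ⟨B, hB⟩ := exists_norm_inv_poch_le' hq hp
  have hγ₁ : ∀ n, ‖(p ^ 2) ^ n ^ 2 * (1 - (p ^ 2) ^ (4 * n + 2))‖ ≤ 2 * ‖p ^ 2‖ ^ n := fun n =>
    norm_pow_mul_le hq (by nlinarith) (norm_one_sub_pow_le hq _)
  have hγ₂ : ∀ n, ‖(p ^ 2) ^ (n ^ 2 + n) * (1 - (p ^ 2) ^ (2 * n + 1))‖ ≤ 2 * ‖p ^ 2‖ ^ n := fun n =>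
    norm_pow_mul_le hq (by nlinarith) (norm_one_sub_pow_le hq _)
  have hsum₁ := fun j => summable_mul_baileyKer hq 0 j (norm_nonneg _) hq hγ₁
  have hsum₂ := fun j => summable_mul_baileyKer hq 0 j (norm_nonneg _) hq hγ₂
  have := tsum_mul_baileySum hq 0 (norm_nonneg _) hq (β := fun j => (poch p (p ^ 2) (j + 1))⁻¹)
    (γ := fun n => (p ^ 2) ^ n ^ 2 * (1 - (p ^ 2) ^ (4 * n + 2))
      - p * ((p ^ 2) ^ (n ^ 2 + n) * (1 - (p ^ 2) ^ (2 * n + 1)))) (C := 2 + ‖p‖ * 2) (fun n => by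
      refine (norm_sub_le _ _).trans ?_
      rw [norm_mul p]
      have h1 := hγ₁ n
      have h2 := mul_le_mul_of_nonneg_left (hγ₂ n) (norm_nonneg p)
      linarith) (fun j => hB (j + 1))
      (δ := fun j => (p ^ 2) ^ j ^ 2 * (1 - p * (p ^ 2) ^ j) * qPoch (p ^ 2) (p ^ 2)) (fun j => by
        simp only [sub_mul _ _ (baileyKer _ _ _ _)]
        simp only [mul_assoc p]
        rw [(hsum₁ j).tsum_sub ((hsum₂ j).mul_left p), tsum_mul_left]
        have h1 := conj_bailey₂ hq 0 j
        have h2 := conj_bailey₁ hq 0 j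
        simp only [zero_mul, mul_zero, add_zero, one_mul] at h1 h2
        rw [h1, h2]
        ring)
  have h1 := qPoch_ne_zero' hq hq
  rw [F0, tsum_congr (fun n => ?_), this, inv_mul_eq_iff_eq_mul₀ h1, ← tsum_mul_left]
  · refine tsum_congr fun n => ?_
    have h2 : 1 - p * (p ^ 2) ^ n ≠ 0 := sub_ne_zero.2 (hb n).symm
    have h3 := poch_ne_zero hb n
    rw [poch_succ]
    field_simp
  · rw [← sum_mul, mul_zpow_sum hp0]
    have : p ^ (5 * (n : ℤ) ^ 2 + 2 * n) = (p ^ 2) ^ n ^ 2 * p ^ (3 * n ^ 2 + 2 * n) := by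
      rw [← pow_mul, ← pow_add, ← zpow_natCast]
      congr 1
      push_cast
      ring
    rw [this]
    have := baileySum_inv_poch_sqrt hp0 hp n
    -- The combined weight factors, and its factor 1 - p^(2n+1) is the one required by
    -- `baileySum_inv_poch_sqrt`.
    have e : (p ^ 2) ^ n ^ 2 * (1 - (p ^ 2) ^ (4 * n + 2))
      - p * ((p ^ 2) ^ (n ^ 2 + n) * (1 - (p ^ 2) ^ (2 * n + 1)))
      = (p ^ 2) ^ n ^ 2 * (1 + p ^ (6 * n + 3)) * (1 - p ^ (2 * n + 1)) := by ring
    rw [e, ← mul_sum]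
    linear_combination -((p ^ 2) ^ n ^ 2 * (1 + p ^ (6 * n + 3))) * this

theorem F1_eq : F1 p = ∑' n, (p ^ 2) ^ (n ^ 2 + n) * (poch p (p ^ 2) (n + 1))⁻¹ := by
  have hq := norm_sq_lt_one hp
  obtain ⟨B, hB⟩ := exists_norm_inv_poch_le' hq hp
  have := tsum_mul_baileySum hq 0 (norm_nonneg _) hq (β := fun j => (poch p (p ^ 2) (j + 1))⁻¹)
    (γ := fun n => (p ^ 2) ^ (n ^ 2 + n) * (1 - (p ^ 2) ^ (2 * n + 1))) (C := 2) (fun n =>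
      norm_pow_mul_le hq (by nlinarith) (norm_one_sub_pow_le hq _)) (fun j => hB (j + 1))
      (fun j => by simpa using conj_bailey₁ hq 0 j)
  have h1 := qPoch_ne_zero' hq hq
  rw [F1, tsum_congr (fun n => ?_), this, inv_mul_eq_iff_eq_mul₀ h1, ← tsum_mul_left]
  · exact tsum_congr fun n => by ring
  · rw [← sum_mul, mul_zpow_sum hp0]
    have : p ^ (5 * (n : ℤ) ^ 2 + 4 * n) = (p ^ 2) ^ (n ^ 2 + n) * p ^ (3 * n ^ 2 + 2 * n) := by
      rw [← pow_mul, ← pow_add, ← zpow_natCast]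
      congr 1
      push_cast
      ring
    rw [this]
    have := baileySum_inv_poch_sqrt hp0 hp n
    have e : (p ^ 2) ^ (n ^ 2 + n) * (1 - (p ^ 2) ^ (2 * n + 1))
      = (p ^ 2) ^ (n ^ 2 + n) * (1 + p ^ (2 * n + 1)) * (1 - p ^ (2 * n + 1)) := by ring
    rw [e, ← mul_sum]
    linear_combination -((p ^ 2) ^ (n ^ 2 + n) * (1 + p ^ (2 * n + 1))) * this

end euler_sqrt

end MockTheta
namespace MockTheta
open Filter Topology Finset

/-! ### Rogers' identities modulo `20` -/

/-- `∑_n q^(n² + c n) / (q; q)_{2 n + e}`. -/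
def rogersSum (e c : ℕ) (q : ℂ) : ℂ := ∑' n : ℕ, q ^ (n ^ 2 + c * n) * (poch q q (2 * n + e))⁻¹

/-- `∑_m (-1)^m q^(m choose 2) [2 n + e - m, m]_q`. -/
def schurSum (e : ℕ) (q : ℂ) (n : ℕ) : ℂ := baileySum e q (fun j => (poch q q (2 * j + e))⁻¹) n

section schur
variable {q : ℂ} (hq : ‖q‖ < 1)
include hq

/-- Write D_N for the alternating sum of the q-binomials [N - m, m], so that `schurSum e q n` is
D_(2n+e). Then D_(N+3) = -q^(N+1) D_N, the q-analogue of the period 6 of the alternating sums of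
binomial coefficients. This is the case of even N; `schurSum_zero_succ` is the odd case. Both are
proved by a telescoping certificate. -/
lemma schurSum_one_succ (n : ℕ) : schurSum 1 q (n + 1) = -q ^ (2 * n + 1) * schurSum 0 q n := by
  set G : ℕ → ℂ := fun j => -(1 - q ^ (n + 1 - j)) * (1 - q ^ (n + 3 * j + 2)) *
    ((-1) ^ (n + 1 - j) * q ^ (n + 1 - j).choose 2) * poch q q (n + j) /
      (poch q q (n + 1 - j) * poch q q (2 * j + 1)) with hG
  have step : ∀ j ∈ range (n + 1), baileyKer 1 q (j + 1) (n - j) * (poch q q (2 * (j + 1) + 1))⁻¹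
      + q ^ (2 * n + 1) * (baileyKer 0 q j (n - j) * (poch q q (2 * j + 0))⁻¹) = G j - G (j + 1) := by
    intro j hj
    obtain ⟨m, rfl⟩ := Nat.exists_eq_add_of_le (Nat.lt_succ_iff.1 (mem_range.1 hj))
    have e1 : j + m + 1 - j = m + 1 := by omega
    have e2 : j + m - j = m := by omega
    have e3 : j + m + 1 - (j + 1) = m := by omega
    have e4 : 2 * j + 1 + 1 + 1 + m = 2 * j + m + 1 + 1 + 1 := by omega
    have e5 : j + m + (j + 1) = 2 * j + m + 1 := by omega
    have e6 : j + m + j = 2 * j + m := by omega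
    have e7 : 2 * (j + 1) + 1 = 2 * j + 1 + 1 + 1 := by omega
    simp only [hG, baileyKer, e1, e2, e3, e4, e5, e6, e7, add_zero]
    have h2 : poch q q m ≠ 0 := poch_ne_zero' hq hq m
    have h2' : poch q q (2 * j) ≠ 0 := poch_ne_zero' hq hq (2 * j)
    have h3 := one_sub_pow_ne_zero hq m
    have h6 := one_sub_pow_ne_zero hq (2 * j)
    have h7 := one_sub_pow_ne_zero hq (2 * j + 1)
    have h8 := one_sub_pow_ne_zero hq (2 * j + 2)
    simp only [poch_succ, choose_two_succ, ← pow_succ']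
    simp only [mul_add, pow_add, pow_mul', pow_one, mul_one] at h3 h6 h7 h8 ⊢
    generalize q ^ m = u at *
    generalize q ^ j = v at *
    have h7' : 1 - v ^ 2 * q ^ 2 ≠ 0 := by convert h7 using 2; ring
    have h8' : 1 - v ^ 2 * q ^ 3 ≠ 0 := by convert h8 using 2; ring
    field_simp
    ring
  have last : G (n + 1) = 0 := by simp [hG]
  have first : baileyKer 1 q 0 (n + 1) * (poch q q (2 * 0 + 1))⁻¹ = -G 0 := by
    have h2 : poch q q n ≠ 0 := poch_ne_zero' hq hq n
    have h3 := one_sub_pow_ne_zero hq n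
    have h4 := one_sub_pow_ne_zero hq 0
    simp only [hG, baileyKer, Nat.sub_zero, mul_zero, zero_add, add_zero, add_comm 1 (n + 1)]
    simp only [poch_succ, ← pow_succ', poch_zero, zero_add]
    field_simp
  rw [schurSum, schurSum, baileySum_eq_range, baileySum_eq_range, sum_range_succ', mul_sum,
    ← sub_eq_zero]
  have hs := sum_congr rfl step
  rw [sum_add_distrib] at hs
  have hs2 : ∑ j ∈ range (n + 1), (G j - G (j + 1)) = G 0 - G (n + 1) := sum_range_sub' G (n + 1)
  rw [hs2, last] at hs
  simp only [Nat.add_sub_add_right, Nat.sub_zero, neg_mul] at *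
  rw [sum_neg_distrib, first]
  linear_combination hs

lemma schurSum_zero_succ (n : ℕ) : schurSum 0 q (n + 2) = -q ^ (2 * n + 2) * schurSum 1 q n := by
  set G : ℕ → ℂ := fun j => -(1 - q ^ (n + 1 - j)) * (1 - q ^ (n + 3 * j + 4)) *
    ((-1) ^ (n + 1 - j) * q ^ (n + 1 - j).choose 2) * poch q q (n + j + 1) /
      (poch q q (n + 1 - j) * poch q q (2 * j + 2)) with hG
  have step : ∀ j ∈ range (n + 1), baileyKer 0 q (j + 2) (n - j) * (poch q q (2 * (j + 2) + 0))⁻¹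
      + q ^ (2 * n + 2) * (baileyKer 1 q j (n - j) * (poch q q (2 * j + 1))⁻¹) = G j - G (j + 1) := by
    intro j hj
    obtain ⟨m, rfl⟩ := Nat.exists_eq_add_of_le (Nat.lt_succ_iff.1 (mem_range.1 hj))
    have e1 : j + m + 1 - j = m + 1 := by omega
    have e2 : j + m - j = m := by omega
    have e3 : j + m + 1 - (j + 1) = m := by omega
    have e4 : 2 * j + 1 + 1 + 1 + 1 + m = 2 * j + m + 1 + 1 + 1 + 1 := by omega
    have e5 : j + m + (j + 1) + 1 = 2 * j + m + 1 + 1 := by omega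
    have e6 : j + m + j + 1 = 2 * j + m + 1 := by omega
    have e7 : 2 * (j + 2) + 0 = 2 * j + 1 + 1 + 1 + 1 := by omega
    have e8 : 2 * (j + 1) + 2 = 2 * j + 1 + 1 + 1 + 1 := by omega
    have e9 : 2 * j + 1 + m = 2 * j + m + 1 := by omega
    have e10 : 2 * j + 2 = 2 * j + 1 + 1 := by omega
    simp only [hG, baileyKer, e1, e2, e3, e4, e5, e6, e7, e8, e9, e10]
    have h2 : poch q q m ≠ 0 := poch_ne_zero' hq hq m
    have h2' : poch q q (2 * j) ≠ 0 := poch_ne_zero' hq hq (2 * j)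
    have h3 := one_sub_pow_ne_zero hq m
    have h6 := one_sub_pow_ne_zero hq (2 * j)
    have h7 := one_sub_pow_ne_zero hq (2 * j + 1)
    have h8 := one_sub_pow_ne_zero hq (2 * j + 2)
    have h9 := one_sub_pow_ne_zero hq (2 * j + 3)
    simp only [poch_succ, choose_two_succ, ← pow_succ']
    simp only [mul_add, pow_add, pow_mul', pow_one, mul_one] at h3 h6 h7 h8 h9 ⊢
    generalize q ^ m = u at *
    generalize q ^ j = v at *
    have h7' : 1 - v ^ 2 * q ^ 2 ≠ 0 := by convert h7 using 2; ring
    have h8' : 1 - v ^ 2 * q ^ 3 ≠ 0 := by convert h8 using 2; ring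
    have h9' : 1 - v ^ 2 * q ^ 4 ≠ 0 := by convert h9 using 2; ring
    field_simp
    ring
  have last : G (n + 1) = 0 := by simp [hG]
  -- For odd N the index j is shifted by two, so two initial terms remain to be matched with the
  -- boundary value of the certificate.
  have first : baileyKer 0 q 0 (n + 2) * (poch q q (2 * 0 + 0))⁻¹
      + baileyKer 0 q 1 (n + 1) * (poch q q (2 * 1 + 0))⁻¹ = -G 0 := by
    have h2 : poch q q n ≠ 0 := poch_ne_zero' hq hq n
    have h3 := one_sub_pow_ne_zero hq n
    have h3' := one_sub_pow_ne_zero hq (n + 1)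
    have h4 := one_sub_pow_ne_zero hq 0
    have h5 := one_sub_pow_ne_zero hq 1
    have e1 : 2 * 1 + 0 + (n + 1) = n + 1 + 1 + 1 := by omega
    have e2 : n + 2 = n + 1 + 1 := rfl
    have e3 : 2 * 1 + 0 = 0 + 1 + 1 := rfl
    simp only [hG, baileyKer, Nat.sub_zero, e1, e2, e3, mul_zero, zero_add, add_zero]
    simp only [poch_succ, choose_two_succ, ← pow_succ', poch_zero, zero_add]
    simp only [pow_add, pow_one, zero_add] at h3 h3' h4 h5 ⊢
    generalize q ^ n = u at *
    have h5' : 1 - q ^ 2 ≠ 0 := by convert h5 using 2; ring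
    have h3'' : 1 - u * q ^ 2 ≠ 0 := by convert h3' using 2; ring
    field_simp
    ring
  rw [schurSum, schurSum, baileySum_eq_range, baileySum_eq_range, sum_range_succ', sum_range_succ',
    mul_sum, ← sub_eq_zero]
  have hs := sum_congr rfl step
  rw [sum_add_distrib] at hs
  have hs2 : ∑ j ∈ range (n + 1), (G j - G (j + 1)) = G 0 - G (n + 1) := sum_range_sub' G (n + 1)
  rw [hs2, last] at hs
  simp only [Nat.add_sub_add_right, Nat.sub_zero, neg_mul, add_assoc, zero_add, Nat.reduceAdd,
    show n + 2 - 1 = n + 1 by omega] at *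
  rw [sum_neg_distrib]
  linear_combination hs + first

/-- Two steps of the recurrence give a relation from n to n + 3 with a monomial coefficient, and the
middle residue class starts from zero. -/
lemma schurSum_zero_mod (s : ℕ) : schurSum 0 q (3 * s) = q ^ (5 * s ^ 2 + s * (s - 1)) ∧
    schurSum 0 q (3 * s + 1) = 0 ∧
    schurSum 0 q (3 * s + 2) = -q ^ ((3 * s + 2) * (2 * s + 1)) := by
  have hrec : ∀ n, schurSum 0 q (n + 3) = q ^ (4 * n + 5) * schurSum 0 q n := by
    intro n
    rw [schurSum_zero_succ hq (n + 1), schurSum_one_succ hq]; ring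
  induction s with
  | zero =>
    have h1 := one_sub_pow_ne_zero hq 0
    have h2 := one_sub_pow_ne_zero hq 1
    simp only [zero_add, pow_one] at h1 h2
    refine ⟨by simp [schurSum, baileySum_zero], ?_, ?_⟩
    · simp [schurSum, baileySum, Nat.antidiagonal_succ, baileyKer, poch_succ, h1]
      field_simp
      ring
    · rw [schurSum_zero_succ hq 0]
      simp [schurSum, baileySum_zero, poch_succ, h1]
  | succ s ih =>
    obtain ⟨i1, i2, i3⟩ := ih
    have e (c : ℕ) : 3 * (s + 1) + c = (3 * s + c) + 3 := by ring
    refine ⟨?_, ?_, ?_⟩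
    · have := e 0
      simp only [add_zero] at this
      rw [this, hrec, i1, ← pow_add]
      congr 1
      rcases s with _ | s
      · rfl
      · simp only [Nat.add_sub_cancel]; ring
    · rw [e, hrec, i2, mul_zero]
    · rw [e, hrec, i3, mul_neg, ← pow_add]
      congr 2
      ring

lemma schurSum_one_mod (s : ℕ) : schurSum 1 q (3 * s) = q ^ (6 * s ^ 2 + s) ∧
    schurSum 1 q (3 * s + 1) = -q ^ (6 * s ^ 2 + 5 * s + 1) ∧
    schurSum 1 q (3 * s + 2) = 0 := by
  refine ⟨?_, ?_, ?_⟩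
  · rcases s with _ | s
    · have h1 := one_sub_pow_ne_zero hq 0
      simp only [zero_add, pow_one] at h1
      simp [schurSum, baileySum_zero, poch_succ, h1]
    · rw [show 3 * (s + 1) = 3 * s + 2 + 1 by ring, schurSum_one_succ hq, (schurSum_zero_mod hq s).2.2]
      ring
  · rw [schurSum_one_succ hq, (schurSum_zero_mod hq s).1, neg_mul, ← pow_add]
    congr 2
    rcases s with _ | s
    · rfl
    · simp only [Nat.add_sub_cancel]; ring
  · rw [show 3 * s + 2 = 3 * s + 1 + 1 by ring, schurSum_one_succ hq, (schurSum_zero_mod hq s).2.1,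
      mul_zero]

end schur

/-! ### Regrouping modulo 3 and summability for Rogers' identities. -/

lemma summable_zpow_quadratic {q : ℂ} (hq0 : q ≠ 0) (hq : ‖q‖ < 1) {a : ℕ} (ha : a ≠ 0) (b c : ℤ) :
    Summable fun n : ℤ => q ^ (a * n ^ 2 + b * n + c) := by
  have key : ∀ b : ℤ, Summable fun n : ℕ => q ^ (a * (n : ℤ) ^ 2 + b * n + c) := by
    intro b
    have h := summable_pow_sq_mul_pow (r := ‖q‖ ^ a) (by positivity)
      (pow_lt_one₀ (norm_nonneg _) hq ha) (‖q‖ ^ ((a : ℤ) + b))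
    refine Summable.of_norm_bounded (h.mul_left (‖q‖ ^ c)) fun n => le_of_eq ?_
    have hq' : ‖q‖ ≠ 0 := norm_ne_zero_iff.2 hq0
    rw [norm_zpow, ← zpow_natCast, ← zpow_natCast, ← zpow_natCast, ← zpow_mul, ← zpow_mul,
      ← zpow_add₀ hq', ← zpow_add₀ hq', mul_pred_eq]
    congr 1
    have := two_mul_choose_cast n
    push_cast
    linear_combination (-(a : ℤ)) * this
  refine Summable.of_nat_of_neg (key b) ?_
  refine (key (-b)).congr fun n => ?_
  congr 1
  ring

/-- The class of n modulo 3 decides which half of a bilateral theta series a term feeds: one nonzero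
class supplies the nonnegative indices, the other the negative ones, and the third vanishes. -/
lemma tsum_three_mul {F : ℕ → ℂ} {f : ℤ → ℂ} (hF : Summable F) (hf : Summable f)
    (h : ∀ s : ℕ, F (3 * s) + F (3 * s + 1) + F (3 * s + 2) = f s + f (-(s + 1))) :
    ∑' n, F n = ∑' s, f s := by
  have hinj : ∀ c, Function.Injective fun s : ℕ => 3 * s + c := fun c x y h => by
    simp only at h; omega
  have hs : ∀ c, Summable fun s : ℕ => F (3 * s + c) := fun c => hF.comp_injective (hinj c)
  have h3 : ∑ j : ZMod 3, ∑' m, F (j.val + 3 * m)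
      = ∑' s, F (3 * s + 0) + ∑' s, F (3 * s + 1) + ∑' s, F (3 * s + 2) := by
    simp only [add_comm _ (3 * _)]
    exact Fin.sum_univ_three fun j : Fin 3 => ∑' m, F (3 * m + j.val)
  rw [Nat.sumByResidueClasses hF 3, h3, ← Summable.tsum_add (hs 0) (hs 1),
    ← Summable.tsum_add ((hs 0).add (hs 1)) (hs 2), tsum_of_nat_of_neg_add_one, ← Summable.tsum_add]
  · exact tsum_congr h
  · exact hf.comp_injective Nat.cast_injective
  · exact hf.comp_injective fun a b hab => by simpa using hab
  · exact hf.comp_injective Nat.cast_injective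
  · exact hf.comp_injective fun a b hab => by simpa using hab

lemma exists_norm_schur_le {q : ℂ} (hq : ‖q‖ < 1) (e : ℕ) :
    ∃ B, ∀ j, ‖(poch q q (2 * j + e))⁻¹‖ ≤ B := by
  obtain ⟨B, hB⟩ := exists_norm_inv_poch_le' hq hq
  exact ⟨B, fun j => hB _⟩

lemma exists_norm_schurSum_le {q : ℂ} (hq : ‖q‖ < 1) (e : ℕ) :
    ∃ D, 0 ≤ D ∧ ∀ n, ‖schurSum e q n‖ ≤ D * (n + 1) := by
  obtain ⟨D, hD, h⟩ := exists_norm_baileyKer_le hq e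
  obtain ⟨B, hB⟩ := exists_norm_schur_le hq e
  have hB0 := (norm_nonneg _).trans (hB 0)
  refine ⟨D * B, by positivity, fun n => ?_⟩
  rw [schurSum, baileySum_eq_range]
  refine (norm_sum_le _ _).trans ?_
  calc _ ≤ ∑ _j ∈ range (n + 1), D * B := sum_le_sum fun j _ => by
        rw [norm_mul]; exact mul_le_mul (h _ _) (hB _) (norm_nonneg _) hD.le
    _ = _ := by simp; ring

lemma summable_mul_schurSum {q : ℂ} (hq : ‖q‖ < 1) (e : ℕ) {γ : ℕ → ℂ} {C : ℝ}
    (hγ : ∀ n, ‖γ n‖ ≤ C * ‖q‖ ^ n) : Summable fun n => γ n * schurSum e q n := by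
  obtain ⟨D, hD0, hD⟩ := exists_norm_schurSum_le hq e
  have hC0 : 0 ≤ C := by simpa using (norm_nonneg _).trans (hγ 0)
  have : Summable fun n : ℕ => (C * D) * ((n : ℝ) ^ 1 * ‖q‖ ^ n + ‖q‖ ^ n) :=
    ((summable_pow_mul_geometric_of_norm_lt_one 1 (by simpa using hq)).add
      (summable_geometric_of_lt_one (norm_nonneg _) hq)).mul_left _
  refine Summable.of_norm_bounded this fun n => ?_
  rw [norm_mul]
  calc _ ≤ (C * ‖q‖ ^ n) * (D * (n + 1)) := by gcongr; exacts [hγ n, hD n]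
    _ = _ := by ring

/-! ### The four identities of Rogers, as theta series of discriminant type 15 s². -/

section rogers
variable {q : ℂ} (hq0 : q ≠ 0) (hq : ‖q‖ < 1)
include hq0 hq

omit hq0 in
lemma tsum_mul_schurSum (e : ℕ) {γ δ : ℕ → ℂ} {C : ℝ} (hγ : ∀ n, ‖γ n‖ ≤ C * ‖q‖ ^ n)
    (hδ : ∀ j, ∑' m, γ (j + m) * baileyKer e q j m = δ j * qPoch q q) :
    ∑' n, γ n * schurSum e q n = qPoch q q * ∑' j, δ j * (poch q q (2 * j + e))⁻¹ := by
  obtain ⟨B, hB⟩ := exists_norm_schur_le hq e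
  unfold schurSum
  rw [tsum_mul_baileySum hq e (norm_nonneg q) hq hγ hB hδ, ← tsum_mul_left]
  exact tsum_congr fun j => by ring

omit hq0 in
lemma norm_gauss_mul_one_sub_le (c k n : ℕ) :
    ‖q ^ (n ^ 2 + c * n) * (1 - q ^ k)‖ ≤ 2 * ‖q‖ ^ n :=
  norm_pow_mul_le hq (le_add_right (Nat.le_self_pow two_ne_zero n))
    (norm_one_sub_pow_le hq _)

omit hq in
lemma zpow_mul_one_sub_mul (a b c : ℤ) :
    q ^ a * (1 - q ^ b) * q ^ c = q ^ (a + c) - q ^ (a + b + c) := by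
  rw [mul_sub, sub_mul, mul_one, ← zpow_add₀ hq0, ← zpow_add₀ hq0, ← zpow_add₀ hq0]

lemma summable_zpow_sub (b c d : ℤ) :
    Summable fun s : ℤ => q ^ (15 * s ^ 2 + b * s) - q ^ (15 * s ^ 2 + c * s + d) := by
  have h := summable_zpow_quadratic hq0 hq (a := 15) (by norm_num)
  simpa using (h b 0).sub (h c d)

lemma rogersSum_zero_zero : qPoch q q * rogersSum 0 0 q =
    ∑' s : ℤ, (q ^ (15 * s ^ 2 + -1 * s) - q ^ (15 * s ^ 2 + 11 * s + 2)) := by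
  have hγ := fun n : ℕ => norm_gauss_mul_one_sub_le hq 0 (4 * n + 2) n
  have h := tsum_mul_schurSum hq 0 (δ := fun j => q ^ (j ^ 2 + 0 * j)) hγ
    (fun j => by simpa [add_assoc] using conj_bailey₂ hq 0 j)
  rw [rogersSum, ← h]
  refine tsum_three_mul (summable_mul_schurSum hq 0 hγ) (summable_zpow_sub hq0 hq _ _ _)
    fun s => ?_
  obtain ⟨h0, h1, h2⟩ := schurSum_zero_mod hq s
  -- The truncated subtraction at s = 0 is harmless, being multiplied by s.
  have hc : (s : ℤ) * ((s - 1 : ℕ) : ℤ) = s ^ 2 - s := by cases s <;> simp; ring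
  rw [h0, h1, h2]
  simp only [← zpow_natCast, mul_neg, zpow_mul_one_sub_mul hq0]
  push_cast
  rw [hc]
  ring_nf

lemma rogersSum_zero_one : qPoch q q * rogersSum 0 1 q =
    ∑' s : ℤ, (q ^ (15 * s ^ 2 + 2 * s) - q ^ (15 * s ^ 2 + 8 * s + 1)) := by
  have hγ := fun n : ℕ => norm_gauss_mul_one_sub_le hq 1 (2 * n + 1) n
  have h := tsum_mul_schurSum hq 0 (δ := fun j => q ^ (j ^ 2 + 1 * j)) hγ
    (fun j => by simpa [add_assoc] using conj_bailey₁ hq 0 j)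
  rw [rogersSum, ← h]
  refine tsum_three_mul (summable_mul_schurSum hq 0 hγ) (summable_zpow_sub hq0 hq _ _ _)
    fun s => ?_
  obtain ⟨h0, h1, h2⟩ := schurSum_zero_mod hq s
  have hc : (s : ℤ) * ((s - 1 : ℕ) : ℤ) = s ^ 2 - s := by cases s <;> simp; ring
  rw [h0, h1, h2]
  simp only [← zpow_natCast, mul_neg, zpow_mul_one_sub_mul hq0]
  push_cast
  rw [hc]
  ring_nf

lemma rogersSum_one_one : qPoch q q * rogersSum 1 1 q =
    ∑' s : ℤ, (q ^ (15 * s ^ 2 + 4 * s) - q ^ (15 * s ^ 2 + 14 * s + 3)) := by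
  have hγ := fun n : ℕ => norm_gauss_mul_one_sub_le hq 1 (4 * n + 4) n
  have h := tsum_mul_schurSum hq 1 (δ := fun j => q ^ (j ^ 2 + 1 * j)) hγ
    (fun j => by simpa [add_assoc] using conj_bailey₂ hq 1 j)
  rw [rogersSum, ← h]
  refine tsum_three_mul (summable_mul_schurSum hq 1 hγ) (summable_zpow_sub hq0 hq _ _ _)
    fun s => ?_
  obtain ⟨h0, h1, h2⟩ := schurSum_one_mod hq s
  rw [h0, h1, h2]
  simp only [← zpow_natCast, mul_neg, zpow_mul_one_sub_mul hq0]
  push_cast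
  ring_nf

lemma rogersSum_one_two : qPoch q q * rogersSum 1 2 q =
    ∑' s : ℤ, (q ^ (15 * s ^ 2 + 7 * s) - q ^ (15 * s ^ 2 + 13 * s + 2)) := by
  have hγ := fun n : ℕ => norm_gauss_mul_one_sub_le hq 2 (2 * n + 2) n
  have h := tsum_mul_schurSum hq 1 (δ := fun j => q ^ (j ^ 2 + 2 * j)) hγ
    (fun j => by simpa [add_assoc] using conj_bailey₁ hq 1 j)
  rw [rogersSum, ← h]
  refine tsum_three_mul (summable_mul_schurSum hq 1 hγ) (summable_zpow_sub hq0 hq _ _ _)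
    fun s => ?_
  obtain ⟨h0, h1, h2⟩ := schurSum_one_mod hq s
  rw [h0, h1, h2]
  simp only [← zpow_natCast, mul_neg, zpow_mul_one_sub_mul hq0]
  push_cast
  ring_nf

end rogers

end MockTheta
namespace MockTheta
open Filter Topology Finset

/-! ### Bilateral sums -/

/-- Euler's expansion of `(z; q)_∞`. -/
theorem hasSum_euler {q : ℂ} (hq : ‖q‖ < 1) (z : ℂ) :
    HasSum (fun k : ℕ => (-z) ^ k * q ^ k.choose 2 * (poch q q k)⁻¹) (qPoch z q) := by
  obtain ⟨B, hB⟩ := exists_norm_inv_poch_le' hq hq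
  -- The exponent m(m-1)/2 is half of the one in `summable_pow_sq_mul_pow`, hence the square root.
  have hr : √‖q‖ < 1 := by rw [Real.sqrt_lt' one_pos]; simpa using hq
  have hbd : ∀ R : ℝ, Summable fun k : ℕ => √‖q‖ ^ (k * (k - 1)) * R ^ k * B := fun R =>
    (summable_pow_sq_mul_pow (Real.sqrt_nonneg _) hr R).mul_right B
  have hle : ∀ (z : ℂ) (R : ℝ), ‖z‖ ≤ R → ∀ k : ℕ,
      ‖(-z) ^ k * q ^ k.choose 2 * (poch q q k)⁻¹‖ ≤ √‖q‖ ^ (k * (k - 1)) * R ^ k * B := by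
    intro z R hz k
    rw [norm_mul, norm_mul, norm_pow, norm_pow, norm_neg, mul_pred_eq, pow_mul,
      Real.sq_sqrt (norm_nonneg q), mul_comm (‖q‖ ^ _)]
    have := (norm_nonneg z).trans hz
    gcongr
    exact hB k
  have hsum : ∀ z : ℂ, Summable fun k : ℕ => (-z) ^ k * q ^ k.choose 2 * (poch q q k)⁻¹ :=
    fun z => Summable.of_norm_bounded (hbd ‖z‖) (hle z _ le_rfl)
  set F : ℂ → ℂ := fun z => ∑' k : ℕ, (-z) ^ k * q ^ k.choose 2 * (poch q q k)⁻¹ with hF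
  -- The series obeys the functional equation of the product; iterating it and letting z q^n tend to
  -- 0 identifies the two.
  have step : ∀ z, F z = (1 - z) * F (z * q) := by
    intro z
    have h1 : F z - F (z * q) = -z * F (z * q) := by
      simp only [hF]
      rw [← (hsum z).tsum_sub (hsum (z * q)), ← tsum_mul_left,
        ((hsum z).sub (hsum (z * q))).tsum_eq_zero_add]
      simp only [pow_zero, sub_self, zero_add]
      refine tsum_congr fun k => ?_
      have h2 : poch q q k ≠ 0 := poch_ne_zero' hq hq k
      have h3 := one_sub_pow_ne_zero hq k
      rw [poch_succ, choose_two_succ, ← pow_succ', pow_add, ← neg_mul, mul_pow, mul_pow]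
      field_simp
      ring
    linear_combination h1
  have iter : ∀ n z, F z = poch z q n * F (z * q ^ n) := by
    intro n
    induction n with
    | zero => simp
    | succ n ih => intro z; rw [ih, step, poch_succ]; ring_nf
  have h0 : F 0 = 1 := by
    simp only [hF]
    rw [tsum_eq_single 0 fun k hk => by simp [hk]]
    simp
  have hlim : Tendsto (fun n => F (z * q ^ n)) atTop (𝓝 1) := by
    rw [← h0]
    refine tendsto_tsum_of_dominated_convergence (hbd ‖z‖) (fun k => ?_) (.of_forall fun n k => ?_)
    · have : Tendsto (fun n : ℕ => z * q ^ n) atTop (𝓝 0) := by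
        simpa using (tendsto_pow_atTop_nhds_zero_of_norm_lt_one hq).const_mul z
      exact (((this.neg).pow k).mul_const _).mul_const _
    · refine hle _ _ ?_ k
      rw [norm_mul, norm_pow]
      exact mul_le_of_le_one_right (norm_nonneg _) (pow_le_one₀ (norm_nonneg _) hq.le)
  have := tendsto_nhds_unique ((tendsto_poch hq z).mul hlim)
    (tendsto_const_nhds.congr fun n => iter n z)
  rw [← mul_one (qPoch z q), this]
  exact (hsum z).hasSum

/-- An abstract form of completing the square: once the terms with k = 2m or 2m + 1 depend on n only
through n + m, the sum over n is independent of m and factors out. Absolute summability over the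
product justifies the interchange. -/
theorem tsum_tsum_of_shift {t : ℕ → ℤ → ℂ} {f₀ f₁ : ℤ → ℂ} {g₀ g₁ : ℕ → ℂ} (hf₀ : Summable f₀)
    (hf₁ : Summable f₁) (hg₀ : Summable g₀) (hg₁ : Summable g₁)
    (h₀ : ∀ m n, t (2 * m) n = g₀ m * f₀ (n + m))
    (h₁ : ∀ m n, t (2 * m + 1) n = g₁ m * f₁ (n + m)) :
    HasSum (fun n => ∑' k, t k n) ((∑' m, g₀ m) * ∑' n, f₀ n + (∑' m, g₁ m) * ∑' n, f₁ n) := by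
  have hs (f : ℤ → ℂ) (m : ℕ) : ∑' n, f (n + m) = ∑' n, f n :=
    (Equiv.addRight (m : ℤ)).tsum_eq f
  have hs' (f : ℤ → ℂ) (m : ℕ) : ∑' n, ‖f (n + m)‖ = ∑' n, ‖f n‖ :=
    (Equiv.addRight (m : ℤ)).tsum_eq fun n => ‖f n‖
  have hsum : ∀ k, Summable (t k) := by
    intro k
    obtain ⟨m, rfl | rfl⟩ := Nat.even_or_odd' k
    · exact (((Equiv.addRight (m : ℤ)).summable_iff.2 hf₀).mul_left (g₀ m)).congr fun n =>
        (h₀ m n).symm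
    · exact (((Equiv.addRight (m : ℤ)).summable_iff.2 hf₁).mul_left (g₁ m)).congr fun n =>
        (h₁ m n).symm
  have e₀ : ∀ m, ∑' n, t (2 * m) n = g₀ m * ∑' n, f₀ n := fun m => by
    simp only [h₀, tsum_mul_left, hs]
  have e₁ : ∀ m, ∑' n, t (2 * m + 1) n = g₁ m * ∑' n, f₁ n := fun m => by
    simp only [h₁, tsum_mul_left, hs]
  have hn : Summable fun k => ∑' n, ‖t k n‖ := by
    refine (HasSum.even_add_odd (m := ∑' k, ‖g₀ k‖ * ∑' n, ‖f₀ n‖)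
      (m' := ∑' k, ‖g₁ k‖ * ∑' n, ‖f₁ n‖) ?_ ?_).summable
    · simp only [h₀, norm_mul, tsum_mul_left, hs']
      exact (hg₀.norm.mul_right _).hasSum
    · simp only [h₁, norm_mul, tsum_mul_left, hs']
      exact (hg₁.norm.mul_right _).hasSum
  have hprod : Summable fun x : ℕ × ℤ => t x.1 x.2 := by
    refine Summable.of_norm ((summable_prod_of_nonneg fun _ => norm_nonneg _).2 ⟨?_, hn⟩)
    exact fun k => (hsum k).norm
  have hkey : HasSum (fun k => ∑' n, t k n)
      ((∑' m, g₀ m) * ∑' n, f₀ n + (∑' m, g₁ m) * ∑' n, f₁ n) := by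
    refine HasSum.even_add_odd ?_ ?_
    · simp only [e₀]
      exact hg₀.hasSum.mul_right _
    · simp only [e₁]
      exact hg₁.hasSum.mul_right _
  rw [← hkey.tsum_eq, ← hprod.tsum_comm]
  exact (hprod.prod_symm.prod).hasSum

/-- `∑_n q^(n²)` over the integers. -/
def thetaEven (q : ℂ) : ℂ := ∑' n : ℤ, q ^ (n ^ 2)

/-- `∑_n q^(n² + n)` over the integers. -/
def thetaOdd (q : ℂ) : ℂ := ∑' n : ℤ, q ^ (n ^ 2 + n)

section bilateral
variable {q : ℂ} (hq0 : q ≠ 0) (hq : ‖q‖ < 1)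
include hq0 hq

lemma summable_gauss_mul_inv_poch (e c : ℕ) (A : ℂ) :
    Summable fun m : ℕ => A ^ m * q ^ (m ^ 2 + c * m) * (poch q q (2 * m + e))⁻¹ := by
  obtain ⟨B, hB⟩ := exists_norm_schur_le hq e
  have h := summable_pow_sq_mul_pow (r := ‖q‖) (by positivity) hq (‖q‖ ^ (c + 1) * ‖A‖)
  refine Summable.of_norm_bounded (h.mul_right B) fun m => ?_
  rw [norm_mul, norm_mul, norm_pow, norm_pow]
  refine mul_le_mul (le_of_eq ?_) (hB m) (norm_nonneg _) (by positivity)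
  rw [mul_pow, ← pow_mul, ← mul_assoc, ← pow_add, mul_comm]
  congr 2
  rcases m with _ | m
  · rfl
  · simp only [Nat.add_sub_cancel]; ring

/-- After Euler's expansion the exponent for k = 2m is n² + 2m(n+1) + m(2m-1) = (n+m)² + m² + m. The
odd k leave (n+m)² + (n+m) instead, which accounts for the two theta constants. -/
theorem hasSum_bilateral_zero (b : ℂ) :
    HasSum (fun n : ℤ => q ^ (n ^ 2) * qPoch (b * q ^ (n + 1)) q)
      ((∑' m : ℕ, (b ^ 2) ^ m * q ^ (m ^ 2 + 1 * m) * (poch q q (2 * m + 0))⁻¹) * thetaEven q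
        + (∑' m : ℕ, -b * q * ((b ^ 2) ^ m * q ^ (m ^ 2 + 2 * m) * (poch q q (2 * m + 1))⁻¹))
          * thetaOdd q) := by
  have h := tsum_tsum_of_shift
    (t := fun k n => q ^ (n ^ 2) *
      ((-(b * q ^ (n + 1))) ^ k * q ^ k.choose 2 * (poch q q k)⁻¹))
    (by simpa using summable_zpow_quadratic hq0 hq one_ne_zero 0 0)
    (by simpa using summable_zpow_quadratic hq0 hq one_ne_zero 1 0)
    (summable_gauss_mul_inv_poch hq0 hq 0 1 (b ^ 2))
    ((summable_gauss_mul_inv_poch hq0 hq 1 2 (b ^ 2)).mul_left (-b * q)) ?_ ?_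
  · simpa only [thetaEven, thetaOdd, tsum_mul_left, (hasSum_euler hq _).tsum_eq] using h
  · intro m n
    have hc := two_mul_choose_cast (2 * m)
    have he : q ^ (n ^ 2) * ((q ^ (n + 1)) ^ (2 * m) * q ^ (2 * m).choose 2)
        = q ^ (m ^ 2 + 1 * m) * q ^ ((n + m) ^ 2) := by
      simp only [← zpow_natCast, ← zpow_mul, ← zpow_add₀ hq0]
      congr 1
      push_cast at hc ⊢
      linarith
    simp only [add_zero]
    rw [neg_pow, mul_pow, pow_mul (-1 : ℂ), pow_mul b, neg_one_sq, one_pow]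
    linear_combination (b ^ 2) ^ m * (poch q q (2 * m))⁻¹ * he
  · intro m n
    have hc := two_mul_choose_cast (2 * m + 1)
    have he : q ^ (n ^ 2) * ((q ^ (n + 1)) ^ (2 * m + 1) * q ^ (2 * m + 1).choose 2)
        = q * q ^ (m ^ 2 + 2 * m) * q ^ ((n + m) ^ 2 + (n + m)) := by
      simp only [← zpow_natCast, ← zpow_mul, ← zpow_add₀ hq0, ← zpow_one_add₀ hq0]
      congr 1
      push_cast at hc ⊢
      linarith
    rw [neg_pow, mul_pow, pow_succ (-1 : ℂ), pow_mul (-1 : ℂ), pow_succ b, pow_mul b, neg_one_sq, one_pow]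
    linear_combination -b * (b ^ 2) ^ m * (poch q q (2 * m + 1))⁻¹ * he

theorem hasSum_bilateral_one (b : ℂ) :
    HasSum (fun n : ℤ => q ^ (n ^ 2 + n) * qPoch (b * q ^ (n + 1)) q)
      ((∑' m : ℕ, (b ^ 2) ^ m * q ^ (m ^ 2 + 0 * m) * (poch q q (2 * m + 0))⁻¹) * thetaOdd q
        + (∑' m : ℕ, -b * ((b ^ 2) ^ m * q ^ (m ^ 2 + 1 * m) * (poch q q (2 * m + 1))⁻¹))
          * thetaEven q) := by
  -- With the weight n² + n, an odd k = 2m + 1 completes to (n + m + 1)², so the even theta series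
  -- enters shifted by one.
  have hsh : ∑' n : ℤ, q ^ ((n + 1) ^ 2) = thetaEven q :=
    (Equiv.addRight (1 : ℤ)).tsum_eq fun n => q ^ (n ^ 2)
  rw [← hsh]
  have h := tsum_tsum_of_shift
    (t := fun k n => q ^ (n ^ 2 + n) *
      ((-(b * q ^ (n + 1))) ^ k * q ^ k.choose 2 * (poch q q k)⁻¹))
    (by simpa using summable_zpow_quadratic hq0 hq one_ne_zero 1 0)
    ((Equiv.addRight (1 : ℤ)).summable_iff.2
      (by simpa using summable_zpow_quadratic hq0 hq one_ne_zero 0 0))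
    (summable_gauss_mul_inv_poch hq0 hq 0 0 (b ^ 2))
    ((summable_gauss_mul_inv_poch hq0 hq 1 1 (b ^ 2)).mul_left (-b)) ?_ ?_
  · simpa only [thetaEven, thetaOdd, tsum_mul_left, Function.comp_apply, Equiv.coe_addRight, (hasSum_euler hq _).tsum_eq] using h
  · intro m n
    have hc := two_mul_choose_cast (2 * m)
    have he : q ^ (n ^ 2 + n) * ((q ^ (n + 1)) ^ (2 * m) * q ^ (2 * m).choose 2)
        = q ^ (m ^ 2 + 0 * m) * q ^ ((n + m) ^ 2 + (n + m)) := by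
      simp only [← zpow_natCast, ← zpow_mul, ← zpow_add₀ hq0]
      congr 1
      push_cast at hc ⊢
      linarith
    simp only [add_zero]
    rw [neg_pow, mul_pow, pow_mul (-1 : ℂ), pow_mul b, neg_one_sq, one_pow]
    linear_combination (b ^ 2) ^ m * (poch q q (2 * m))⁻¹ * he
  · intro m n
    have hc := two_mul_choose_cast (2 * m + 1)
    have he : q ^ (n ^ 2 + n) * ((q ^ (n + 1)) ^ (2 * m + 1) * q ^ (2 * m + 1).choose 2)
        = q ^ (m ^ 2 + 1 * m) * q ^ ((n + m + 1) ^ 2) := by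
      simp only [← zpow_natCast, ← zpow_mul, ← zpow_add₀ hq0]
      congr 1
      push_cast at hc ⊢
      linarith
    rw [neg_pow, mul_pow, pow_succ (-1 : ℂ), pow_mul (-1 : ℂ), pow_succ b, pow_mul b, neg_one_sq, one_pow]
    simp only [Function.comp_apply, Equiv.coe_addRight]
    linear_combination -b * (b ^ 2) ^ m * (poch q q (2 * m + 1))⁻¹ * he

omit hq in
lemma poch_mul_zpow_neg {b : ℂ} (hb : b ≠ 0) (m : ℕ) : poch (b * q ^ (-(m : ℤ))) q (m + 1)
    = (-b) ^ (m + 1) * (q ^ (m + 1).choose 2)⁻¹ * poch b⁻¹ q (m + 1) := by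
  induction m with
  | zero => simp [poch_succ]; field_simp; ring
  | succ m ih =>
    rw [poch_succ', show b * q ^ (-((m + 1 : ℕ) : ℤ)) * q = b * q ^ (-(m : ℤ)) by
      rw [mul_assoc, ← zpow_add_one₀ hq0]; push_cast; ring_nf, ih, poch_succ _ _ (m + 1),
      choose_two_succ (m + 1), pow_add, zpow_neg, zpow_natCast]
    field_simp
    ring

/-- For n ≥ 0 the product (b q^(n+1))_∞ is (bq)_∞ / (bq)_n. For n = -(m+1) it is (bq)_∞ times a
finite product which, read backwards, becomes (1/b)_(m+1). So one half has its Pochhammer symbol in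
the denominator and the other in the numerator. -/
theorem tsum_bilateral_eq {b : ℂ} (hb : b ≠ 0) (hb1 : ∀ i : ℕ, b * q * q ^ i ≠ 1) (c : ℤ) {S : ℂ}
    (h : HasSum (fun n : ℤ => q ^ (n ^ 2 + c * n) * qPoch (b * q ^ (n + 1)) q) S) :
    S = qPoch (b * q) q * (∑' n : ℕ, q ^ ((n : ℤ) ^ 2 + c * n) * (poch (b * q) q n)⁻¹
      + ∑' m : ℕ, (-b) ^ (m + 1) * q ^ (((m : ℤ) + 1) ^ 2 - c * (m + 1) - (m + 1).choose 2)
        * poch b⁻¹ q (m + 1)) := by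
  have hpos : Summable fun n : ℕ => q ^ ((n : ℤ) ^ 2 + c * n) * qPoch (b * q ^ ((n : ℤ) + 1)) q :=
    h.summable.comp_injective Nat.cast_injective
  have hneg : Summable fun m : ℕ => q ^ ((-((m : ℤ) + 1)) ^ 2 + c * (-((m : ℤ) + 1)))
      * qPoch (b * q ^ (-((m : ℤ) + 1) + 1)) q :=
    h.summable.comp_injective (i := fun m : ℕ => (-((m : ℤ) + 1))) fun x y h => by simpa using h
  have key := tsum_of_nat_of_neg_add_one
    (f := fun n : ℤ => q ^ (n ^ 2 + c * n) * qPoch (b * q ^ (n + 1)) q) hpos hneg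
  rw [← h.tsum_eq, key, mul_add (qPoch (b * q) q), ← tsum_mul_left, ← tsum_mul_left]
  congr 1
  · refine tsum_congr fun n => ?_
    have h1 := qPoch_eq hq (b * q) n
    have h2 : poch (b * q) q n ≠ 0 := poch_ne_zero hb1 n
    rw [h1, zpow_add_one₀ hq0, zpow_natCast]
    field_simp
  · refine tsum_congr fun m => ?_
    have h1 := qPoch_eq hq (b * q ^ (-(m : ℤ))) (m + 1)
    have h3 : b * q ^ (-(m : ℤ)) * q ^ (m + 1) = b * q := by
      rw [zpow_neg, zpow_natCast, pow_succ]
      field_simp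
    rw [show -((m : ℤ) + 1) + 1 = -m by ring, h1, h3, poch_mul_zpow_neg hq0 hb,
      zpow_sub₀ hq0 _ (((m + 1).choose 2 : ℕ) : ℤ), zpow_natCast]
    ring_nf

theorem bilateral_zero {b : ℂ} (hb : b ≠ 0) (hb1 : ∀ i : ℕ, b * q * q ^ i ≠ 1) :
    qPoch (b * q) q * (∑' n : ℕ, q ^ n ^ 2 * (poch (b * q) q n)⁻¹
      + ∑' m : ℕ, (-b) ^ (m + 1) * q ^ (m + 2).choose 2 * poch b⁻¹ q (m + 1))
    = thetaEven q * (∑' m : ℕ, (b ^ 2) ^ m * q ^ (m ^ 2 + 1 * m) * (poch q q (2 * m + 0))⁻¹)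
      - b * q * thetaOdd q *
        ∑' m : ℕ, (b ^ 2) ^ m * q ^ (m ^ 2 + 2 * m) * (poch q q (2 * m + 1))⁻¹ := by
  have h := tsum_bilateral_eq hq0 hq hb hb1 0
    (by convert hasSum_bilateral_zero hq0 hq b using 4; simp)
  rw [tsum_mul_left] at h
  have e (m : ℕ) : q ^ (((m : ℤ) + 1) ^ 2 - 0 * (m + 1) - (m + 1).choose 2)
      = q ^ (m + 2).choose 2 := by
    rw [← zpow_natCast]
    congr 1
    have h1 := two_mul_choose_cast (m + 1)
    have h2 := two_mul_choose_cast (m + 2)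
    push_cast at h1 h2
    linarith
  have e' (n : ℕ) : q ^ ((n : ℤ) ^ 2 + 0 * n) = q ^ n ^ 2 := by
    rw [← zpow_natCast]; simp
  simp only [e, e'] at h
  linear_combination -h

theorem bilateral_one {b : ℂ} (hb : b ≠ 0) (hb1 : ∀ i : ℕ, b * q * q ^ i ≠ 1) :
    qPoch (b * q) q * (∑' n : ℕ, q ^ (n ^ 2 + n) * (poch (b * q) q n)⁻¹
      + ∑' m : ℕ, (-b) ^ (m + 1) * q ^ (m + 1).choose 2 * poch b⁻¹ q (m + 1))
    = thetaOdd q * (∑' m : ℕ, (b ^ 2) ^ m * q ^ (m ^ 2 + 0 * m) * (poch q q (2 * m + 0))⁻¹)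
      - b * thetaEven q *
        ∑' m : ℕ, (b ^ 2) ^ m * q ^ (m ^ 2 + 1 * m) * (poch q q (2 * m + 1))⁻¹ := by
  have h := tsum_bilateral_eq hq0 hq hb hb1 1
    (by convert hasSum_bilateral_one hq0 hq b using 4; simp)
  rw [tsum_mul_left] at h
  have e (m : ℕ) : q ^ (((m : ℤ) + 1) ^ 2 - 1 * (m + 1) - (m + 1).choose 2)
      = q ^ (m + 1).choose 2 := by
    rw [← zpow_natCast]
    congr 1
    have h1 := two_mul_choose_cast (m + 1)
    push_cast at h1
    linarith
  have e' (n : ℕ) : q ^ ((n : ℤ) ^ 2 + 1 * n) = q ^ (n ^ 2 + n) := by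
    rw [← zpow_natCast]; simp
  simp only [e, e'] at h
  linear_combination -h

/-- Take b = -1. The half n < 0 involves (-1)_(m+1), so it is the series of 1 + 2ψ₀ without its
constant term. -/
theorem f0_add_two_mul_psi0 : f0 q + 2 * psi0 q =
    (thetaEven q * rogersSum 0 1 q + q * thetaOdd q * rogersSum 1 2 q) / qPoch (-q) q := by
  have hq' : ‖-q‖ < 1 := by simpa using hq
  have h := bilateral_zero hq0 hq (b := -1) (by norm_num) (by simpa using mul_pow_ne_one hq hq')
  have hs : Summable fun n : ℕ => q ^ (n + 1).choose 2 * poch (-1) q n := by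
    obtain ⟨B, hB⟩ := exists_norm_poch_le' hq (-1)
    exact Summable.of_norm_bounded ((summable_geometric_of_lt_one (norm_nonneg _) hq).mul_left B)
      fun n => norm_pow_mul_le hq (le_choose_two_succ n) (hB n)
  have h1 := psi0_eq hq0 hq
  rw [hs.tsum_eq_zero_add] at h1
  simp only [zero_add, Nat.choose_succ_self, pow_zero, poch_zero, one_mul, add_right_inj] at h1
  simp only [neg_neg, one_pow, one_mul, neg_mul, sub_neg_eq_add, inv_neg, inv_one] at h
  rw [← f0_eq hq0 hq, ← h1] at h
  rw [eq_div_iff (qPoch_ne_zero' hq hq'), mul_comm, h]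
  simp [rogersSum]

theorem f1_add_two_mul_psi1 : f1 q + 2 * psi1 q =
    (thetaOdd q * rogersSum 0 0 q + thetaEven q * rogersSum 1 1 q) / qPoch (-q) q := by
  have hq' : ‖-q‖ < 1 := by simpa using hq
  have h := bilateral_one hq0 hq (b := -1) (by norm_num) (by simpa using mul_pow_ne_one hq hq')
  simp only [neg_neg, one_pow, one_mul, neg_mul, sub_neg_eq_add, inv_neg, inv_one] at h
  have e (m : ℕ) : q ^ (m + 1).choose 2 * poch (-1) q (m + 1)
      = 2 * (q ^ (m + 1).choose 2 * poch (-q) q m) := by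
    rw [poch_succ', neg_one_mul]; ring
  simp only [e, tsum_mul_left] at h
  rw [← f1_eq hq0 hq, ← psi1_eq hq0 hq] at h
  rw [eq_div_iff (qPoch_ne_zero' hq hq'), mul_comm, h]
  simp [rogersSum]

end bilateral

/-! ### The rows in q^(1/2): bilateral series in base p². -/

section half
variable {p : ℂ} (hp0 : p ≠ 0) (hp : ‖p‖ < 1)
include hp0 hp

/-- Take b = 1/p in base p². Both Eulerian series contain a term 1 at n = 0, whereas the bilateral
series counts it once; this explains the -1. -/
theorem neg_one_add_F0_add_phi0 : -1 + F0 p + phi0 (-p) =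
    (thetaEven (p ^ 2) * rogersSum 0 0 (p ^ 2) - p * thetaOdd (p ^ 2) * rogersSum 1 1 (p ^ 2))
      / qPoch p (p ^ 2) := by
  have hq := norm_sq_lt_one hp
  have hq0 : p ^ 2 ≠ 0 := pow_ne_zero 2 hp0
  have hb : p⁻¹ * p ^ 2 = p := by field_simp
  have h := bilateral_zero hq0 hq (b := p⁻¹) (inv_ne_zero hp0)
    (by rw [hb]; exact mul_pow_ne_one hq hp)
  have hp' : ‖-p‖ < 1 := by simpa using hp
  have hs : Summable fun n : ℕ => (-p) ^ n ^ 2 * poch p (p ^ 2) n := by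
    obtain ⟨B, hB⟩ := exists_norm_poch_le' hq p
    exact Summable.of_norm_bounded ((summable_geometric_of_lt_one (norm_nonneg _) hp').mul_left B)
      fun n => norm_pow_mul_le hp' (Nat.le_self_pow two_ne_zero n) (hB n)
  have h1 := phi0_eq (neg_ne_zero.2 hp0) hp'
  simp only [neg_neg, neg_sq] at h1
  rw [hs.tsum_eq_zero_add] at h1
  have e (m : ℕ) : (-p⁻¹) ^ (m + 1) * (p ^ 2) ^ (m + 2).choose 2 = (-p) ^ (m + 1) ^ 2 := by
    have h1 : (m + 1) ^ 2 + (m + 1) = 2 * (m + 2).choose 2 := by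
      have := two_mul_choose_cast (m + 2)
      zify
      push_cast at this
      linarith
    have h2 : (-p) ^ (m + 1) ≠ 0 := pow_ne_zero _ (neg_ne_zero.2 hp0)
    refine mul_right_cancel₀ h2 ?_
    rw [← pow_add, h1, pow_mul, neg_sq, mul_right_comm, ← mul_pow, neg_mul_neg,
      inv_mul_cancel₀ hp0, one_pow, one_mul]
  have e1 (m c : ℕ) : (p⁻¹ ^ 2) ^ m * (p ^ 2) ^ (m ^ 2 + (c + 1) * m) = (p ^ 2) ^ (m ^ 2 + c * m) := by
    rw [show m ^ 2 + (c + 1) * m = m + (m ^ 2 + c * m) by ring, pow_add _ m, ← mul_assoc, ← mul_pow,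
      ← mul_pow, inv_mul_cancel₀ hp0]
    simp
  simp only [inv_inv, hb, e, e1 _ 0, e1 _ 1] at h
  simp only [ne_eq, OfNat.ofNat_ne_zero, not_false_eq_true, zero_pow, pow_zero, poch_zero,
    one_mul] at h1
  rw [← F0_eq hp0 hp] at h
  rw [eq_div_iff (qPoch_ne_zero' hq hp), h1, rogersSum, rogersSum]
  linear_combination h

/-- Take b = p in base p². The denominators start at p³, so a common factor 1 - p must be restored
on both halves. -/
theorem F1_sub_phi1 : F1 p - p⁻¹ * phi1 (-p) =
    (thetaOdd (p ^ 2) * rogersSum 0 1 (p ^ 2) - p * thetaEven (p ^ 2) * rogersSum 1 2 (p ^ 2))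
      / qPoch p (p ^ 2) := by
  have hq := norm_sq_lt_one hp
  have hq0 : p ^ 2 ≠ 0 := pow_ne_zero 2 hp0
  have hpq : ‖p * p ^ 2‖ < 1 := by
    rw [norm_mul]; exact mul_lt_one_of_nonneg_of_lt_one_left (norm_nonneg _) hp hq.le
  have h := bilateral_one hq0 hq (b := p) hp0 (mul_pow_ne_one hq hpq)
  have hp' : ‖-p‖ < 1 := by simpa using hp
  have h1 := phi1_eq (neg_ne_zero.2 hp0) hp'
  simp only [neg_neg, neg_sq] at h1
  have hp1 : 1 - p ≠ 0 := by simpa using one_sub_pow_ne_zero hp 0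
  have hQ : qPoch p (p ^ 2) = (1 - p) * qPoch (p * p ^ 2) (p ^ 2) := by
    simpa [poch_succ] using qPoch_eq hq p 1
  have e (m : ℕ) : (-p) ^ (m + 1) * (p ^ 2) ^ (m + 1).choose 2 * poch p⁻¹ (p ^ 2) (m + 1)
      = (1 - p) * ((-p) ^ (m ^ 2 + 2 * m) * poch p (p ^ 2) m) := by
    have h1 : m ^ 2 + 2 * m = m + 2 * (m + 1).choose 2 := by
      have := two_mul_choose_cast (m + 1)
      zify
      push_cast at this
      linarith
    rw [poch_succ', h1, show p⁻¹ * p ^ 2 = p by field_simp, pow_add (-p) m (2 * _),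
      pow_mul, neg_sq, pow_succ]
    field_simp
    ring
  have e1 (m c : ℕ) : (p ^ 2) ^ m * (p ^ 2) ^ (m ^ 2 + c * m) = (p ^ 2) ^ (m ^ 2 + (c + 1) * m) := by
    rw [← pow_add]; ring_nf
  have e2 (n : ℕ) : (p ^ 2) ^ (n ^ 2 + n) * (poch (p * p ^ 2) (p ^ 2) n)⁻¹
      = (1 - p) * ((p ^ 2) ^ (n ^ 2 + n) * (poch p (p ^ 2) (n + 1))⁻¹) := by
    rw [poch_succ', mul_inv]; field_simp
  simp only [e, e1, e2, tsum_mul_left] at h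
  rw [← F1_eq hp0 hp] at h
  rw [eq_div_iff (qPoch_ne_zero' hq hp), h1, rogersSum, rogersSum, hQ, ← mul_assoc p⁻¹, mul_neg,
    inv_mul_cancel₀ hp0, neg_one_mul]
  linear_combination h

end half

end MockTheta
namespace MockTheta
open Filter Topology Finset

/-! ### Theta series of shifted lattices -/

/-- `e(z) = exp (2 π i z)`. -/
def ee (z : ℂ) : ℂ := Complex.exp (2 * Real.pi * Complex.I * z)

lemma ee_add (z w : ℂ) : ee (z + w) = ee z * ee w := by rw [ee, ee, ee, mul_add, Complex.exp_add]

lemma ee_int (n : ℤ) : ee n = 1 := by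
  rw [ee, mul_comm]; exact Complex.exp_int_mul_two_pi_mul_I n

lemma ee_zero : ee 0 = 1 := by simp [ee]

lemma ee_ne_zero (z : ℂ) : ee z ≠ 0 := Complex.exp_ne_zero _

lemma ee_add_int (z : ℂ) (n : ℤ) : ee (z + n) = ee z := by rw [ee_add, ee_int, mul_one]

lemma ee_eq_of_sub_eq_int {z w : ℂ} (n : ℤ) (h : z - w = n) : ee z = ee w := by
  rw [← ee_add_int w n, ← h]; ring_nf

lemma ee_pow (z : ℂ) (n : ℕ) : ee z ^ n = ee (n * z) := by
  rw [ee, ee, ← Complex.exp_nat_mul]; ring_nf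

lemma ee_zpow (z : ℂ) (n : ℤ) : ee z ^ n = ee (n * z) := by
  rw [ee, ee, ← Complex.exp_int_mul]; ring_nf

lemma norm_ee (z : ℂ) : ‖ee z‖ = Real.exp (-2 * Real.pi * z.im) := by
  rw [ee, Complex.norm_exp]; simp

lemma norm_ee_lt_one {z : ℂ} (hz : 0 < z.im) : ‖ee z‖ < 1 := by
  rw [norm_ee, Real.exp_lt_one_iff]
  nlinarith [Real.pi_pos]

/-- `∑_n e(c (n + x)² τ)` over the integers. -/
def lth (c x : ℝ) (τ : ℂ) : ℂ := ∑' n : ℤ, ee (c * (n + x) ^ 2 * τ)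

lemma ee_eq_jacobiTheta₂_term (c x : ℝ) (τ : ℂ) (n : ℤ) : ee (c * (n + x) ^ 2 * τ) =
    ee (c * x ^ 2 * τ) * jacobiTheta₂_term n (2 * c * x * τ) (2 * c * τ) := by
  rw [ee, ee, jacobiTheta₂_term, ← Complex.exp_add]
  ring_nf

lemma im_mul_pos {c : ℝ} (hc : 0 < c) {τ : ℂ} (hτ : 0 < τ.im) : 0 < (2 * c * τ).im := by
  have : (2 * c * τ).im = 2 * c * τ.im := by simp
  rw [this]; positivity

lemma lth_eq_jacobiTheta₂ (c x : ℝ) (τ : ℂ) :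
    lth c x τ = ee (c * x ^ 2 * τ) * jacobiTheta₂ (2 * c * x * τ) (2 * c * τ) := by
  simp only [lth, ee_eq_jacobiTheta₂_term, tsum_mul_left, jacobiTheta₂]

lemma summable_lth {c : ℝ} (hc : 0 < c) (x : ℝ) {τ : ℂ} (hτ : 0 < τ.im) :
    Summable fun n : ℤ => ee (c * (n + x) ^ 2 * τ) := by
  simp only [ee_eq_jacobiTheta₂_term]
  exact (hasSum_jacobiTheta₂_term _ (im_mul_pos hc hτ)).summable.mul_left _

lemma differentiableAt_lth {c : ℝ} (hc : 0 < c) (x : ℝ) {τ : ℂ} (hτ : 0 < τ.im) :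
    DifferentiableAt ℂ (lth c x) τ := by
  have h1 := (hasFDerivAt_jacobiTheta₂ (2 * c * x * τ) (im_mul_pos hc hτ)).differentiableAt
  have h2 : DifferentiableAt ℂ (fun τ : ℂ => ((2 * c * x * τ, 2 * c * τ) : ℂ × ℂ)) τ := by fun_prop
  have h3 : DifferentiableAt ℂ (fun τ : ℂ => ee (c * x ^ 2 * τ)) τ := by unfold ee; fun_prop
  have := h3.mul (DifferentiableAt.comp τ h1 h2)
  exact this.congr_of_eventuallyEq (.of_forall fun τ => lth_eq_jacobiTheta₂ c x τ)

lemma lth_add_int (c x : ℝ) (τ : ℂ) (m : ℤ) : lth c (x + m) τ = lth c x τ := by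
  rw [lth, lth, ← (Equiv.addRight m).tsum_eq fun n : ℤ => ee (c * (n + x) ^ 2 * τ)]
  refine tsum_congr fun n => ?_
  simp only [Equiv.coe_addRight]
  push_cast
  ring_nf

lemma lth_neg (c x : ℝ) (τ : ℂ) : lth c (-x) τ = lth c x τ := by
  rw [lth, lth, ← (Equiv.neg ℤ).tsum_eq]
  refine tsum_congr fun n => ?_
  simp only [Equiv.neg_apply]
  push_cast
  ring_nf

/-- `√(-i τ)`. -/
def sqrtI (τ : ℂ) : ℂ := (-Complex.I * τ) ^ (1 / 2 : ℂ)

lemma sqrtI_ne_zero {τ : ℂ} (hτ : τ ≠ 0) : sqrtI τ ≠ 0 := by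
  rw [sqrtI, Ne, Complex.cpow_eq_zero_iff]
  simp [hτ]

lemma sqrtI_sq (τ : ℂ) : sqrtI τ ^ 2 = -Complex.I * τ := by
  rw [sqrtI, ← Complex.cpow_nat_mul]; simp

/-- A positive real factor does not change the argument, so the principal logarithm is additive
here. -/
lemma sqrtI_ofReal_mul {r : ℝ} (hr : 0 < r) {τ : ℂ} (hτ : τ ≠ 0) :
    sqrtI (r * τ) = (√r : ℝ) * sqrtI τ := by
  have h1 : (-Complex.I * τ) ≠ 0 := by simp [hτ]
  have h2 : (r : ℂ) ≠ 0 := by exact_mod_cast hr.ne'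
  rw [sqrtI, sqrtI, mul_left_comm, Complex.cpow_def_of_ne_zero (mul_ne_zero h2 h1),
    Complex.cpow_def_of_ne_zero h1, Complex.log_ofReal_mul hr h1, add_mul, Complex.exp_add,
    Real.sqrt_eq_rpow, Complex.ofReal_cpow hr.le, Complex.cpow_def_of_ne_zero h2,
    Complex.ofReal_log hr.le]
  simp

lemma ne_zero_of_im_pos {τ : ℂ} (hτ : 0 < τ.im) : τ ≠ 0 := by
  rintro rfl; simp at hτ

lemma inversion_term {c : ℝ} (hc : 0 < c) (x : ℝ) {τ : ℂ} (hτ : 0 < τ.im) (n : ℤ) :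
    ee (n * x) * ee (n ^ 2 * (-1 / τ) / (4 * c)) =
      jacobiTheta₂_term n (2 * c * x * τ / (2 * c * τ)) (-1 / (2 * c * τ)) := by
  have h0 := ne_zero_of_im_pos hτ
  have hc' : (c : ℂ) ≠ 0 := by exact_mod_cast hc.ne'
  rw [← ee_add, ee, jacobiTheta₂_term]
  congr 1
  field_simp
  ring

/-- Jacobi's functional equation of the two variable theta function. Its Gaussian prefactor cancels
the factor e(c x² τ) that comes from shifting the lattice. -/
theorem lth_eq_inversion {c : ℝ} (hc : 0 < c) (x : ℝ) {τ : ℂ} (hτ : 0 < τ.im) :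
    lth c x τ = ((√(2 * c) : ℝ) : ℂ)⁻¹ * (sqrtI τ)⁻¹ *
      ∑' n : ℤ, ee (n * x) * ee (n ^ 2 * (-1 / τ) / (4 * c)) := by
  have h0 := ne_zero_of_im_pos hτ
  have hc' : (c : ℂ) ≠ 0 := by exact_mod_cast hc.ne'
  have h1 : (-Complex.I * (2 * c * τ)) ^ (1 / 2 : ℂ) = (√(2 * c) : ℝ) * sqrtI τ := by
    rw [← sqrtI_ofReal_mul (by positivity) h0, sqrtI]
    push_cast
    rfl
  have h2 : ee (c * x ^ 2 * τ) * Complex.exp (-Real.pi * Complex.I * (2 * c * x * τ) ^ 2 / (2 * c * τ))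
      = 1 := by
    rw [ee, ← Complex.exp_add, ← Complex.exp_zero]
    congr 1
    field_simp
    ring
  rw [lth_eq_jacobiTheta₂, jacobiTheta₂_functional_equation, h1, jacobiTheta₂,
    tsum_congr fun n => (inversion_term hc x hτ n).symm]
  linear_combination (1 / (((√(2 * c) : ℝ) : ℂ) * sqrtI τ) *
    ∑' n : ℤ, ee (n * x) * ee (n ^ 2 * (-1 / τ) / (4 * c))) * h2

lemma neg_one_div_im_pos {τ : ℂ} (hτ : 0 < τ.im) : 0 < (-1 / τ).im := by
  have := UpperHalfPlane.im_inv_neg_coe_pos ⟨τ, hτ⟩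
  rwa [show -1 / τ = (-τ)⁻¹ by rw [inv_neg, neg_div, one_div]]

lemma summable_inversion {c : ℝ} (hc : 0 < c) (x : ℝ) {τ : ℂ} (hτ : 0 < τ.im) :
    Summable fun n : ℤ => ee (n * x) * ee (n ^ 2 * (-1 / τ) / (4 * c)) := by
  simp only [inversion_term hc x hτ]
  refine (hasSum_jacobiTheta₂_term _ ?_).summable
  refine neg_one_div_im_pos (im_mul_pos hc hτ)

lemma arg_neg_I_mul_ne_pi {τ : ℂ} (hτ : 0 < τ.im) : (-Complex.I * τ).arg ≠ Real.pi := by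
  intro h
  have h1 := (Complex.arg_eq_pi_iff.1 h).1
  simp at h1
  linarith

lemma sqrtI_neg_one_div {τ : ℂ} (hτ : 0 < τ.im) : sqrtI (-1 / τ) = (sqrtI τ)⁻¹ := by
  have h0 := ne_zero_of_im_pos hτ
  rw [sqrtI, sqrtI, ← Complex.inv_cpow _ _ (arg_neg_I_mul_ne_pi hτ)]
  congr 1
  rw [mul_inv, inv_neg, Complex.inv_I]
  ring

/-- Splitting a sum over the integers into residue classes. -/
lemma tsum_int_eq_sum_range {N : ℕ} (hN : N ≠ 0) {f : ℤ → ℂ} (hf : Summable f) :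
    ∑' n, f n = ∑ j ∈ range N, ∑' n : ℤ, f (j + N * n) := by
  have : NeZero N := ⟨hN⟩
  have hs := (Int.divModEquiv N).symm.summable_iff.2 hf
  have h := ((Equiv.prodComm (Fin N) ℤ).summable_iff.2 hs).tsum_prod
  rw [← (Int.divModEquiv N).symm.tsum_eq f, ← (Equiv.prodComm (Fin N) ℤ).tsum_eq]
  refine h.trans ?_
  rw [tsum_fintype, Finset.sum_range fun j => ∑' n : ℤ, f (j + N * n)]
  refine sum_congr rfl fun j _ => tsum_congr fun n => ?_
  simp [Int.divModEquiv, add_comm, mul_comm]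

/-- The transformation of `lth c (h / (2 c))`, for `2 c = N` an integer. -/
theorem lth_inversion {N : ℕ} (hN : N ≠ 0) (h : ℤ) {τ : ℂ} (hτ : 0 < τ.im) :
    lth (N / 2) (h / N) (-1 / τ) = ((√N : ℝ) : ℂ)⁻¹ * sqrtI τ *
      ∑ j ∈ range N, ee (j * h / N) * lth (N / 2) (j / N) τ := by
  have hN' : (0 : ℝ) < N := by exact_mod_cast Nat.pos_of_ne_zero hN
  have hNc : (N : ℂ) ≠ 0 := by exact_mod_cast hN
  have h0 := ne_zero_of_im_pos hτ
  have hc : (0 : ℝ) < N / 2 := by positivity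
  have hτ' := neg_one_div_im_pos hτ
  have h1 : (sqrtI (-1 / τ))⁻¹ = sqrtI τ := by rw [sqrtI_neg_one_div hτ, inv_inv]
  have h2 : -1 / (-1 / τ) = τ := by field_simp
  rw [lth_eq_inversion hc _ hτ', h1, tsum_int_eq_sum_range hN (summable_inversion hc _ hτ'), h2,
    mul_div_cancel₀ _ (two_ne_zero' ℝ)]
  congr 1
  refine sum_congr rfl fun j _ => ?_
  rw [lth, ← tsum_mul_left]
  refine tsum_congr fun n => ?_
  congr 1
  · refine ee_eq_of_sub_eq_int (n * h) ?_
    push_cast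
    field_simp
    ring
  · congr 1
    push_cast
    field_simp
    ring

lemma lth_ofReal_mul (c x r : ℝ) (τ : ℂ) : lth c x (r * τ) = lth (c * r) x τ := by
  rw [lth, lth]
  refine tsum_congr fun n => ?_
  push_cast
  ring_nf

/-! ### The eta function -/

lemma eta_eq_ee_mul_qPoch (τ : ℂ) : ModularForm.eta τ = ee (τ / 24) * qPoch (ee τ) (ee τ) := by
  rw [ModularForm.eta, qPoch]
  congr 1
  · rw [Function.Periodic.qParam, ee]; push_cast; ring_nf
  · refine tprod_congr fun n => ?_
    rw [ModularForm.eta_q_eq_pow, ee]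
    ring

lemma eta_neg_one_div {τ : ℂ} (hτ : 0 < τ.im) :
    ModularForm.eta (-1 / τ) = sqrtI τ * ModularForm.eta τ := by
  have h := ModularForm.eta_comp_eq_csqrt_I_inv hτ
  -- A comparison of branches: -iτ has positive real part, so adding the argument π/2 of i stays
  -- inside (-π, π).
  have h1 : sqrtI τ = (Complex.sqrt Complex.I)⁻¹ * Complex.sqrt τ := by
    set w := -Complex.I * τ with hw
    have hw0 : w ≠ 0 := by simp [hw, ne_zero_of_im_pos hτ]
    have hre : 0 < w.re := by simpa [hw] using hτ
    have hτw : τ = Complex.I * w := by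
      rw [hw, ← mul_assoc, mul_neg, Complex.I_mul_I, neg_neg, one_mul]
    have harg := abs_lt.1 (Complex.abs_arg_lt_pi_div_two_iff.2 (.inl hre))
    have hlog : Complex.log (Complex.I * w) = Complex.log Complex.I + Complex.log w :=
      (Complex.log_mul_eq_add_log_iff Complex.I_ne_zero hw0).2 (by
        rw [Complex.arg_I]; constructor <;> linarith [harg.1, harg.2])
    have hI : (Complex.sqrt Complex.I) ≠ 0 := by simp [Complex.sqrt, Complex.cpow_eq_zero_iff]
    rw [eq_inv_mul_iff_mul_eq₀ hI, sqrtI, ← hw, hτw, Complex.sqrt, Complex.sqrt, one_div,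
      Complex.cpow_def_of_ne_zero Complex.I_ne_zero, Complex.cpow_def_of_ne_zero hw0,
      Complex.cpow_def_of_ne_zero (mul_ne_zero Complex.I_ne_zero hw0), hlog, add_mul,
      Complex.exp_add]
  rw [h1]
  simpa [mul_assoc] using h

lemma tsum_two_mul {F : ℕ → ℂ} {f : ℤ → ℂ} (hF : Summable F) (hf : Summable f)
    (h : ∀ s : ℕ, F (2 * s) + F (2 * s + 1) = f s + f (-(s + 1))) : ∑' n, F n = ∑' s, f s := by
  have hinj : ∀ c, Function.Injective fun s : ℕ => 2 * s + c := fun c x y h => by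
    simp only at h; omega
  have hs : ∀ c, Summable fun s : ℕ => F (2 * s + c) := fun c => hF.comp_injective (hinj c)
  have h1 : Summable fun n : ℕ => f n := hf.comp_injective Nat.cast_injective
  have h2 : Summable fun n : ℕ => f (-(n + 1)) :=
    hf.comp_injective (i := fun n : ℕ => (-((n : ℤ) + 1))) fun a b hab => by simpa using hab
  rw [← tsum_even_add_odd (hs 0) (hs 1), tsum_of_nat_of_neg_add_one h1 h2,
    ← Summable.tsum_add h1 h2]
  exact (Summable.tsum_add (hs 0) (hs 1)).symm.trans (tsum_congr h)

/-- Euler's pentagonal number theorem is the well-poised sum at x = q, w = 0. -/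
lemma qPoch_eq_pentagonal {q : ℂ} (hq : ‖q‖ < 1) : qPoch q q =
    ∑' m : ℕ, (-1) ^ m * q ^ (m ^ 2 + (m + 1).choose 2) * (1 - q ^ (2 * m + 1)) ∧
    Summable fun m : ℕ => (-1) ^ m * q ^ (m ^ 2 + (m + 1).choose 2) * (1 - q ^ (2 * m + 1)) := by
  have e (m : ℕ) : wpTerm q 0 q m =
      (-1) ^ m * q ^ (m ^ 2 + (m + 1).choose 2) * (1 - q ^ (2 * m + 1)) := by
    rw [wpTerm, div_self (poch_ne_zero' hq hq m)]
    have h1 := sq_eq_choose_two m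
    have h2 : wpNum (q * q) 0 q m / poch 0 q m =
        (-1) ^ m * q ^ (m ^ 2 + (m + 1).choose 2) := by
      rw [wpNum_zero_mid, poch_zero_left, div_one, choose_two_succ, h1, ← pow_two, ← pow_mul,
        mul_assoc, ← pow_add, ← pow_add]
      ring_nf
    rw [h2]
    ring
  have h := tsum_wpTerm (x := q) (w := 0) hq (by simp)
  have h' := summable_wpTerm (x := q) (w := 0) hq (by simp)
  rw [funext e] at h'
  simp only [e, qPoch_zero_left, div_one] at h
  exact ⟨h.symm, h'⟩

/-- The even m of the pentagonal series give the nonnegative lattice points and the odd m the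
negative ones. In this form η becomes subject to the same treatment under Γ(3600) as the other theta
series. -/
theorem eta_eq_lth {τ : ℂ} (hτ : 0 < τ.im) :
    ModularForm.eta τ = lth 6 (1 / 12) τ - lth 6 (5 / 12) τ := by
  obtain ⟨h1, h2⟩ := qPoch_eq_pentagonal (norm_ee_lt_one hτ)
  have s1 := summable_lth (c := 6) (by norm_num) (1 / 12) hτ
  have s2 := summable_lth (c := 6) (by norm_num) (5 / 12) hτ
  rw [eta_eq_ee_mul_qPoch, h1, ← tsum_mul_left, lth, lth, ← s1.tsum_sub s2]
  refine tsum_two_mul (h2.mul_left _) (s1.sub s2) fun s => ?_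
  have hc (m : ℕ) : (((m + 1).choose 2 : ℕ) : ℂ) = (m ^ 2 + m) / 2 := by
    have := congrArg (Int.cast (R := ℂ)) (two_mul_choose_cast (m + 1))
    push_cast at this
    linear_combination this / 2
  have e (m : ℕ) : ee (τ / 24) * ((-1) ^ m * ee τ ^ (m ^ 2 + (m + 1).choose 2)
      * (1 - ee τ ^ (2 * m + 1)))
      = (-1) ^ m * (ee ((6 * m + 1) ^ 2 / 24 * τ) - ee ((6 * m + 5) ^ 2 / 24 * τ)) := by
    have h1 : ee ((6 * m + 1) ^ 2 / 24 * τ) = ee (τ / 24) * ee τ ^ (m ^ 2 + (m + 1).choose 2) := by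
      rw [ee_pow, ← ee_add]
      push_cast
      rw [hc]
      ring_nf
    have h2 : ee ((6 * m + 5) ^ 2 / 24 * τ)
        = ee (τ / 24) * ee τ ^ (m ^ 2 + (m + 1).choose 2) * ee τ ^ (2 * m + 1) := by
      rw [ee_pow, ee_pow, ← ee_add, ← ee_add]
      push_cast
      rw [hc]
      ring_nf
    rw [h1, h2]
    ring
  rw [e, e, pow_succ (-1 : ℂ), pow_mul (-1 : ℂ), neg_one_sq, one_pow, one_mul, one_mul, neg_one_mul]
  push_cast
  have a1 : ee ((6 * (2 * s) + 1) ^ 2 / 24 * τ) = ee (6 * (s + 1 / 12) ^ 2 * τ) := by ring_nf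
  have a2 : ee ((6 * (2 * s) + 5) ^ 2 / 24 * τ) = ee (6 * (s + 5 / 12) ^ 2 * τ) := by ring_nf
  have a3 : ee ((6 * (2 * s + 1) + 1) ^ 2 / 24 * τ) = ee (6 * (-(s + 1) + 5 / 12) ^ 2 * τ) := by
    ring_nf
  have a4 : ee ((6 * (2 * s + 1) + 5) ^ 2 / 24 * τ) = ee (6 * (-(s + 1) + 1 / 12) ^ 2 * τ) := by
    ring_nf
  rw [a1, a2, a3, a4]
  ring

end MockTheta
namespace MockTheta
open Filter Topology Finset

/-! ### The theta functions of Rogers' identities under inversion -/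

/-- `∑ e(n² τ / 60)` over `n ≡ r` minus the same sum over `n ≡ 11 r`, modulo `30`. -/
def rogersTheta (r : ℤ) (τ : ℂ) : ℂ := lth 15 (r / 30) τ - lth 15 ((11 * r : ℤ) / 30) τ

/-- The coefficients `4 sin (2 π j / 5) sin (π j / 3)`. -/
def sinCoeff (j : ℤ) : ℝ := 4 * Real.sin (2 * Real.pi * j / 5) * Real.sin (Real.pi * j / 3)

lemma sinCoeff_neg (j : ℤ) : sinCoeff (-j) = sinCoeff j := by
  simp only [sinCoeff, Int.cast_neg, mul_neg, neg_div, Real.sin_neg]; ring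

lemma sinCoeff_add (j m : ℤ) : sinCoeff (j + 30 * m) = sinCoeff j := by
  have h1 : 2 * Real.pi * (j + 30 * m : ℤ) / 5 = 2 * Real.pi * j / 5 + (6 * m : ℤ) * (2 * Real.pi) := by
    push_cast; ring
  have h2 : Real.pi * (j + 30 * m : ℤ) / 3 = Real.pi * j / 3 + (5 * m : ℤ) * (2 * Real.pi) := by
    push_cast; ring
  rw [sinCoeff, h1, h2, Real.sin_add_int_mul_two_pi, Real.sin_add_int_mul_two_pi, sinCoeff]

/-- 11 is 1 modulo 5 and -1 modulo 3. Hence the coefficient is antisymmetric under j ↦ 11 j, like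
`rogersTheta`. -/
lemma sinCoeff_eleven (j : ℤ) : sinCoeff (11 * j) = -sinCoeff j := by
  have h1 : 2 * Real.pi * (11 * j : ℤ) / 5 = 2 * Real.pi * j / 5 + (2 * j : ℤ) * (2 * Real.pi) := by
    push_cast; ring
  have h2 : Real.pi * (11 * j : ℤ) / 3 = -(Real.pi * j / 3) + (2 * j : ℤ) * (2 * Real.pi) := by
    push_cast; ring
  rw [sinCoeff, h1, h2, Real.sin_add_int_mul_two_pi, Real.sin_add_int_mul_two_pi, Real.sin_neg,
    sinCoeff]
  ring

lemma sinCoeff_three (j : ℤ) : sinCoeff (3 * j) = 0 := by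
  have h2 : Real.pi * (3 * j : ℤ) / 3 = j * Real.pi := by push_cast; ring
  rw [sinCoeff, h2, Real.sin_int_mul_pi, mul_zero]

lemma sinCoeff_five (j : ℤ) : sinCoeff (5 * j) = 0 := by
  have h2 : 2 * Real.pi * (5 * j : ℤ) / 5 = (2 * j : ℤ) * Real.pi := by push_cast; ring
  rw [sinCoeff, h2, Real.sin_int_mul_pi, mul_zero, zero_mul]

lemma ee_add_ee_neg (x : ℝ) : ee x + ee (-x) = 2 * (Real.cos (2 * Real.pi * x) : ℝ) := by
  rw [Complex.ofReal_cos, Complex.two_cos, ee, ee]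
  push_cast
  ring_nf

lemma ee_sub_ee_eleven (j : ℤ) :
    (ee (j / 30) - ee (11 * j / 30)) + (ee (-j / 30) - ee (-(11 * j) / 30)) = sinCoeff j := by
  have h1 := ee_add_ee_neg (j / 30)
  have h2 := ee_add_ee_neg (11 * j / 30)
  have h3 : sinCoeff j
      = 2 * Real.cos (2 * Real.pi * (j / 30)) - 2 * Real.cos (2 * Real.pi * (11 * j / 30)) := by
    rw [← mul_sub, Real.cos_sub_cos, sinCoeff]
    have a1 : (2 * Real.pi * (j / 30) + 2 * Real.pi * (11 * j / 30)) / 2 = 2 * Real.pi * j / 5 := by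
      ring
    have a2 : (2 * Real.pi * (j / 30) - 2 * Real.pi * (11 * j / 30)) / 2 = -(Real.pi * j / 3) := by
      ring
    rw [a1, a2, Real.sin_neg]
    ring
  rw [h3]
  push_cast at h1 h2 ⊢
  rw [neg_div, neg_div]
  linear_combination h1 - h2

lemma sum_range_sub_eq {f : ℕ → ℂ} {n : ℕ} (h : f n = f 0) :
    ∑ j ∈ range n, f (n - j) = ∑ j ∈ range n, f j := by
  have := Finset.sum_range_reflect f (n + 1)
  rw [sum_range_succ, sum_range_succ] at this
  simp only [Nat.add_sub_cancel, Nat.sub_self] at this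
  rwa [h, add_left_inj] at this

/-- Inversion of a series of level 30 is a finite Fourier transform on ℤ/30. Evenness in j and
antisymmetry under multiplication by 11 are preserved, and the space so cut out is spanned by the
four functions with r = 1, 2, 4, 7. -/
theorem rogersTheta_neg_one_div (r : ℤ) {τ : ℂ} (hτ : 0 < τ.im) :
    rogersTheta r (-1 / τ) = ((√30 : ℝ) : ℂ)⁻¹ * sqrtI τ *
      (sinCoeff r * rogersTheta 1 τ + sinCoeff (2 * r) * rogersTheta 2 τ
        + sinCoeff (4 * r) * rogersTheta 4 τ + sinCoeff (7 * r) * rogersTheta 7 τ) := by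
  have key (h : ℤ) := lth_inversion (N := 30) (by norm_num) h hτ
  norm_num only [Nat.cast_ofNat] at key
  set L : ℤ → ℂ := fun j => lth 15 (j / 30) τ with hL
  have hL' (j m : ℤ) : L (j + 30 * m) = L j := by
    have : ((j + 30 * m : ℤ) : ℝ) / 30 = j / 30 + m := by push_cast; ring
    simp only [hL, this, lth_add_int]
  have hLn (j : ℤ) : L (-j) = L j := by
    simp only [hL, Int.cast_neg, neg_div, lth_neg]
  set c : ℤ → ℂ := fun j => ee (j * r / 30) - ee (11 * (j * r) / 30) with hc
  have hcL : rogersTheta r (-1 / τ) = ((√30 : ℝ) : ℂ)⁻¹ * sqrtI τ *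
      ∑ j ∈ range 30, c (j : ℕ) * L (j : ℕ) := by
    rw [rogersTheta, key r, key (11 * r), ← mul_sub, ← sum_sub_distrib]
    congr 1
    refine sum_congr rfl fun j _ => ?_
    simp only [hc, hL]
    rw [← sub_mul]
    push_cast
    ring_nf
  set T : ℤ → ℂ := fun j => sinCoeff (j * r) * L j with hT
  have hTs (j m : ℤ) : T (30 * m - j) = T j := by
    simp only [hT]
    rw [show 30 * m - j = -j + 30 * m by ring, hL', hLn, show (-j + 30 * m) * r = -(j * r) + 30 * (m * r) by ring,
      sinCoeff_add, sinCoeff_neg]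
  -- Averaging with j ↦ 30 - j replaces differences of exponentials by products of two sines.
  have hsum : 2 * ∑ j ∈ range 30, c (j : ℕ) * L (j : ℕ) = ∑ j ∈ range 30, T (j : ℕ) := by
    have hc0 (j : ℤ) : c j + c (30 - j) = sinCoeff (j * r) := by
      rw [← ee_sub_ee_eleven]
      simp only [hc]
      push_cast
      congr 1
      congr 1
      · exact ee_eq_of_sub_eq_int r (by ring)
      · exact ee_eq_of_sub_eq_int (11 * r) (by push_cast; ring)
    have h30 : c (30 : ℕ) * L (30 : ℕ) = c (0 : ℕ) * L (0 : ℕ) := by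
      have e1 : c (30 : ℕ) = 0 := by
        have a1 : ee r = 1 := ee_int r
        have a2 : ee (11 * r) = 1 := by exact_mod_cast ee_int (11 * r)
        have a3 : (11 * (30 * r) / 30 : ℂ) = 11 * r := by ring
        simp [hc, a1, a2, a3]
      have e2 : c (0 : ℕ) = 0 := by simp [hc]
      rw [e1, e2, zero_mul, zero_mul]
    rw [two_mul]
    nth_rewrite 1 [← sum_range_sub_eq h30]
    rw [← sum_add_distrib]
    refine sum_congr rfl fun j hj => ?_
    have hj' : ((30 - j : ℕ) : ℤ) = 30 - j := by have := mem_range.1 hj; omega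
    have hLj : L (30 - j) = L j := by rw [← hLn j, ← hL' (-j) 1]; ring_nf
    simp only [hT, hj', hLj, ← hc0]
    ring
  have hT3 (j : ℤ) : T (3 * j) = 0 := by simp [hT, mul_assoc, sinCoeff_three]
  have hT5 (j : ℤ) : T (5 * j) = 0 := by simp [hT, mul_assoc, sinCoeff_five]
  have hU (j : ℤ) : T j + T (11 * j) = sinCoeff (j * r) * rogersTheta j τ := by
    simp only [hT, mul_assoc, sinCoeff_eleven, hL, rogersTheta]
    push_cast
    ring
  have u1 := hU 1
  have u2 := hU 2
  have u4 := hU 4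
  have u7 := hU 7
  have e8 : T (11 * 2) = T 8 := hTs 8 1
  have e14 : T (11 * 4) = T 14 := (hTs 16 2).trans (hTs 14 1)
  have e13 : T (11 * 7) = T 13 := hTs 13 3
  rw [e8] at u2
  rw [e14] at u4
  rw [e13] at u7
  -- Multiples of 3 and of 5 drop out. The other sixteen residues form eight pairs ±j, matched in
  -- turn by multiplication by 11: 1 with 11, 2 with 8, 4 with 14, 7 with 13.
  have hfin : ∑ j ∈ range 30, T (j : ℕ)
      = 2 * (T 1 + T (11 * 1) + (T 2 + T 8) + (T 4 + T 14) + (T 7 + T 13)) := by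
    have t0 := hT3 0
    have t3 := hT3 1
    have t6 := hT3 2
    have t9 := hT3 3
    have t12 := hT3 4
    have t15 := hT3 5
    have t5 := hT5 1
    have t10 := hT5 2
    have ht (j : ℤ) := hTs j 1
    have r1 := ht 1
    have r2 := ht 2
    have r3 := ht 3
    have r4 := ht 4
    have r5 := ht 5
    have r6 := ht 6
    have r7 := ht 7
    have r8 := ht 8
    have r9 := ht 9
    have r10 := ht 10
    have r11 := ht 11
    have r12 := ht 12
    have r13 := ht 13
    have r14 := ht 14
    norm_num only at t0 t3 t6 t9 t12 t15 t5 t10 r1 r2 r3 r4 r5 r6 r7 r8 r9 r10 r11 r12 r13 r14 ⊢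
    simp only [sum_range_succ, sum_range_zero, Nat.cast_ofNat, Nat.cast_zero, Nat.cast_one, t0, t3, t6, t9,
      t12, t15, t5, t10, r1, r2, r3, r4, r5, r6, r7, r8, r9, r10, r11, r12, r13, r14]
    clear_value T
    ring
  rw [hcL, show ∑ j ∈ range 30, c (j : ℕ) * L (j : ℕ) = T 1 + T (11 * 1) + (T 2 + T 8)
    + (T 4 + T 14) + (T 7 + T 13) by linear_combination (hsum.trans hfin) / 2, u1, u2, u4, u7,
    one_mul]

/-! ### Special values -/

lemma sinCoeff_one : (sinCoeff 1 : ℂ) = 2 * (√3 : ℝ) * s2 := by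
  have h : sinCoeff 1 = 2 * √3 * Real.sin (2 * Real.pi / 5) := by
    simp [sinCoeff]; ring
  rw [h, s2]; push_cast; ring

lemma sinCoeff_two : (sinCoeff 2 : ℂ) = 2 * (√3 : ℝ) * s1 := by
  have h : sinCoeff 2 = 2 * √3 * Real.sin (Real.pi / 5) := by
    have a1 : 2 * Real.pi * (2 : ℤ) / 5 = Real.pi - Real.pi / 5 := by push_cast; ring
    have a2 : Real.pi * (2 : ℤ) / 3 = Real.pi - Real.pi / 3 := by push_cast; ring
    rw [sinCoeff, a1, a2, Real.sin_pi_sub, Real.sin_pi_sub, Real.sin_pi_div_three]; ring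
  rw [h, s1]; push_cast; ring

lemma sinCoeff_four : (sinCoeff 4 : ℂ) = 2 * (√3 : ℝ) * s2 := by
  have h : sinCoeff 4 = 2 * √3 * Real.sin (2 * Real.pi / 5) := by
    have a1 : 2 * Real.pi * (4 : ℤ) / 5 = 2 * Real.pi - 2 * Real.pi / 5 := by push_cast; ring
    have a2 : Real.pi * (4 : ℤ) / 3 = Real.pi / 3 + Real.pi := by push_cast; ring
    rw [sinCoeff, a1, a2, Real.sin_two_pi_sub, Real.sin_add_pi, Real.sin_pi_div_three]; ring
  rw [h, s2]; push_cast; ring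

lemma sinCoeff_seven : (sinCoeff 7 : ℂ) = 2 * (√3 : ℝ) * s1 := by
  have h : sinCoeff 7 = 2 * √3 * Real.sin (Real.pi / 5) := by
    have a1 : 2 * Real.pi * (7 : ℤ) / 5 = Real.pi - Real.pi / 5 + 2 * Real.pi := by push_cast; ring
    have a2 : Real.pi * (7 : ℤ) / 3 = Real.pi / 3 + 2 * Real.pi := by push_cast; ring
    rw [sinCoeff, a1, a2, Real.sin_add_two_pi, Real.sin_add_two_pi, Real.sin_pi_sub,
      Real.sin_pi_div_three]; ring
  rw [h, s1]; push_cast; ring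

lemma sinCoeff_eight : (sinCoeff 8 : ℂ) = -(2 * (√3 : ℝ) * s1) := by
  rw [← sinCoeff_two, show (8 : ℤ) = -(11 * 2) + 30 * 1 by norm_num, sinCoeff_add, sinCoeff_neg,
    sinCoeff_eleven]
  push_cast
  rfl

lemma sinCoeff_fourteen : (sinCoeff 14 : ℂ) = -(2 * (√3 : ℝ) * s2) := by
  rw [← sinCoeff_four, show (14 : ℤ) = 11 * 4 + 30 * (-1) by norm_num, sinCoeff_add,
    sinCoeff_eleven]
  push_cast
  rfl

lemma sinCoeff_sixteen : (sinCoeff 16 : ℂ) = -(2 * (√3 : ℝ) * s2) := by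
  rw [← sinCoeff_fourteen, show (16 : ℤ) = -14 + 30 * 1 by norm_num, sinCoeff_add, sinCoeff_neg]

lemma sinCoeff_twentyeight : (sinCoeff 28 : ℂ) = 2 * (√3 : ℝ) * s1 := by
  rw [← sinCoeff_two, show (28 : ℤ) = -2 + 30 * 1 by norm_num, sinCoeff_add, sinCoeff_neg]

lemma sinCoeff_fortynine : (sinCoeff 49 : ℂ) = -(2 * (√3 : ℝ) * s2) := by
  rw [← sinCoeff_one, show (49 : ℤ) = -(11 * 1) + 30 * 2 by norm_num, sinCoeff_add, sinCoeff_neg,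
    sinCoeff_eleven]
  push_cast
  rfl

/-- The common factor `√(-i τ) / √5` times `√2`. -/
lemma sqrt_thirty_inv_mul : ((√30 : ℝ) : ℂ)⁻¹ * (2 * (√3 : ℝ)) = (√2 : ℝ) * ((√5 : ℝ) : ℂ)⁻¹ := by
  have h : (√30)⁻¹ * (2 * √3) = √2 * (√5)⁻¹ := by
    rw [show (30 : ℝ) = 2 * (3 * 5) by norm_num, Real.sqrt_mul (by norm_num),
      Real.sqrt_mul (by norm_num)]
    have h2 := Real.sq_sqrt (show (0 : ℝ) ≤ 2 by norm_num)
    have h3 : √3 ≠ 0 := by positivity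
    field_simp
    exact h2.symm
  exact_mod_cast congrArg (fun x : ℝ => (x : ℂ)) h

section inversion
variable {τ : ℂ} (hτ : 0 < τ.im)
include hτ

lemma rogersTheta_one_neg_one_div : rogersTheta 1 (-1 / τ) = (√2 : ℝ) * ((√5 : ℝ) : ℂ)⁻¹ * sqrtI τ *
    (s2 * rogersTheta 1 τ + s1 * rogersTheta 2 τ + s2 * rogersTheta 4 τ + s1 * rogersTheta 7 τ) := by
  rw [rogersTheta_neg_one_div 1 hτ, ← sqrt_thirty_inv_mul]
  norm_num only [sinCoeff_one, sinCoeff_two, sinCoeff_four, sinCoeff_seven]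
  ring

lemma rogersTheta_two_neg_one_div : rogersTheta 2 (-1 / τ) = (√2 : ℝ) * ((√5 : ℝ) : ℂ)⁻¹ * sqrtI τ *
    (s1 * rogersTheta 1 τ + s2 * rogersTheta 2 τ - s1 * rogersTheta 4 τ - s2 * rogersTheta 7 τ) := by
  rw [rogersTheta_neg_one_div 2 hτ, ← sqrt_thirty_inv_mul]
  norm_num only [sinCoeff_two, sinCoeff_four, sinCoeff_eight, sinCoeff_fourteen]
  ring

lemma rogersTheta_four_neg_one_div : rogersTheta 4 (-1 / τ) = (√2 : ℝ) * ((√5 : ℝ) : ℂ)⁻¹ * sqrtI τ *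
    (s2 * rogersTheta 1 τ - s1 * rogersTheta 2 τ - s2 * rogersTheta 4 τ + s1 * rogersTheta 7 τ) := by
  rw [rogersTheta_neg_one_div 4 hτ, ← sqrt_thirty_inv_mul]
  norm_num only [sinCoeff_four, sinCoeff_eight, sinCoeff_sixteen, sinCoeff_twentyeight]
  ring

lemma rogersTheta_seven_neg_one_div : rogersTheta 7 (-1 / τ) = (√2 : ℝ) * ((√5 : ℝ) : ℂ)⁻¹ * sqrtI τ *
    (s1 * rogersTheta 1 τ - s2 * rogersTheta 2 τ + s1 * rogersTheta 4 τ - s2 * rogersTheta 7 τ) := by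
  rw [rogersTheta_neg_one_div 7 hτ, ← sqrt_thirty_inv_mul]
  norm_num only [sinCoeff_seven, sinCoeff_fourteen, sinCoeff_twentyeight, sinCoeff_fortynine]
  ring

lemma lth_one_zero_neg_one_div : lth 1 0 (-1 / τ) =
    ((√2 : ℝ) : ℂ)⁻¹ * sqrtI τ * (lth 1 0 τ + lth 1 (1 / 2) τ) := by
  have := lth_inversion (N := 2) (by norm_num) 0 hτ
  simpa [sum_range_succ, ee_zero] using this

lemma lth_one_half_neg_one_div : lth 1 (1 / 2) (-1 / τ) =
    ((√2 : ℝ) : ℂ)⁻¹ * sqrtI τ * (lth 1 0 τ - lth 1 (1 / 2) τ) := by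
  have := lth_inversion (N := 2) (by norm_num) 1 hτ
  have h : ee 2⁻¹ = -1 := by
    rw [ee, ← Complex.exp_pi_mul_I]; congr 1; ring
  simpa [sum_range_succ, ee_zero, h, sub_eq_add_neg] using this

lemma eta_two_mul_neg_one_div : ModularForm.eta (2 * (-1 / τ)) =
    ((√2 : ℝ) : ℂ)⁻¹ * sqrtI τ * ModularForm.eta (τ / 2) := by
  have h : 0 < (τ / 2).im := by simpa using hτ
  have h0 := ne_zero_of_im_pos hτ
  have e : τ / 2 = ((2⁻¹ : ℝ) : ℂ) * τ := by push_cast; ring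
  have := eta_neg_one_div h
  rw [show -1 / (τ / 2) = 2 * (-1 / τ) by field_simp] at this
  rw [this]
  congr 1
  rw [e, sqrtI_ofReal_mul (by norm_num) h0, Real.sqrt_inv]
  push_cast
  rfl

lemma eta_half_neg_one_div : ModularForm.eta (-1 / τ / 2) =
    (√2 : ℝ) * sqrtI τ * ModularForm.eta (2 * τ) := by
  have h : 0 < (2 * τ).im := by simpa using hτ
  have h0 := ne_zero_of_im_pos hτ
  have e : 2 * τ = ((2 : ℝ) : ℂ) * τ := by push_cast; ring
  have := eta_neg_one_div h
  rw [show -1 / (2 * τ) = -1 / τ / 2 by field_simp] at this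
  rw [this]
  congr 1
  rw [e, sqrtI_ofReal_mul (by norm_num) h0]

end inversion

end MockTheta
namespace MockTheta
open Filter Topology Finset

/-! ### Infinite products -/

section products
variable {q : ℂ} (hq : ‖q‖ < 1)
include hq

lemma qPoch_mul_qPoch_neg (a : ℂ) : qPoch a q * qPoch (-a) q = qPoch (a ^ 2) (q ^ 2) := by
  rw [qPoch, qPoch, qPoch, ← (multipliable_poch hq a).tprod_mul (multipliable_poch hq (-a))]
  refine tprod_congr fun n => ?_
  ring

lemma qPoch_sq_mul_qPoch_sq (a : ℂ) : qPoch a (q ^ 2) * qPoch (a * q) (q ^ 2) = qPoch a q := by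
  have hq2 := norm_sq_lt_one hq
  have h1 : Multipliable fun n : ℕ => 1 - a * q ^ (2 * n) := by
    simpa only [pow_mul] using multipliable_poch hq2 a
  have h2 : Multipliable fun n : ℕ => 1 - a * q ^ (2 * n + 1) := by
    refine (multipliable_poch hq2 (a * q)).congr fun n => ?_
    ring
  have h := tprod_even_mul_odd (f := fun n : ℕ => 1 - a * q ^ n) h1 h2
  rw [qPoch, qPoch, qPoch, ← h]
  congr 1
  · exact tprod_congr fun n => by ring
  · exact tprod_congr fun n => by ring

/-- `(p; p²)_∞ (-p; p²)_∞ (-p²; p²)_∞ = 1` -/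
lemma qPoch_mul_mul_eq_one :
    qPoch q (q ^ 2) * qPoch (-q) (q ^ 2) * qPoch (-q ^ 2) (q ^ 2) = 1 := by
  have hq2 := norm_sq_lt_one hq
  have h1 := qPoch_mul_qPoch_neg hq2 q
  have h2 := qPoch_mul_qPoch_neg hq2 (q ^ 2)
  have h3 := qPoch_sq_mul_qPoch_sq hq2 (q ^ 2)
  rw [← pow_two] at h3
  have h4 : qPoch (q ^ 2) (q ^ 2) ≠ 0 := qPoch_ne_zero' hq2 hq2
  refine mul_right_cancel₀ h4 ?_
  rw [h1]
  linear_combination h3 + qPoch (q ^ 2) ((q ^ 2) ^ 2) * h2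

end products

/-! ### The components of `F₅` as quotients of theta functions -/

lemma lth_one_zero (τ : ℂ) : lth 1 0 τ = thetaEven (ee τ) := by
  rw [lth, thetaEven]
  refine tsum_congr fun n => ?_
  rw [ee_zpow]
  push_cast
  ring_nf

lemma lth_one_half (τ : ℂ) : lth 1 (1 / 2) τ = ee (τ / 4) * thetaOdd (ee τ) := by
  rw [lth, thetaOdd, ← tsum_mul_left]
  refine tsum_congr fun n => ?_
  rw [ee_zpow, ← ee_add]
  push_cast
  ring_nf

/-- Completing the square, 15 s² + r s + r²/60 = (30 s + r)²/60. The hypothesis on d says that one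
and the same prefactor completes both squares. -/
lemma ee_zpow_sub (τ : ℂ) (r₁ r₂ d : ℤ) (h : r₂ ^ 2 = r₁ ^ 2 + 60 * d) (s : ℤ) :
    ee (r₁ ^ 2 / 60 * τ) * (ee τ ^ (15 * s ^ 2 + r₁ * s) - ee τ ^ (15 * s ^ 2 + r₂ * s + d)) =
      ee ((15 : ℝ) * (s + (r₁ / 30 : ℝ)) ^ 2 * τ) - ee ((15 : ℝ) * (s + (r₂ / 30 : ℝ)) ^ 2 * τ) := by
  have h' : (r₂ : ℂ) ^ 2 = r₁ ^ 2 + 60 * d := by exact_mod_cast h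
  rw [mul_sub, ee_zpow, ee_zpow, ← ee_add, ← ee_add]
  congr 2
  · push_cast; ring
  · push_cast
    linear_combination (-τ / 60) * h'

lemma tsum_rogers {τ : ℂ} (hτ : 0 < τ.im) (r₁ r₂ d : ℤ) (h : r₂ ^ 2 = r₁ ^ 2 + 60 * d) :
    ee (r₁ ^ 2 / 60 * τ) * ∑' s : ℤ, (ee τ ^ (15 * s ^ 2 + r₁ * s) - ee τ ^ (15 * s ^ 2 + r₂ * s + d))
      = lth 15 (r₁ / 30) τ - lth 15 (r₂ / 30) τ := by
  rw [← tsum_mul_left, tsum_congr (ee_zpow_sub τ r₁ r₂ d h), Summable.tsum_sub, lth, lth]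
  · exact summable_lth (by norm_num) _ hτ
  · exact summable_lth (by norm_num) _ hτ

section rows
variable {τ : ℂ} (hτ : 0 < τ.im)
include hτ

lemma rogersTheta_one : rogersTheta 1 τ =
    ee (τ / 60) * (qPoch (ee τ) (ee τ) * rogersSum 0 0 (ee τ)) := by
  rw [rogersSum_zero_zero (ee_ne_zero τ) (norm_ee_lt_one hτ)]
  have := tsum_rogers hτ (-1) 11 2 (by norm_num)
  have h1 : lth 15 (1 / 30) τ = lth 15 (-1 / 30) τ := by rw [neg_div, lth_neg]
  norm_num [rogersTheta, h1] at this ⊢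
  rw [← this]
  ring_nf

lemma rogersTheta_two : rogersTheta 2 τ =
    ee (τ / 15) * (qPoch (ee τ) (ee τ) * rogersSum 0 1 (ee τ)) := by
  rw [rogersSum_zero_one (ee_ne_zero τ) (norm_ee_lt_one hτ)]
  have := tsum_rogers hτ 2 8 1 (by norm_num)
  have h1 : lth 15 (22 / 30) τ = lth 15 (8 / 30) τ := by
    rw [← lth_neg, ← lth_add_int _ _ _ 1]; norm_num
  norm_num [rogersTheta] at this h1 ⊢
  rw [h1, ← this]
  ring_nf

lemma rogersTheta_four : rogersTheta 4 τ =
    ee (4 * τ / 15) * (qPoch (ee τ) (ee τ) * rogersSum 1 1 (ee τ)) := by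
  rw [rogersSum_one_one (ee_ne_zero τ) (norm_ee_lt_one hτ)]
  have := tsum_rogers hτ 4 14 3 (by norm_num)
  have h1 : lth 15 (44 / 30) τ = lth 15 (14 / 30) τ := by
    rw [← lth_add_int _ (14 / 30) _ 1]; norm_num
  norm_num [rogersTheta] at this h1 ⊢
  rw [h1, ← this]
  ring_nf

lemma rogersTheta_seven : rogersTheta 7 τ =
    ee (49 * τ / 60) * (qPoch (ee τ) (ee τ) * rogersSum 1 2 (ee τ)) := by
  rw [rogersSum_one_two (ee_ne_zero τ) (norm_ee_lt_one hτ)]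
  have := tsum_rogers hτ 7 13 2 (by norm_num)
  have h1 : lth 15 (77 / 30) τ = lth 15 (13 / 30) τ := by
    rw [← lth_neg, ← lth_add_int _ _ _ 3]; norm_num
  norm_num [rogersTheta] at this h1 ⊢
  rw [h1, ← this]
  ring_nf

lemma eta_two_mul : ModularForm.eta (2 * τ) =
    ee (τ / 12) * (qPoch (ee τ) (ee τ) * qPoch (-ee τ) (ee τ)) := by
  rw [eta_eq_ee_mul_qPoch, qPoch_mul_qPoch_neg (norm_ee_lt_one hτ), ee_pow]
  push_cast
  ring_nf

lemma norm_ee_half_lt_one : ‖ee (τ / 2)‖ < 1 := norm_ee_lt_one (by simpa using hτ)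

omit hτ in
lemma ee_half_sq : ee (τ / 2) ^ 2 = ee τ := by
  rw [ee_pow]; push_cast; ring_nf

lemma eta_half : ModularForm.eta (τ / 2) =
    ee (τ / 48) * (qPoch (ee τ) (ee τ) * qPoch (ee (τ / 2)) (ee τ)) := by
  rw [eta_eq_ee_mul_qPoch, ← qPoch_sq_mul_qPoch_sq (norm_ee_half_lt_one hτ), ← pow_two, ee_half_sq,
    mul_comm (qPoch (ee τ) (ee τ))]
  ring_nf

/-- The eta quotient `η(τ)³ / (η(τ/2) η(2 τ))`. -/
def etaMid (τ : ℂ) : ℂ :=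
  ModularForm.eta τ ^ 3 / (ModularForm.eta (τ / 2) * ModularForm.eta (2 * τ))

lemma eta_half_ne_zero : ModularForm.eta (τ / 2) ≠ 0 :=
  ModularForm.eta_ne_zero (by simpa [UpperHalfPlane.upperHalfPlaneSet] using hτ)

lemma eta_two_ne_zero : ModularForm.eta (2 * τ) ≠ 0 :=
  ModularForm.eta_ne_zero (by simpa [UpperHalfPlane.upperHalfPlaneSet] using hτ)

/-- Euler's identity (p; p²)_∞ (-p; p²)_∞ (-p²; p²)_∞ = 1 at p = q^(1/2). The functions η(2τ),
η(τ/2) and this quotient are the three denominators that occur; inversion exchanges the first two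
and fixes the third, up to the weight factor and constants. -/
lemma etaMid_eq : etaMid τ = ee (τ / 48) * (qPoch (ee τ) (ee τ) * qPoch (-ee (τ / 2)) (ee τ)) := by
  have h := qPoch_mul_mul_eq_one (norm_ee_half_lt_one hτ)
  rw [ee_half_sq] at h
  rw [etaMid, div_eq_iff (mul_ne_zero (eta_half_ne_zero hτ) (eta_two_ne_zero hτ)),
    eta_eq_ee_mul_qPoch, eta_half hτ, eta_two_mul hτ]
  have e : ee (τ / 24) ^ 3 = ee (τ / 48) * ee (τ / 48) * ee (τ / 12) := by
    rw [ee_pow, ← ee_add, ← ee_add]; push_cast; ring_nf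
  rw [mul_pow, e]
  linear_combination (-ee (τ / 48) * ee (τ / 48) * ee (τ / 12) * qPoch (ee τ) (ee τ) ^ 3) * h

end rows

/-- The components of `F₅` in terms of theta functions. -/
def thetaVec (τ : ℂ) : Fin 6 → ℂ :=
  ![(lth 1 0 τ * rogersTheta 2 τ + lth 1 (1 / 2) τ * rogersTheta 7 τ) / ModularForm.eta (2 * τ),
    (lth 1 (1 / 2) τ * rogersTheta 1 τ + lth 1 0 τ * rogersTheta 4 τ) / ModularForm.eta (2 * τ),
    (lth 1 0 τ * rogersTheta 1 τ - lth 1 (1 / 2) τ * rogersTheta 4 τ) / ModularForm.eta (τ / 2),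
    (lth 1 (1 / 2) τ * rogersTheta 2 τ - lth 1 0 τ * rogersTheta 7 τ) / ModularForm.eta (τ / 2),
    (lth 1 0 τ * rogersTheta 1 τ + lth 1 (1 / 2) τ * rogersTheta 4 τ) / etaMid τ,
    (lth 1 (1 / 2) τ * rogersTheta 2 τ + lth 1 0 τ * rogersTheta 7 τ) / etaMid τ]

lemma qPow_eq_ee (r : ℚ) (τ : ℍ) : qPow r τ = ee (r * τ) := by
  rw [qPow, ee]; ring_nf

lemma div_ee_aux {N D E Q X Y : ℂ} (hQ : Q ≠ 0) (hE : E ≠ 0) (h : E * (X * N) * Q = Y) :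
    X * (N / D) = Y / (E * (Q * D)) := by
  rw [← h]
  rcases eq_or_ne D 0 with rfl | hD
  · simp
  · field_simp

/-- The bilateral identities, with both sides multiplied by (q)_∞, match Rogers' theta series and
the eta products; what remains is bookkeeping of the fractional powers of q in each row. -/
theorem F5_eq_thetaVec (τ : ℍ) : F5 τ = thetaVec τ := by
  have hτ : 0 < (τ : ℂ).im := τ.2
  have hq := norm_ee_lt_one hτ
  have hq0 := ee_ne_zero (τ : ℂ)
  have hp := norm_ee_half_lt_one hτ
  have hp0 := ee_ne_zero ((τ : ℂ) / 2)
  have hQ : qPoch (ee τ) (ee τ) ≠ 0 := qPoch_ne_zero' hq hq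
  have e1 : qPow 1 τ = ee τ := by rw [qPow_eq_ee]; norm_num
  have e2 : qPow (1 / 2) τ = ee (τ / 2) := by rw [qPow_eq_ee]; push_cast; ring_nf
  have r0 := f0_add_two_mul_psi0 hq0 hq
  have r1 := f1_add_two_mul_psi1 hq0 hq
  have r2 := neg_one_add_F0_add_phi0 hp0 hp
  have r3 := F1_sub_phi1 hp0 hp
  have hp' : ‖-ee ((τ : ℂ) / 2)‖ < 1 := by simpa using hp
  -- The last two rows are rows three and four with q^(1/2) replaced by its negative.
  have r4 := neg_one_add_F0_add_phi0 (neg_ne_zero.2 hp0) hp'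
  have r5 := F1_sub_phi1 (neg_ne_zero.2 hp0) hp'
  rw [ee_half_sq] at r2 r3
  rw [neg_sq, ee_half_sq, neg_neg] at r4 r5
  have e3 : ee ((τ : ℂ) / 2) * qPow (-49 / 240) τ = qPow (71 / 240) τ := by
    rw [qPow_eq_ee, qPow_eq_ee, ← ee_add]; push_cast; ring_nf
  have t0 := lth_one_zero τ
  have t1 := lth_one_half τ
  have u1 := rogersTheta_one hτ
  have u2 := rogersTheta_two hτ
  have u4 := rogersTheta_four hτ
  have u7 := rogersTheta_seven hτ
  have w1 := eta_two_mul hτ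
  have w2 := eta_half hτ
  have w3 := etaMid_eq hτ
  ext i
  fin_cases i
  · have : F5 τ 0 = qPow (-1 / 60) τ * (f0 (ee τ) + 2 * psi0 (ee τ)) := by
      simp only [F5, F51, F52, Pi.add_apply, Matrix.cons_val, e1]; ring
    simp only [thetaVec, Matrix.cons_val, r0, w1, Fin.isValue, Fin.zero_eta, this]
    refine div_ee_aux hQ (ee_ne_zero _) ?_
    have h1 : ee ((τ : ℂ) / 12) * ee (-1 / 60 * τ) = ee ((τ : ℂ) / 15) := by simp only [← ee_add]; ring_nf
    have h2 : ee ((τ : ℂ) / 12) * ee (-1 / 60 * τ) * ee τ = ee ((τ : ℂ) / 4) * ee (49 * τ / 60) := by simp only [← ee_add]; ring_nf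
    rw [t0, t1, u2, u7, qPow_eq_ee]
    push_cast
    linear_combination qPoch (ee τ) (ee τ) * (thetaEven (ee τ) * rogersSum 0 1 (ee τ) * h1 + thetaOdd (ee τ) * rogersSum 1 2 (ee τ) * h2)
  · have : F5 τ 1 = qPow (11 / 60) τ * (f1 (ee τ) + 2 * psi1 (ee τ)) := by
      simp only [F5, F51, F52, Pi.add_apply, Matrix.cons_val, e1]; ring
    simp only [thetaVec, Matrix.cons_val, r1, w1, Fin.isValue, Fin.mk_one, this]
    refine div_ee_aux hQ (ee_ne_zero _) ?_
    have h1 : ee ((τ : ℂ) / 12) * ee (11 / 60 * τ) = ee ((τ : ℂ) / 4) * ee (τ / 60) := by simp only [← ee_add]; ring_nf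
    have h2 : ee ((τ : ℂ) / 12) * ee (11 / 60 * τ) = ee (4 * (τ : ℂ) / 15) := by simp only [← ee_add]; ring_nf
    rw [t0, t1, u1, u4, qPow_eq_ee]
    push_cast
    linear_combination qPoch (ee τ) (ee τ) * (thetaOdd (ee τ) * rogersSum 0 0 (ee τ) * h1 + thetaEven (ee τ) * rogersSum 1 1 (ee τ) * h2)
  · have : F5 τ 2 = qPow (-1 / 240) τ * (-1 + F0 (ee ((τ : ℂ) / 2)) + phi0 (-ee ((τ : ℂ) / 2))) := by
      simp only [F5, F51, F52, Pi.add_apply, Matrix.cons_val, e2]; ring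
    simp only [thetaVec, Matrix.cons_val, r2, w2, Fin.reduceFinMk, this]
    refine div_ee_aux hQ (ee_ne_zero _) ?_
    have h1 : ee ((τ : ℂ) / 48) * ee (-1 / 240 * τ) = ee ((τ : ℂ) / 60) := by simp only [← ee_add]; ring_nf
    have h2 : ee ((τ : ℂ) / 48) * ee (-1 / 240 * τ) * ee ((τ : ℂ) / 2) = ee ((τ : ℂ) / 4) * ee (4 * τ / 15) := by simp only [← ee_add]; ring_nf
    rw [t0, t1, u1, u4, qPow_eq_ee]
    push_cast
    linear_combination qPoch (ee τ) (ee τ) * (thetaEven (ee τ) * rogersSum 0 0 (ee τ) * h1 + -thetaOdd (ee τ) * rogersSum 1 1 (ee τ) * h2)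
  · have : F5 τ 3 = qPow (71 / 240) τ * (F1 (ee ((τ : ℂ) / 2)) - (ee ((τ : ℂ) / 2))⁻¹ * phi1 (-ee ((τ : ℂ) / 2))) := by
      simp only [F5, F51, F52, Pi.add_apply, Matrix.cons_val, e2]; rw [← e3]; field_simp; ring
    simp only [thetaVec, Matrix.cons_val, r3, w2, Fin.reduceFinMk, this]
    refine div_ee_aux hQ (ee_ne_zero _) ?_
    have h1 : ee ((τ : ℂ) / 48) * ee (71 / 240 * τ) = ee ((τ : ℂ) / 4) * ee (τ / 15) := by simp only [← ee_add]; ring_nf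
    have h2 : ee ((τ : ℂ) / 48) * ee (71 / 240 * τ) * ee ((τ : ℂ) / 2) = ee (49 * (τ : ℂ) / 60) := by simp only [← ee_add]; ring_nf
    rw [t0, t1, u2, u7, qPow_eq_ee]
    push_cast
    linear_combination qPoch (ee τ) (ee τ) * (thetaOdd (ee τ) * rogersSum 0 1 (ee τ) * h1 + -thetaEven (ee τ) * rogersSum 1 2 (ee τ) * h2)
  · have : F5 τ 4 = qPow (-1 / 240) τ * (-1 + F0 (-ee ((τ : ℂ) / 2)) + phi0 (ee ((τ : ℂ) / 2))) := by
      simp only [F5, F51, F52, Pi.add_apply, Matrix.cons_val, e2]; ring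
    simp only [thetaVec, Matrix.cons_val, r4, w3, Fin.reduceFinMk, this]
    refine div_ee_aux hQ (ee_ne_zero _) ?_
    have h1 : ee ((τ : ℂ) / 48) * ee (-1 / 240 * τ) = ee ((τ : ℂ) / 60) := by simp only [← ee_add]; ring_nf
    have h2 : ee ((τ : ℂ) / 48) * ee (-1 / 240 * τ) * ee ((τ : ℂ) / 2) = ee ((τ : ℂ) / 4) * ee (4 * τ / 15) := by simp only [← ee_add]; ring_nf
    rw [t0, t1, u1, u4, qPow_eq_ee]
    push_cast
    linear_combination qPoch (ee τ) (ee τ) * (thetaEven (ee τ) * rogersSum 0 0 (ee τ) * h1 + thetaOdd (ee τ) * rogersSum 1 1 (ee τ) * h2)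
  · have : F5 τ 5 = qPow (71 / 240) τ * (F1 (-ee ((τ : ℂ) / 2)) - (-ee ((τ : ℂ) / 2))⁻¹ * phi1 (ee ((τ : ℂ) / 2))) := by
      simp only [F5, F51, F52, Pi.add_apply, Matrix.cons_val, e2]; rw [← e3]; field_simp; ring
    simp only [thetaVec, Matrix.cons_val, r5, w3, Fin.reduceFinMk, this]
    refine div_ee_aux hQ (ee_ne_zero _) ?_
    have h1 : ee ((τ : ℂ) / 48) * ee (71 / 240 * τ) = ee ((τ : ℂ) / 4) * ee (τ / 15) := by simp only [← ee_add]; ring_nf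
    have h2 : ee ((τ : ℂ) / 48) * ee (71 / 240 * τ) * ee ((τ : ℂ) / 2) = ee (49 * (τ : ℂ) / 60) := by simp only [← ee_add]; ring_nf
    rw [t0, t1, u2, u7, qPow_eq_ee]
    push_cast
    linear_combination qPoch (ee τ) (ee τ) * (thetaOdd (ee τ) * rogersSum 0 1 (ee τ) * h1 + thetaEven (ee τ) * rogersSum 1 2 (ee τ) * h2)

end MockTheta
namespace MockTheta
open Filter Topology Finset

/-! ### The action of the generators -/

lemma qPow_vadd_one (r : ℚ) (τ : ℍ) : qPow r ((1 : ℝ) +ᵥ τ) = ee r * qPow r τ := by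
  rw [qPow_eq_ee, qPow_eq_ee, ← ee_add, UpperHalfPlane.coe_vadd]
  push_cast
  ring_nf

lemma zeta_zpow (n : ℕ) (k : ℤ) : zeta n ^ k = ee (k / n) := by
  rw [zeta, ee, ← Complex.exp_int_mul]; ring_nf

lemma ee_half_eq : ee (1 / 2) = -1 := by
  rw [ee, ← Complex.exp_pi_mul_I]; congr 1; ring

lemma ee_one : ee 1 = 1 := by exact_mod_cast ee_int 1

theorem F5_vadd_one (τ : ℍ) : F5 ((1 : ℝ) +ᵥ τ) = T5 *ᵥ F5 τ := by
  have e1 : ee ((1 / 2 : ℚ) : ℂ) = -1 := by rw [← ee_half_eq]; push_cast; rfl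
  have e2 : ee ((1 : ℚ) : ℂ) = 1 := by rw [← ee_one]; push_cast; rfl
  have e3 : ee ((-1 / 60 : ℚ) : ℂ) = ee ((-1 : ℤ) / (60 : ℕ)) := by push_cast; rfl
  have e4 : ee ((11 / 60 : ℚ) : ℂ) = ee ((11 : ℤ) / (60 : ℕ)) := by push_cast; rfl
  have e5 : ee ((-1 / 240 : ℚ) : ℂ) = ee ((-1 : ℤ) / (240 : ℕ)) := by push_cast; rfl
  have e6 : ee ((71 / 240 : ℚ) : ℂ) = ee ((71 : ℤ) / (240 : ℕ)) := by push_cast; rfl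
  -- The exponents -49/240 and 71/240 differ by 1/2; the sign produced accounts for the opposite
  -- signs of φ₁ in rows four and six.
  have e7 : ee ((-49 / 240 : ℚ) : ℂ) = -ee ((71 : ℤ) / (240 : ℕ)) := by
    rw [← neg_one_mul (ee ((71 : ℤ) / (240 : ℕ))), ← ee_half_eq, ← ee_add]
    refine ee_eq_of_sub_eq_int (-1) ?_
    push_cast
    norm_num
  ext i
  simp only [T5, zeta_zpow, F5, F51, F52, qPow_vadd_one, e1, e2, e3, e4, e5, e6, e7, Matrix.mulVec,
    dotProduct, Fin.sum_univ_six]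
  fin_cases i <;> simp <;> ring

section inversion
variable {τ : ℂ} (hτ : 0 < τ.im)
include hτ

lemma etaMid_neg_one_div : etaMid (-1 / τ) = sqrtI τ * etaMid τ := by
  have h0 := sqrtI_ne_zero (ne_zero_of_im_pos hτ)
  have h2 : ((√2 : ℝ) : ℂ) ≠ 0 := by
    rw [Complex.ofReal_ne_zero]; positivity
  have h3 := eta_half_ne_zero hτ
  have h4 := eta_two_ne_zero hτ
  rw [etaMid, etaMid, eta_half_neg_one_div hτ, eta_two_mul_neg_one_div hτ, eta_neg_one_div hτ]
  field_simp

lemma etaMid_ne_zero : etaMid τ ≠ 0 :=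
  div_ne_zero (pow_ne_zero _ (ModularForm.eta_ne_zero hτ))
    (mul_ne_zero (eta_half_ne_zero hτ) (eta_two_ne_zero hτ))

theorem thetaVec_neg_one_div :
    thetaVec (-1 / τ) = (sqrtI τ * (2 / (√5 : ℝ) : ℂ)) • (M5 *ᵥ thetaVec τ) := by
  have h0 := sqrtI_ne_zero (ne_zero_of_im_pos hτ)
  have h2 : ((√2 : ℝ) : ℂ) ≠ 0 := by
    rw [Complex.ofReal_ne_zero]; positivity
  have h5 : ((√5 : ℝ) : ℂ) ≠ 0 := by
    rw [Complex.ofReal_ne_zero]; positivity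
  have h3 := eta_half_ne_zero hτ
  have h4 := eta_two_ne_zero hτ
  have h6 := etaMid_ne_zero hτ
  ext i
  simp only [thetaVec, rogersTheta_one_neg_one_div hτ, rogersTheta_two_neg_one_div hτ,
    rogersTheta_four_neg_one_div hτ, rogersTheta_seven_neg_one_div hτ, lth_one_zero_neg_one_div hτ,
    lth_one_half_neg_one_div hτ, eta_two_mul_neg_one_div hτ, eta_half_neg_one_div hτ,
    etaMid_neg_one_div hτ, M5, r2, Matrix.mulVec, dotProduct, Fin.sum_univ_six, Pi.smul_apply,
    smul_eq_mul]
  fin_cases i <;> simp <;> field_simp <;> ring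

end inversion

lemma coe_S_smul (τ : ℍ) : ((ModularGroup.S • τ : ℍ) : ℂ) = -1 / τ := by
  rw [UpperHalfPlane.modular_S_smul]
  simp [neg_div, inv_neg]

theorem F5_S_smul (τ : ℍ) : F5 (ModularGroup.S • τ) =
    ((-Complex.I * (τ : ℂ)) ^ (1 / 2 : ℂ) * (2 / (Real.sqrt 5 : ℝ) : ℂ)) • (M5 *ᵥ F5 τ) := by
  rw [F5_eq_thetaVec, F5_eq_thetaVec, coe_S_smul, thetaVec_neg_one_div τ.2, sqrtI]

/-! ### Holomorphy -/

lemma differentiableAt_eta_comp {τ : ℂ} (hτ : 0 < τ.im) :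
    DifferentiableAt ℂ ModularForm.eta τ :=
  ModularForm.differentiableAt_eta_of_mem_upperHalfPlaneSet hτ

lemma differentiableAt_thetaVec {τ : ℂ} (hτ : 0 < τ.im) (i : Fin 6) :
    DifferentiableAt ℂ (fun z => thetaVec z i) τ := by
  have hl (c x : ℝ) (hc : 0 < c) := differentiableAt_lth hc x hτ
  have hr (r : ℤ) : DifferentiableAt ℂ (rogersTheta r) τ :=
    (hl 15 _ (by norm_num)).sub (hl 15 _ (by norm_num))
  have ha := hl 1 0 one_pos
  have hb := hl 1 (1 / 2) one_pos
  have h1 := differentiableAt_eta_comp hτ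
  have h2 : DifferentiableAt ℂ (fun z => ModularForm.eta (2 * z)) τ := by
    refine (differentiableAt_eta_comp (τ := 2 * τ) (by simpa using hτ)).comp τ ?_
    fun_prop
  have h3 : DifferentiableAt ℂ (fun z => ModularForm.eta (z / 2)) τ := by
    refine DifferentiableAt.comp (f := fun z : ℂ => z / 2) τ
      (differentiableAt_eta_comp (by simpa using hτ)) ?_
    fun_prop
  have n2 := eta_two_ne_zero hτ
  have n3 := eta_half_ne_zero hτ
  have h4 : DifferentiableAt ℂ etaMid τ := (h1.pow 3).div (h3.mul h2) (mul_ne_zero n3 n2)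
  have n4 := etaMid_ne_zero hτ
  fin_cases i
  · exact ((ha.mul (hr 2)).add (hb.mul (hr 7))).div h2 n2
  · exact ((hb.mul (hr 1)).add (ha.mul (hr 4))).div h2 n2
  · exact ((ha.mul (hr 1)).sub (hb.mul (hr 4))).div h3 n3
  · exact ((hb.mul (hr 2)).sub (ha.mul (hr 7))).div h3 n3
  · exact ((ha.mul (hr 1)).add (hb.mul (hr 4))).div h4 n4
  · exact ((hb.mul (hr 2)).add (ha.mul (hr 7))).div h4 n4

theorem mdifferentiable_F5 (i : Fin 6) : MDifferentiable 𝓘(ℂ) 𝓘(ℂ) (fun τ => F5 τ i) := by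
  rw [UpperHalfPlane.mdifferentiable_iff]
  intro z hz
  have := (differentiableAt_thetaVec hz i).differentiableWithinAt (s := {z | 0 < z.im})
  refine this.congr (fun w hw => ?_) ?_
  · simp only [Function.comp_apply, F5_eq_thetaVec]
    rw [UpperHalfPlane.ofComplex_apply_of_im_pos hw]
  · simp only [Function.comp_apply, F5_eq_thetaVec]
    rw [UpperHalfPlane.ofComplex_apply_of_im_pos hz]

end MockTheta
namespace MockTheta
open Filter Topology Finset

/-! ### Theta series under principal congruence subgroups -/

lemma sum_range_eq_sum_zmod {p : ℕ} [NeZero p] (F : ZMod p → ℂ) :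
    ∑ j ∈ range p, F (j : ℕ) = ∑ a, F a := by
  refine sum_nbij' (fun j => ((j : ℕ) : ZMod p)) ZMod.val ?_ ?_ ?_ ?_ ?_
  · simp
  · intro a _; simpa using ZMod.val_lt a
  · intro j hj; exact ZMod.val_cast_of_lt (mem_range.1 hj)
  · simp
  · simp

lemma stdAddChar_int {p : ℕ} [NeZero p] (j : ℤ) : (ZMod.stdAddChar (j : ZMod p) : ℂ) = ee (j / p) := by
  rw [ZMod.stdAddChar_coe, ee]
  ring_nf

/-- The quadratic Gauss sum `∑_a e(b a² / p)`. -/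
def gaussQuad (p : ℕ) [NeZero p] (b : ZMod p) : ℂ := ∑ a : ZMod p, ZMod.stdAddChar (b * a ^ 2)

lemma gaussQuad_mul_sq {p : ℕ} [Fact p.Prime] (b t : ZMod p) (ht : t ≠ 0) :
    gaussQuad p (t * t * b) = gaussQuad p b := by
  rw [gaussQuad, gaussQuad,
    ← Equiv.sum_comp (Equiv.mulLeft₀ t ht) fun a : ZMod p => (ZMod.stdAddChar (b * a ^ 2) : ℂ)]
  refine sum_congr rfl fun a _ => ?_
  simp only [Equiv.mulLeft₀_apply]
  ring_nf

/-- Substituting a + s n for a completes the square, since 2 b s = 1. The value does not depend on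
n, which lets the Gauss sum come out of the dual theta series. -/
lemma gaussQuad_complete {p : ℕ} [NeZero p] (b n s : ZMod p) (h : 2 * b * s = 1) :
    ∑ a : ZMod p, (ZMod.stdAddChar (b * a ^ 2 + n * a + b * s ^ 2 * n ^ 2) : ℂ) = gaussQuad p b := by
  rw [gaussQuad,
    ← Equiv.sum_comp (Equiv.addRight (s * n)) fun a : ZMod p => (ZMod.stdAddChar (b * a ^ 2) : ℂ)]
  refine sum_congr rfl fun a _ => ?_
  congr 1
  simp only [Equiv.coe_addRight]
  linear_combination (-n * a) * h

section congruence
variable {p : ℕ} [Fact p.Prime] {A b' C' : ℤ} {τ : ℂ}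

/-- The imaginary part of the translate by a rational number of a point of an orbit. -/
def orbitShift (p : ℕ) (C : ℤ) (τ : ℂ) : ℂ := τ / (p * (C * τ + p))

lemma lth_split {c : ℕ} (hc : 0 < c) {p' : ℤ} (hp : (p : ℤ) = 3600 * p' + 1) (h : ℤ)
    {z : ℂ} (hz : 0 < z.im) :
    lth c (h / 60) (z + (3600 * b' : ℤ) / p) =
      ∑ j ∈ range p, ee ((c * (3600 * b') * j ^ 2 : ℤ) / p) *
        lth (c * p ^ 2) (j / p + h / 60) z := by
  have hp0 : p ≠ 0 := (Fact.out : p.Prime).ne_zero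
  have hpc : (p : ℂ) ≠ 0 := by exact_mod_cast hp0
  have hpr : (p : ℝ) ≠ 0 := by exact_mod_cast hp0
  have hw : 0 < (z + (3600 * b' : ℤ) / p).im := by
    have : (((3600 * b' : ℤ) / p : ℂ)).im = 0 := by
      rw [show ((3600 * b' : ℤ) / p : ℂ) = (((3600 * b' : ℤ) / p : ℝ) : ℂ) by push_cast; rfl]
      exact Complex.ofReal_im _
    rwa [Complex.add_im, this, add_zero]
  have hpR : (p : ℝ) = 3600 * p' + 1 := by exact_mod_cast hp
  have hpC : (p : ℂ) = 3600 * p' + 1 := by exact_mod_cast hp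
  -- As p is 1 modulo 3600, h/60 and p h/60 differ by an integer. With n = j + p l the lattice point
  -- is then p (l + j/p + h/60).
  have e0 : lth c (h / 60) (z + (3600 * b' : ℤ) / p)
      = lth c (p * (h / 60)) (z + (3600 * b' : ℤ) / p) := by
    rw [← lth_add_int _ _ _ (60 * p' * h)]
    congr 1
    rw [hpR]; push_cast; ring
  have hc' : (0 : ℝ) < c := by exact_mod_cast hc
  rw [e0, lth, tsum_int_eq_sum_range hp0 (summable_lth hc' _ hw)]
  refine sum_congr rfl fun j _ => ?_
  rw [lth, ← tsum_mul_left]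
  refine tsum_congr fun l => ?_
  rw [← ee_add]
  refine ee_eq_of_sub_eq_int (c * (3600 * b') * (2 * j * l + p * l ^ 2) + 120 * b' * c * h * (j + p * l)
    + c * p * b' * h ^ 2) ?_
  push_cast
  field_simp
  ring

/-- Write γτ = z + 3600b'/p with z = `orbitShift`, split the lattice modulo p, and invert each
piece. As -1/z is p² (-1/τ) minus an integer multiple of p, the dual series is that of τ itself with
a quadratic phase modulo p. Summing the phases over the classes gives one Gauss sum, and inverting
back restores the original series. The multiplier involves neither c nor h, because c is a square
modulo p. -/
theorem lth_orbit {c m : ℕ} (hc : 0 < c) (hcm : c * m = 900) {p' : ℤ} (hp : (p : ℤ) = 3600 * p' + 1)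
    (hdet : A * p - (3600 * b') * (3600 * C') = 1) (hsq : IsSquare (c : ZMod p)) (h : ℤ)
    (hτ : 0 < τ.im) :
    lth c (h / 60) ((A * τ + (3600 * b' : ℤ)) / ((3600 * C' : ℤ) * τ + p)) =
      (p : ℂ)⁻¹ * gaussQuad p (3600 * b' : ℤ) * (sqrtI (orbitShift p (3600 * C') τ))⁻¹ * sqrtI τ *
        lth c (h / 60) τ := by
  have hp0 : p ≠ 0 := (Fact.out : p.Prime).ne_zero
  have hpc : (p : ℂ) ≠ 0 := by exact_mod_cast hp0
  have hpr : (0 : ℝ) < p := by exact_mod_cast Nat.pos_of_ne_zero hp0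
  have hc' : (0 : ℝ) < c := by exact_mod_cast hc
  have hcc : (c : ℂ) ≠ 0 := by exact_mod_cast hc.ne'
  have hτ0 := ne_zero_of_im_pos hτ
  have hden : ((3600 * C' : ℤ) * τ + p : ℂ) ≠ 0 := by
    intro h0
    have him := congrArg Complex.im h0
    have hC : ((3600 * C' : ℤ) : ℝ) = 0 := by
      simpa [hτ.ne', -Int.cast_mul] using him
    have hC0 : (3600 * C' : ℤ) = 0 := by exact_mod_cast hC
    rw [hC0] at h0
    simp [hp0] at h0
  have hdetC : (A : ℂ) * p - (3600 * b') * (3600 * C') = 1 := by exact_mod_cast hdet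
  set z := orbitShift p (3600 * C') τ with hz
  have hzτ : -1 / z = p ^ 2 * (-1 / τ) - p * (3600 * C') := by
    rw [hz, orbitShift]
    push_cast at hden ⊢
    field_simp
    ring
  have hzim : 0 < z.im := by
    have h1 : 0 < (-1 / z).im := by
      have h2 : ((p : ℂ) * ((3600 : ℂ) * C')).im = 0 := by
        rw [show (p : ℂ) * ((3600 : ℂ) * C') = ((p * (3600 * C') : ℝ) : ℂ) by push_cast; rfl]
        exact Complex.ofReal_im _
      have h3 : ((p : ℂ) ^ 2 * (-1 / τ)).im = p ^ 2 * (-1 / τ).im := by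
        rw [show (p : ℂ) ^ 2 = ((p ^ 2 : ℝ) : ℂ) by push_cast; rfl, Complex.im_ofReal_mul]
      rw [hzτ, Complex.sub_im, h2, h3, sub_zero]
      exact mul_pos (by positivity) (neg_one_div_im_pos hτ)
    have h2 := neg_one_div_im_pos h1
    rwa [show -1 / (-1 / z) = z by rw [div_div_eq_mul_div]; ring] at h2
  have hw : ((A * τ + (3600 * b' : ℤ)) / ((3600 * C' : ℤ) * τ + p) : ℂ) = z + (3600 * b' : ℤ) / p := by
    rw [hz, orbitShift, div_add_div _ _ (mul_ne_zero hpc hden) hpc,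
      div_eq_div_iff hden (mul_ne_zero (mul_ne_zero hpc hden) hpc)]
    push_cast
    linear_combination (τ * p * (3600 * C' * τ + p)) * hdetC
  have hcp : (0 : ℝ) < c * p ^ 2 := by positivity
  have hsqrt : √(2 * (c * p ^ 2)) = √(2 * c) * p := by
    rw [← mul_assoc, Real.sqrt_mul (by positivity), Real.sqrt_sq hpr.le]
  have hterm : ∀ j : ℕ, ∀ n : ℤ, ee (n * (j / p + h / 60 : ℝ)) * ee (n ^ 2 * (-1 / z) / (4 * (c * p ^ 2 : ℝ)))
      = ee ((n * j - m * C' * n ^ 2 : ℤ) / p) * (ee (n * (h / 60 : ℝ)) * ee (n ^ 2 * (-1 / τ) / (4 * (c : ℝ)))) := by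
    intro j n
    have hcmC : (c : ℂ) * m = 900 := by exact_mod_cast hcm
    rw [← ee_add, ← ee_add, ← ee_add, hzτ]
    congr 1
    push_cast
    field_simp
    linear_combination (240 * n ^ 2 * τ * C') * hcmC
  have hsplit := lth_split (p := p) (b' := b') hc hp h hzim
  have hsum : ∀ j ∈ range p, Summable fun n : ℤ => ee ((c * (3600 * b') * j ^ 2 : ℤ) / p) *
      (ee ((n * j - m * C' * n ^ 2 : ℤ) / p) *
        (ee (n * (h / 60 : ℝ)) * ee (n ^ 2 * (-1 / τ) / (4 * (c : ℝ))))) := by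
    intro j _
    refine Summable.mul_left _ ?_
    simp only [← hterm]
    have := summable_inversion hcp (j / p + h / 60) hzim
    push_cast at this ⊢
    exact this
  -- The determinant relation modulo p, with 4 c m = 3600. It says that -2 m C' is the inverse of 2
  -- c · 3600 b', the shift that completes the square, and it makes the phase -m C' n² the matching
  -- constant term.
  have hmod : (-4 : ZMod p) * c * (3600 * b' : ℤ) * m * C' = 1 := by
    have h1 : ((A * p - (3600 * b') * (3600 * C') : ℤ) : ZMod p) = 1 := by rw [hdet, Int.cast_one]
    have h2 : ((c * m : ℕ) : ZMod p) = 900 := by rw [hcm]; norm_num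
    push_cast at h1 h2 ⊢
    rw [CharP.cast_eq_zero (ZMod p) p] at h1
    linear_combination h1 - 4 * 3600 * b' * C' * h2
  have hgauss : ∀ n : ℤ, ∑ j ∈ range p, ee ((c * (3600 * b') * j ^ 2 : ℤ) / p) *
      ee ((n * j - m * C' * n ^ 2 : ℤ) / p) = gaussQuad p (3600 * b' : ℤ) := by
    intro n
    obtain ⟨t, ht⟩ := hsq
    have ht0 : t ≠ 0 := by
      rintro rfl
      rw [ht] at hmod
      simp at hmod
    rw [← gaussQuad_mul_sq _ t ht0, ← ht, ← gaussQuad_complete _ (n : ZMod p)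
      (-2 * (m : ZMod p) * (C' : ZMod p))
      (by linear_combination hmod), ← sum_range_eq_sum_zmod fun a : ZMod p =>
        (ZMod.stdAddChar ((c : ZMod p) * ((3600 * b' : ℤ) : ZMod p) * a ^ 2 + (n : ZMod p) * a +
          (c : ZMod p) * ((3600 * b' : ℤ) : ZMod p) * (-2 * (m : ZMod p) * (C' : ZMod p)) ^ 2 * (n : ZMod p) ^ 2) : ℂ)]
    refine sum_congr rfl fun j _ => ?_
    rw [← ee_add, ← add_div, ← Int.cast_add, ← stdAddChar_int]
    congr 1
    push_cast at hmod ⊢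
    linear_combination (m * C' * n ^ 2) * hmod
  have hsqrt0 : ((√(2 * c) : ℝ) : ℂ) ≠ 0 := by
    exact_mod_cast (Real.sqrt_pos.2 (by positivity)).ne'
  have hS : sqrtI τ ≠ 0 := sqrtI_ne_zero hτ0
  rw [hw, hsplit]
  simp only [lth_eq_inversion hcp _ hzim, hterm, hsqrt]
  rw [lth_eq_inversion hc' _ hτ]
  calc _ = ((√(2 * c) * p : ℝ) : ℂ)⁻¹ * (sqrtI z)⁻¹ * ∑ j ∈ range p, ∑' n : ℤ,
        ee ((c * (3600 * b') * j ^ 2 : ℤ) / p) * (ee ((n * j - m * C' * n ^ 2 : ℤ) / p) *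
        (ee (n * (h / 60 : ℝ)) * ee (n ^ 2 * (-1 / τ) / (4 * (c : ℝ))))) := by
        rw [mul_sum]
        refine sum_congr rfl fun j _ => ?_
        rw [tsum_mul_left]
        ring
    _ = ((√(2 * c) * p : ℝ) : ℂ)⁻¹ * (sqrtI z)⁻¹ * (gaussQuad p (3600 * b' : ℤ) *
        ∑' n : ℤ, ee (n * (h / 60 : ℝ)) * ee (n ^ 2 * (-1 / τ) / (4 * (c : ℝ)))) := by
        rw [← Summable.tsum_finsetSum hsum, ← tsum_mul_left (a := gaussQuad p _)]
        congr 1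
        refine tsum_congr fun n => ?_
        rw [← hgauss n, sum_mul]
        exact sum_congr rfl fun j _ => by ring
    _ = _ := by
        generalize (∑' n : ℤ, ee (n * (h / 60 : ℝ)) * ee (n ^ 2 * (-1 / τ) / (4 * (c : ℝ)))) = X
        rw [Complex.ofReal_mul, Complex.ofReal_natCast]
        field_simp

end congruence

end MockTheta
namespace MockTheta
open Filter Topology Finset

/-! ### The components of `F₅` as modular forms on `Γ(3600)` -/

lemma lth_add_period (c : ℕ) (h k : ℤ) (τ : ℂ) :
    lth c (h / 60) (τ + 3600 * k) = lth c (h / 60) τ := by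
  rw [lth, lth]
  refine tsum_congr fun n => ee_eq_of_sub_eq_int (c * (60 * n + h) ^ 2 * k) ?_
  push_cast
  ring

/-- Since p is 1 modulo 8, 3 and 5, the supplementary law and quadratic reciprocity make 2, 3 and 5
squares modulo p. The levels are 1 for the theta constants, 15 for Rogers' series, and 6, 12, 3 for
η(τ), η(2τ), η(τ/2). -/
lemma isSquare_levels {p : ℕ} [Fact p.Prime] {p' : ℤ} (hp : (p : ℤ) = 3600 * p' + 1) {c : ℕ}
    (hc : c ∈ ({1, 3, 6, 12, 15} : Finset ℕ)) : IsSquare (c : ZMod p) := by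
  have h8 : p % 8 = 1 := by lia
  have h4 : p % 4 = 1 := by lia
  have h2 : IsSquare (2 : ZMod p) := (ZMod.exists_sq_eq_two_iff (by lia)).2 (Or.inl h8)
  have hp1 (n : ℕ) (hn : (n : ℤ) ∣ 3600) : (p : ZMod n) = 1 := by
    obtain ⟨m, hm⟩ := hn
    have : ((p : ℤ) : ZMod n) = ((n * (m * p') + 1 : ℤ) : ZMod n) := by rw [hp, hm, mul_assoc]
    simpa using this
  have h3 : IsSquare ((3 : ℕ) : ZMod p) := by
    rw [ZMod.exists_sq_eq_prime_iff_of_mod_four_eq_one h4 (by norm_num), hp1 3 (by norm_num)]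
    exact IsSquare.one
  have h5 : IsSquare ((5 : ℕ) : ZMod p) := by
    have : Fact (Nat.Prime 5) := ⟨by norm_num⟩
    rw [ZMod.exists_sq_eq_prime_iff_of_mod_four_eq_one h4 (by norm_num), hp1 5 (by norm_num)]
    exact IsSquare.one
  have h22 : IsSquare (2 * 2 : ZMod p) := ⟨2, rfl⟩
  simp only [mem_insert, mem_singleton] at hc
  rcases hc with rfl | rfl | rfl | rfl | rfl
  · simp
  · exact h3
  · simpa [show (2 : ZMod p) * 3 = 6 by norm_num] using h2.mul h3
  · simpa [show (2 : ZMod p) * 2 * 3 = 12 by norm_num] using h22.mul h3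
  · simpa [show (3 : ZMod p) * 5 = 15 by norm_num] using h3.mul h5

/-- The essential point is that a single ν serves all levels c and all shifts h. Its value is never
needed, since it cancels against the multiplier of θ. -/
theorem exists_lth_smul {γ : SL(2, ℤ)} (hγ : γ ∈ CongruenceSubgroup.Gamma 3600) (τ : ℍ) :
    ∃ ν : ℂ, ∀ c ∈ ({1, 3, 6, 12, 15} : Finset ℕ), ∀ h : ℤ,
      lth c (h / 60) ((γ • τ : ℍ) : ℂ) = ν * lth c (h / 60) τ := by
  obtain ⟨hA, hB, hC, hD⟩ := CongruenceSubgroup.Gamma_mem.1 hγ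
  have hdet := γ.det_coe
  rw [Matrix.det_fin_two] at hdet
  rw [UpperHalfPlane.coe_specialLinearGroup_apply]
  set A := γ 0 0
  set B := γ 0 1
  set C := γ 1 0
  set D := γ 1 1
  obtain ⟨a, ha⟩ : (3600 : ℤ) ∣ A - 1 := by
    rw [← Nat.cast_ofNat, ← ZMod.intCast_zmod_eq_zero_iff_dvd]; simp [hA]
  obtain ⟨b, hb⟩ : (3600 : ℤ) ∣ B := by
    rw [← Nat.cast_ofNat, ← ZMod.intCast_zmod_eq_zero_iff_dvd]; simp [hB]
  obtain ⟨c', hc'⟩ : (3600 : ℤ) ∣ C := by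
    rw [← Nat.cast_ofNat, ← ZMod.intCast_zmod_eq_zero_iff_dvd]; simp [hC]
  obtain ⟨d, hd⟩ : (3600 : ℤ) ∣ D - 1 := by
    rw [← Nat.cast_ofNat, ← ZMod.intCast_zmod_eq_zero_iff_dvd]; simp [hD]
  simp only [algebraMap_int_eq, eq_intCast, Complex.ofReal_intCast]
  by_cases hC0 : C = 0
  · have hAD : A * D = 1 := by rw [hC0, mul_zero, sub_zero] at hdet; exact hdet
    have hD1 : A = 1 ∧ D = 1 := by
      rcases Int.mul_eq_one_iff_eq_one_or_neg_one.1 hAD with h | h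
      · exact h
      · lia
    refine ⟨1, fun c _ h => ?_⟩
    rw [hD1.1, hD1.2, hC0, hb, one_mul, ← lth_add_period c h b τ]
    congr 1
    push_cast
    ring
  · have hcop : IsCoprime D ((3600 * C).natAbs : ℤ) := by
      have h1 : IsCoprime D C := ⟨A, -B, by linear_combination hdet⟩
      have h2 : IsCoprime D 3600 := ⟨1, -d, by linear_combination hd⟩
      have h3 := h2.mul_right h1
      rcases Int.natAbs_eq (3600 * C) with h | h
      · rwa [h] at h3
      · rw [h] at h3; exact (IsCoprime.neg_right_iff _ _).1 h3
    -- Dirichlet's theorem: the progression of D modulo 3600 C contains a prime.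
    obtain ⟨p, -, hp, hpD⟩ := Nat.forall_exists_prime_gt_and_zmodEq 0 (by simpa using hC0) hcop
    have : Fact p.Prime := ⟨hp⟩
    obtain ⟨k, hk⟩ : 3600 * C ∣ p - D := by
      have := hpD.symm.dvd
      rwa [Int.natCast_natAbs, abs_dvd] at this
    have hp' : (p : ℤ) = 3600 * (d + C * k) + 1 := by linear_combination hk + hd
    -- The matrix γ T^(3600k) has lower right entry D + 3600 C k = p, and its value at τ - 3600k is
    -- γτ. The theta series do not notice the translation.
    set τ' : ℂ := τ + 3600 * (-k : ℤ) with hτ'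
    have him : 0 < τ'.im := by
      have : ((3600 : ℂ) * (-k : ℤ)).im = 0 := by
        rw [show (3600 : ℂ) * (-k : ℤ) = ((3600 * (-k : ℤ) : ℝ) : ℂ) by push_cast; rfl]
        exact Complex.ofReal_im _
      rw [hτ', Complex.add_im, this, add_zero]
      exact τ.2
    refine ⟨(p : ℂ)⁻¹ * gaussQuad p (3600 * (b + k * A) : ℤ) *
      (sqrtI (orbitShift p (3600 * c') τ'))⁻¹ * sqrtI τ', fun c hc h => ?_⟩
    have hcm : ∃ m, 0 < c ∧ c * m = 900 := by
      simp only [mem_insert, mem_singleton] at hc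
      rcases hc with rfl | rfl | rfl | rfl | rfl
      exacts [⟨900, by norm_num⟩, ⟨300, by norm_num⟩, ⟨150, by norm_num⟩, ⟨75, by norm_num⟩,
        ⟨60, by norm_num⟩]
    obtain ⟨m, hc0, hcm⟩ := hcm
    have key := lth_orbit (p := p) (A := A) (b' := b + k * A) (C' := c') hc0 hcm hp'
      (by rw [hb, hc'] at hdet; rw [hc'] at hk; linear_combination hdet + A * hk)
      (isSquare_levels hp' hc) h him
    rw [← lth_add_period c h (-k) τ, ← hτ', ← key]
    congr 1
    have hkC : (p : ℂ) - D = 3600 * C * k := by exact_mod_cast hk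
    rw [← hc', hτ', show (p : ℂ) = D + 3600 * C * k by linear_combination hkC, hb]
    push_cast
    congr 1 <;> ring

lemma theta_eq_lth (τ : ℍ) : theta τ = lth 1 0 τ := by
  rw [theta, jacobiTheta, lth]
  refine tsum_congr fun n => ?_
  rw [ee]
  push_cast
  ring_nf

lemma eta_two_mul_eq_lth {τ : ℂ} (hτ : 0 < τ.im) :
    ModularForm.eta (2 * τ) = lth 12 (1 / 12) τ - lth 12 (5 / 12) τ := by
  have h2 : ((2 : ℝ) : ℂ) = 2 := by norm_num
  rw [← h2, eta_eq_lth (by rw [Complex.im_ofReal_mul]; positivity), lth_ofReal_mul, lth_ofReal_mul]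
  norm_num

lemma eta_half_eq_lth {τ : ℂ} (hτ : 0 < τ.im) :
    ModularForm.eta (τ / 2) = lth 3 (1 / 12) τ - lth 3 (5 / 12) τ := by
  have h2 : τ / 2 = ((1 / 2 : ℝ) : ℂ) * τ := by push_cast; ring
  rw [h2, eta_eq_lth (by rw [Complex.im_ofReal_mul]; positivity), lth_ofReal_mul, lth_ofReal_mul]
  norm_num

/-- Numerators acquire ν², denominators ν, and θ acquires ν as well; ν is nonzero because η does not
vanish. -/
theorem thetaVec_smul_mul_theta {γ : SL(2, ℤ)} (hγ : γ ∈ CongruenceSubgroup.Gamma 3600) (τ : ℍ)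
    (i : Fin 6) : thetaVec (γ • τ : ℍ) i * theta τ = theta (γ • τ) * thetaVec τ i := by
  obtain ⟨ν, hν⟩ := exists_lth_smul hγ τ
  have hτ : 0 < (τ : ℂ).im := τ.2
  have hγτ : 0 < ((γ • τ : ℍ) : ℂ).im := (γ • τ).2
  have h0 : lth 1 0 (γ • τ : ℍ) = ν * lth 1 0 τ := by simpa using hν 1 (by simp) 0
  have h1 : lth 1 (1 / 2) (γ • τ : ℍ) = ν * lth 1 (1 / 2) τ := by
    have := hν 1 (by simp) 30
    norm_num at this ⊢
    exact this
  have hr (r : ℤ) : rogersTheta r (γ • τ : ℍ) = ν * rogersTheta r τ := by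
    have e1 := hν 15 (by simp) (2 * r)
    have e2 := hν 15 (by simp) (2 * (11 * r))
    have a1 : (((2 * r : ℤ) : ℝ) / 60) = r / 30 := by push_cast; ring
    have a2 : (((2 * (11 * r) : ℤ) : ℝ) / 60) = ((11 * r : ℤ) : ℝ) / 30 := by push_cast; ring
    rw [a1] at e1
    rw [a2] at e2
    rw [rogersTheta, rogersTheta, mul_sub]
    exact congrArg₂ _ (by exact_mod_cast e1) (by exact_mod_cast e2)
  have hl (c : ℕ) (hc : c ∈ ({1, 3, 6, 12, 15} : Finset ℕ)) :
      lth c (1 / 12) (γ • τ : ℍ) - lth c (5 / 12) (γ • τ : ℍ) =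
        ν * (lth c (1 / 12) τ - lth c (5 / 12) τ) := by
    have e1 := hν c hc 5
    have e2 := hν c hc 25
    rw [show ((5 : ℤ) : ℝ) / 60 = 1 / 12 by norm_num] at e1
    rw [show ((25 : ℤ) : ℝ) / 60 = 5 / 12 by norm_num] at e2
    rw [e1, e2, mul_sub]
  have eη : ModularForm.eta (γ • τ : ℍ) = ν * ModularForm.eta τ := by
    rw [eta_eq_lth hγτ, eta_eq_lth hτ]; exact_mod_cast hl 6 (by simp)
  have e2 : ModularForm.eta (2 * (γ • τ : ℍ)) = ν * ModularForm.eta (2 * τ) := by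
    rw [eta_two_mul_eq_lth hγτ, eta_two_mul_eq_lth hτ]; exact_mod_cast hl 12 (by simp)
  have e3 : ModularForm.eta ((γ • τ : ℍ) / 2) = ν * ModularForm.eta (τ / 2) := by
    rw [eta_half_eq_lth hγτ, eta_half_eq_lth hτ]; exact_mod_cast hl 3 (by simp)
  have hν0 : ν ≠ 0 := by
    rintro rfl
    exact ModularForm.eta_ne_zero hγτ (by rw [eη, zero_mul])
  have n1 := ModularForm.eta_ne_zero hτ
  have n2 := eta_two_ne_zero hτ
  have n3 := eta_half_ne_zero hτ
  have e4 : etaMid (γ • τ : ℍ) = ν * etaMid τ := by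
    rw [etaMid, etaMid, eη, e2, e3]
    field_simp
  have n4 := etaMid_ne_zero hτ
  rw [theta_eq_lth, theta_eq_lth, h0]
  fin_cases i <;>
  · simp only [thetaVec, Matrix.cons_val, Fin.zero_eta, Fin.mk_one, Fin.reduceFinMk, Fin.isValue,
      h0, h1, hr, e2, e3, e4]
    field_simp

theorem F5_smul_mul_theta {γ : SL(2, ℤ)} (hγ : γ ∈ CongruenceSubgroup.Gamma 3600) (τ : ℍ)
    (i : Fin 6) : F5 (γ • τ) i * theta τ = theta (γ • τ) * F5 τ i := by
  rw [F5_eq_thetaVec, F5_eq_thetaVec, thetaVec_smul_mul_theta hγ]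

lemma Gamma_le_Gamma0 : CongruenceSubgroup.Gamma 3600 ≤ CongruenceSubgroup.Gamma0 4 := by
  intro γ hγ
  have h := (CongruenceSubgroup.Gamma_mem.1 hγ).2.2.1
  rw [CongruenceSubgroup.Gamma0_mem]
  rw [ZMod.intCast_zmod_eq_zero_iff_dvd] at h ⊢
  exact dvd_trans (by norm_num) h

end MockTheta
namespace MockTheta
open Filter Topology Finset

/-! ### Behaviour at the cusp -/

section cusp
open UpperHalfPlane Asymptotics

lemma tendsto_ee_mul {r : ℝ} (hr : 0 < r) :
    Tendsto (fun τ : ℍ => ee (r * τ)) atImInfty (𝓝 0) := by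
  rw [tendsto_zero_iff_norm_tendsto_zero]
  have h : Tendsto (fun τ : ℍ => 2 * Real.pi * r * τ.im) atImInfty atTop :=
    tendsto_comap.const_mul_atTop (by positivity)
  refine (Real.tendsto_exp_neg_atTop_nhds_zero.comp h).congr fun τ => ?_
  rw [norm_ee, Complex.im_ofReal_mul, Function.comp_apply, coe_im]
  ring_nf

/-- Dominated convergence, with the values at τ = i as majorant once Im τ ≥ 1. The limit counts the
lattice points of exact exponent e. -/
lemma tendsto_lth {c x e : ℝ} (hc : 0 < c) (he : ∀ n : ℤ, e ≤ c * (n + x) ^ 2) :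
    Tendsto (fun τ : ℍ => ee ((-e : ℝ) * τ) * lth c x τ) atImInfty
      (𝓝 (∑' n : ℤ, if c * (n + x) ^ 2 = e then 1 else 0)) := by
  have h1 : (fun τ : ℍ => ee ((-e : ℝ) * τ) * lth c x τ) =
      fun τ : ℍ => ∑' n : ℤ, ee ((c * (n + x) ^ 2 - e : ℝ) * τ) := by
    funext τ
    rw [lth, ← tsum_mul_left]
    refine tsum_congr fun n => ?_
    rw [← ee_add]
    push_cast
    ring_nf
  rw [h1]
  have hI : 0 < (Complex.I).im := by simp
  refine tendsto_tsum_of_dominated_convergence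
    (bound := fun n : ℤ => ‖ee ((-e : ℝ) * Complex.I) * ee (c * (n + x) ^ 2 * Complex.I)‖)
    ((summable_lth hc x hI).mul_left _).norm (fun n => ?_) ?_
  · split_ifs with h
    · simp only [h, sub_self, Complex.ofReal_zero, zero_mul, ee_zero]
      exact tendsto_const_nhds
    · exact tendsto_ee_mul (sub_pos.2 (lt_of_le_of_ne (he n) (Ne.symm h)))
  · filter_upwards [(atImInfty_mem _).2 ⟨1, fun _ h => h⟩] with τ hτ n
    rw [← ee_add, show ((-e : ℝ) : ℂ) * Complex.I + c * (n + x) ^ 2 * Complex.I =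
      (c * (n + x) ^ 2 - e : ℝ) * Complex.I by push_cast; ring, norm_ee, norm_ee,
      Complex.im_ofReal_mul, Complex.im_ofReal_mul, Complex.I_im, Real.exp_le_exp, coe_im]
    have := mul_le_mul_of_nonneg_left hτ (mul_nonneg Real.pi_pos.le (sub_nonneg.2 (he n)))
    linarith

lemma sq_lt_add_sq {x : ℝ} (h0 : 0 ≤ x) (h1 : x < 1 / 2) {n : ℤ} (hn : n ≠ 0) :
    x ^ 2 < (n + x) ^ 2 := by
  rcases lt_or_gt_of_ne hn with h | h
  · have : (n : ℝ) ≤ -1 := by exact_mod_cast (by lia : n ≤ -1)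
    nlinarith
  · have : (1 : ℝ) ≤ n := by exact_mod_cast h
    nlinarith

lemma tendsto_lth_one {c x : ℝ} (hc : 0 < c) (h0 : 0 ≤ x) (h1 : x < 1 / 2) :
    Tendsto (fun τ : ℍ => ee ((-(c * x ^ 2) : ℝ) * τ) * lth c x τ) atImInfty (𝓝 1) := by
  have h2 (n : ℤ) (hn : n ≠ 0) := mul_lt_mul_of_pos_left (sq_lt_add_sq h0 h1 hn) hc
  have h := tendsto_lth (x := x) (e := c * x ^ 2) hc fun n => by
    rcases eq_or_ne n 0 with rfl | hn
    · simp
    · exact (h2 n hn).le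
  rwa [tsum_eq_single 0 fun n hn => if_neg (h2 n hn).ne', if_pos (by simp)] at h

lemma tendsto_lth_zero {c x e : ℝ} (hc : 0 < c) (h0 : 0 ≤ x) (h1 : x ≤ 1 / 2)
    (he : e < c * x ^ 2) :
    Tendsto (fun τ : ℍ => ee ((-e : ℝ) * τ) * lth c x τ) atImInfty (𝓝 0) := by
  have h2 (n : ℤ) : e < c * (n + x) ^ 2 := by
    have : x ^ 2 ≤ (n + x) ^ 2 := by
      rcases le_or_gt 0 n with h | h
      · have : (0 : ℝ) ≤ n := by exact_mod_cast h
        nlinarith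
      · have : (n : ℝ) ≤ -1 := by exact_mod_cast (by lia : n ≤ -1)
        nlinarith
    nlinarith
  have h := tendsto_lth hc fun n => (h2 n).le
  simpa only [if_neg (h2 _).ne', tsum_zero] using h

lemma isBigO_lth {c : ℝ} (hc : 0 < c) (x : ℝ) :
    (fun τ : ℍ => lth c x τ) =O[atImInfty] fun _ => (1 : ℝ) := by
  have h := tendsto_lth (x := x) (e := 0) hc fun n => by positivity
  refine (h.isBigO_one ℝ).congr_left fun τ => ?_
  simp [ee_zero]

lemma tendsto_eta_level {c : ℝ} (hc : 0 < c) :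
    Tendsto (fun τ : ℍ => ee ((-(c / 144) : ℝ) * τ) * (lth c (1 / 12) τ - lth c (5 / 12) τ))
      atImInfty (𝓝 1) := by
  have h1 := tendsto_lth_one (x := 1 / 12) hc (by norm_num) (by norm_num)
  rw [show c * (1 / 12 : ℝ) ^ 2 = c / 144 by ring] at h1
  have h2 := tendsto_lth_zero (x := 5 / 12) (e := c / 144) hc (by norm_num) (by norm_num)
    (by linarith)
  simpa [mul_sub] using h1.sub h2

/-- The leading term is e(cτ/144), with no cancellation, so the inverse grows at most like its
reciprocal. -/
lemma isBigO_inv_eta_level {c : ℝ} (hc : 0 < c) :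
    (fun τ : ℍ => (lth c (1 / 12) τ - lth c (5 / 12) τ)⁻¹) =O[atImInfty]
      fun τ => Real.exp (Real.pi * c / 72 * τ.im) := by
  have h := ((tendsto_eta_level hc).inv₀ one_ne_zero).isBigO_one ℝ
  have h2 : (fun τ : ℍ => ee ((-(c / 144) : ℝ) * τ)) =O[atImInfty]
      fun τ => Real.exp (Real.pi * c / 72 * τ.im) := by
    refine isBigO_of_le _ fun τ => ?_
    rw [norm_ee, Complex.im_ofReal_mul, Real.norm_of_nonneg (Real.exp_pos _).le, coe_im]
    ring_nf
    rfl
  refine (h2.mul h).congr (fun τ => ?_) fun τ => mul_one _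
  have := ee_ne_zero ((-(c / 144) : ℝ) * (τ : ℂ))
  rw [mul_inv]
  field_simp

lemma isBigO_exp_mono {C C' : ℝ} (h : C ≤ C') :
    (fun τ : ℍ => Real.exp (C * τ.im)) =O[atImInfty] fun τ => Real.exp (C' * τ.im) := by
  refine isBigO_of_le _ fun τ => ?_
  rw [Real.norm_of_nonneg (Real.exp_pos _).le, Real.norm_of_nonneg (Real.exp_pos _).le,
    Real.exp_le_exp]
  exact mul_le_mul_of_nonneg_right h τ.im_pos.le

lemma isBigO_inv_etaMid :
    (fun τ : ℍ => (etaMid τ)⁻¹) =O[atImInfty] fun τ => Real.exp (Real.pi * τ.im) := by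
  have hb (c : ℝ) (hc : 0 < c) := (isBigO_lth hc (1 / 12)).sub (isBigO_lth hc (5 / 12))
  have h := ((hb 3 (by norm_num)).mul (hb 12 (by norm_num))).mul
    ((isBigO_inv_eta_level (c := 6) (by norm_num)).pow 3)
  refine (h.congr (fun τ => ?_) fun τ => ?_).trans
    (isBigO_exp_mono (C := Real.pi / 4) (by linarith [Real.pi_pos]))
  · have n1 := ModularForm.eta_ne_zero τ.2
    have n2 := eta_two_ne_zero τ.2
    have n3 := eta_half_ne_zero τ.2
    have e1 := eta_eq_lth τ.2
    have e2 := eta_half_eq_lth τ.2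
    have e3 := eta_two_mul_eq_lth τ.2
    rw [← e1, ← e2, ← e3, etaMid]
    field_simp
  · rw [mul_one, one_mul, ← Real.exp_nat_mul]
    push_cast
    ring_nf

theorem isBigO_thetaVec (i : Fin 6) :
    (fun τ : ℍ => thetaVec τ i) =O[atImInfty] fun τ => Real.exp (Real.pi * τ.im) := by
  have t0 := isBigO_lth (c := 1) one_pos 0
  have t1 := isBigO_lth (c := 1) one_pos (1 / 2)
  have hr (r : ℤ) : (fun τ : ℍ => rogersTheta r τ) =O[atImInfty] fun _ => (1 : ℝ) :=
    (isBigO_lth (by norm_num) _).sub (isBigO_lth (by norm_num) _)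
  have d1 : (fun τ : ℍ => (ModularForm.eta (2 * τ))⁻¹) =O[atImInfty]
      fun τ => Real.exp (Real.pi * τ.im) := by
    refine ((isBigO_inv_eta_level (c := 12) (by norm_num)).congr_left fun τ => ?_).trans
      (isBigO_exp_mono (by linarith [Real.pi_pos]))
    rw [← eta_two_mul_eq_lth τ.2]
  have d2 : (fun τ : ℍ => (ModularForm.eta (τ / 2))⁻¹) =O[atImInfty]
      fun τ => Real.exp (Real.pi * τ.im) := by
    refine ((isBigO_inv_eta_level (c := 3) (by norm_num)).congr_left fun τ => ?_).trans
      (isBigO_exp_mono (by linarith [Real.pi_pos]))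
    rw [← eta_half_eq_lth τ.2]
  have d3 := isBigO_inv_etaMid
  have key {a b c d e : ℍ → ℂ} (ha : a =O[atImInfty] fun _ => (1 : ℝ))
      (hb : b =O[atImInfty] fun _ => (1 : ℝ)) (hc : c =O[atImInfty] fun _ => (1 : ℝ))
      (hd : d =O[atImInfty] fun _ => (1 : ℝ))
      (he : (fun τ => (e τ)⁻¹) =O[atImInfty] fun τ => Real.exp (Real.pi * τ.im)) :
      (fun τ => (a τ * b τ + c τ * d τ) / e τ) =O[atImInfty]
          (fun τ => Real.exp (Real.pi * τ.im)) ∧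
        (fun τ => (a τ * b τ - c τ * d τ) / e τ) =O[atImInfty]
          (fun τ => Real.exp (Real.pi * τ.im)) := by
    have h1 := ha.mul hb
    have h2 := hc.mul hd
    simp only [mul_one] at h1 h2
    simp only [div_eq_mul_inv]
    constructor
    · simpa only [one_mul] using (h1.add h2).mul he
    · simpa only [one_mul] using (h1.sub h2).mul he
  fin_cases i
  · exact (key t0 (hr 2) t1 (hr 7) d1).1
  · exact (key t1 (hr 1) t0 (hr 4) d1).1
  · exact (key t0 (hr 1) t1 (hr 4) d2).2
  · exact (key t1 (hr 2) t0 (hr 7) d2).2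
  · exact (key t0 (hr 1) t1 (hr 4) d3).1
  · exact (key t1 (hr 2) t0 (hr 7) d3).1

theorem isBigO_F5 (i : Fin 6) :
    (fun τ => F5 τ i) =O[atImInfty] fun τ => Real.exp (Real.pi * τ.im) := by
  simpa only [F5_eq_thetaVec] using isBigO_thetaVec i

/-- The numerator of this component, divided by e(τ/60), tends to 1 at the cusp: only the constant
term of the even theta series and the shift 1/30 contribute. -/
theorem exists_F5_ne_zero : ∃ τ, F5 τ 4 ≠ 0 := by
  have t0 := tendsto_lth_one (c := 1) (x := 0) one_pos le_rfl (by norm_num)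
  have t1 := tendsto_lth_zero (c := 1) (x := 1 / 2) (e := 0) one_pos (by norm_num) le_rfl
    (by norm_num)
  have a1 := tendsto_lth_one (c := 15) (x := 1 / 30) (by norm_num) (by norm_num) (by norm_num)
  have a2 := tendsto_lth_zero (c := 15) (x := 11 / 30) (e := 1 / 60) (by norm_num) (by norm_num)
    (by norm_num) (by norm_num)
  have a3 := tendsto_lth_zero (c := 15) (x := 4 / 30) (e := 1 / 60) (by norm_num) (by norm_num)
    (by norm_num) (by norm_num)
  have a4 := tendsto_lth_zero (c := 15) (x := 14 / 30) (e := 1 / 60) (by norm_num) (by norm_num)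
    (by norm_num) (by norm_num)
  rw [show (15 : ℝ) * (1 / 30) ^ 2 = 1 / 60 by norm_num] at a1
  have h := (t0.mul (a1.sub a2)).add (t1.mul (a3.sub a4))
  norm_num at h
  obtain ⟨τ, hτ⟩ := (h.eventually_ne one_ne_zero).exists
  refine ⟨τ, fun h0 => hτ ?_⟩
  have e4 : lth 15 (44 / 30) τ = lth 15 (14 / 30) τ := by
    rw [← lth_add_int 15 (14 / 30) τ 1]; norm_num
  rw [F5_eq_thetaVec] at h0
  simp only [thetaVec, Matrix.cons_val, div_eq_zero_iff, etaMid_ne_zero τ.2, or_false,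
    rogersTheta] at h0
  norm_num at h0 e4
  rw [e4] at h0
  linear_combination (ee 0 * ee (-(1 / 60 * (τ : ℂ)))) * h0

end cusp

end MockTheta
namespace MockTheta
open Filter Topology Finset

/-! ### Linear independence of the components of `F₅` -/

lemma F5_vadd_one_apply (τ : ℍ) :
    F5 ((1 : ℝ) +ᵥ τ) 0 = ee (-1 / 60) * F5 τ 0 ∧ F5 ((1 : ℝ) +ᵥ τ) 1 = ee (11 / 60) * F5 τ 1 ∧
    F5 ((1 : ℝ) +ᵥ τ) 2 = ee (-1 / 240) * F5 τ 4 ∧ F5 ((1 : ℝ) +ᵥ τ) 3 = ee (71 / 240) * F5 τ 5 ∧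
    F5 ((1 : ℝ) +ᵥ τ) 4 = ee (-1 / 240) * F5 τ 2 ∧ F5 ((1 : ℝ) +ᵥ τ) 5 = ee (71 / 240) * F5 τ 3 := by
  have h1 : zeta 60 ^ 11 = ee (11 / 60) := by simpa using zeta_zpow 60 11
  have h2 : zeta 240 ^ 71 = ee (71 / 240) := by simpa using zeta_zpow 240 71
  rw [F5_vadd_one]
  refine ⟨?_, ?_, ?_, ?_, ?_, ?_⟩ <;>
    simp [T5, Matrix.mulVec, dotProduct, Fin.sum_univ_succ, zeta_zpow, -zpow_neg, h1, h2]

lemma s1_ne_zero : s1 ≠ 0 := by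
  rw [s1, Complex.ofReal_ne_zero]
  exact (Real.sin_pos_of_pos_of_lt_pi (by positivity) (by linarith [Real.pi_pos])).ne'

lemma s2_ne_zero : s2 ≠ 0 := by
  rw [s2, Complex.ofReal_ne_zero]
  exact (Real.sin_pos_of_pos_of_lt_pi (by positivity) (by linarith [Real.pi_pos])).ne'

lemma r2_ne_zero : r2 ≠ 0 := by
  rw [r2, Complex.ofReal_ne_zero]
  positivity

lemma ee_ne_ee {x y : ℝ} (h : 0 < |x - y|) (h1 : |x - y| < 1) : ee x ≠ ee y := by
  intro he
  have h2 : ee (x - y) = 1 := by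
    rw [sub_eq_add_neg, ee_add, he, ← ee_add, add_neg_cancel, ee_zero]
  rw [ee, Complex.exp_eq_one_iff] at h2
  obtain ⟨n, hn⟩ := h2
  have h3 : ((x - y : ℝ) : ℂ) = (n : ℝ) := by
    have : (2 * Real.pi * Complex.I : ℂ) ≠ 0 := by simp [Real.pi_ne_zero]
    refine mul_left_cancel₀ this ?_
    push_cast
    linear_combination hn
  have h4 : x - y = n := by exact_mod_cast h3
  rw [h4] at h h1
  have h5 : |n| < 1 := by exact_mod_cast h1
  have h6 : 0 < |n| := by exact_mod_cast h
  lia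

/-- Eigenvectors of `τ ↦ τ + 2` with distinct eigenvalues are linearly independent. -/
lemma eq_zero_of_sum_eigen {g : Fin 4 → ℍ → ℂ} {μ : Fin 4 → ℂ} (hμ : Function.Injective μ)
    (hg : ∀ j τ, g j ((1 : ℝ) +ᵥ ((1 : ℝ) +ᵥ τ)) = μ j * g j τ) (h : ∀ τ, ∑ j, g j τ = 0) (τ : ℍ)
    (j : Fin 4) : g j τ = 0 := by
  -- Translating the relation by 2 repeatedly gives a Vandermonde system.
  have key (k : ℕ) : ∀ τ, ∑ j, g j τ * μ j ^ k = 0 := by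
    induction k with
    | zero => simpa using h
    | succ k ih =>
      intro τ
      rw [← ih ((1 : ℝ) +ᵥ ((1 : ℝ) +ᵥ τ))]
      refine sum_congr rfl fun j _ => ?_
      rw [hg]
      ring
  exact congrFun (Matrix.eq_zero_of_forall_pow_sum_mul_pow_eq_zero (v := fun j => g j τ) hμ
    fun k => key k τ) j

/-- T² acts diagonally, with eigenvalues e(-8/240), e(88/240), e(-2/240) and e(142/240), the last
two each on two components. A linear relation therefore breaks into its four eigenparts. -/
lemma separate {v : Fin 6 → ℂ} (h : ∀ τ, ∑ i, v i * F5 τ i = 0) (τ : ℍ) :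
    v 0 * F5 τ 0 = 0 ∧ v 1 * F5 τ 1 = 0 ∧ v 2 * F5 τ 2 + v 4 * F5 τ 4 = 0 ∧
      v 3 * F5 τ 3 + v 5 * F5 τ 5 = 0 := by
  have hμ : Function.Injective (fun j : Fin 4 => ee (![(-8 / 240 : ℝ), 88 / 240, -2 / 240, 142 / 240] j : ℝ)) := by
    intro i j hij
    by_contra hne
    refine ee_ne_ee ?_ ?_ hij
    all_goals
      fin_cases i <;> fin_cases j <;> first | exact absurd rfl hne | norm_num [abs_lt]
  have hsum := eq_zero_of_sum_eigen (g := ![fun τ => v 0 * F5 τ 0, fun τ => v 1 * F5 τ 1,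
      fun τ => v 2 * F5 τ 2 + v 4 * F5 τ 4, fun τ => v 3 * F5 τ 3 + v 5 * F5 τ 5]) hμ ?_ ?_ τ
  · exact ⟨hsum 0, hsum 1, hsum 2, hsum 3⟩
  · intro j τ
    obtain ⟨a0, a1, a2, a3, a4, a5⟩ := F5_vadd_one_apply τ
    obtain ⟨b0, b1, b2, b3, b4, b5⟩ := F5_vadd_one_apply ((1 : ℝ) +ᵥ τ)
    have e0 : ee ((-8 / 240 : ℝ) : ℂ) = ee (-1 / 60) * ee (-1 / 60) := by
      rw [← ee_add]; push_cast; norm_num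
    have e1 : ee ((88 / 240 : ℝ) : ℂ) = ee (11 / 60) * ee (11 / 60) := by
      rw [← ee_add]; push_cast; norm_num
    have e2 : ee ((-2 / 240 : ℝ) : ℂ) = ee (-1 / 240) * ee (-1 / 240) := by
      rw [← ee_add]; push_cast; norm_num
    have e3 : ee ((142 / 240 : ℝ) : ℂ) = ee (71 / 240) * ee (71 / 240) := by
      rw [← ee_add]; push_cast; norm_num
    fin_cases j
    · change v 0 * F5 _ 0 = ee ((-8 / 240 : ℝ) : ℂ) * (v 0 * F5 _ 0)
      rw [b0, a0, e0]; ring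
    · change v 1 * F5 _ 1 = ee ((88 / 240 : ℝ) : ℂ) * (v 1 * F5 _ 1)
      rw [b1, a1, e1]; ring
    · change v 2 * F5 _ 2 + v 4 * F5 _ 4 = ee ((-2 / 240 : ℝ) : ℂ) * (v 2 * F5 _ 2 + v 4 * F5 _ 4)
      rw [b2, b4, a4, a2, e2]; ring
    · change v 3 * F5 _ 3 + v 5 * F5 _ 5 = ee ((142 / 240 : ℝ) : ℂ) * (v 3 * F5 _ 3 + v 5 * F5 _ 5)
      rw [b3, b5, a5, a3, e3]; ring
  · intro τ
    rw [← h τ]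
    simp [Fin.sum_univ_succ]
    ring

lemma sum_M5_mul_F5 {v : Fin 6 → ℂ} (h : ∀ τ, ∑ i, v i * F5 τ i = 0) (τ : ℍ) :
    ∑ j, (v ᵥ* M5) j * F5 τ j = 0 := by
  have h1 : v ⬝ᵥ F5 (ModularGroup.S • τ) = 0 := h _
  have h2 : sqrtI τ * (2 / (√5 : ℝ) : ℂ) ≠ 0 := by
    refine mul_ne_zero (sqrtI_ne_zero (ne_zero_of_im_pos τ.2)) (div_ne_zero two_ne_zero ?_)
    rw [Complex.ofReal_ne_zero]; positivity
  rw [F5_S_smul, ← sqrtI, dotProduct_smul, smul_eq_mul, mul_eq_zero, or_iff_right h2,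
    Matrix.dotProduct_mulVec] at h1
  exact h1

theorem exists_F5_zero_ne_zero : ∃ τ, F5 τ 0 ≠ 0 := by
  by_contra! h0
  have h1 := sum_M5_mul_F5 (v := Pi.single 0 1) (by simpa [Pi.single_apply] using h0)
  obtain ⟨τ, hτ⟩ := exists_F5_ne_zero
  have h2 (τ : ℍ) : F5 τ 2 = 0 := by
    have := (separate h1 τ).2.2.1
    simpa [M5, Matrix.vecMul, dotProduct, Fin.sum_univ_succ, Pi.single_apply, s1_ne_zero,
      r2_ne_zero] using this
  have h3 := (F5_vadd_one_apply τ).2.2.1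
  rw [h2] at h3
  exact hτ ((mul_eq_zero.1 h3.symm).resolve_left (ee_ne_zero _))

/-- Relations are stable under splitting by T² and under v ↦ v M₅. Applying S to an eigenpart mixes
it with other eigenspaces, and splitting again isolates single coefficients against components 0 and
4, or against component 2, which a translation turns into component 4. Components 0 and 4 are known
not to vanish identically. -/
theorem eq_zero_of_forall_sum_F5 {v : Fin 6 → ℂ} (h : ∀ τ, ∑ i, v i * F5 τ i = 0) : v = 0 := by
  obtain ⟨τ₀, hτ₀⟩ := exists_F5_zero_ne_zero
  obtain ⟨τ₄, hτ₄⟩ := exists_F5_ne_zero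
  have s1n := s1_ne_zero
  have s2n := s2_ne_zero
  have r2n := r2_ne_zero
  have c0 : v 0 = 0 := (mul_eq_zero.1 (separate h τ₀).1).resolve_right hτ₀
  have c1 : v 1 = 0 := by
    have h1 := sum_M5_mul_F5 (v := Pi.single 1 (v 1)) fun τ => by
      simpa [Pi.single_apply] using (separate h τ).2.1
    have h2 := (separate h1 ((1 : ℝ) +ᵥ τ₄)).2.2.1
    rw [(F5_vadd_one_apply τ₄).2.2.1] at h2
    simpa [M5, Matrix.vecMul, dotProduct, Fin.sum_univ_succ, Pi.single_apply, s2n, r2n, hτ₄,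
      ee_ne_zero] using h2
  have c24 : v 2 = 0 ∧ v 4 = 0 := by
    have h1 := sum_M5_mul_F5 (v := ![0, 0, v 2, 0, v 4, 0]) fun τ => by
      simpa [Fin.sum_univ_succ] using (separate h τ).2.2.1
    have h2 := (separate h1 τ₀).1
    have h3 := (separate h1 τ₄).2.2.1
    simp [M5, Matrix.vecMul, dotProduct, Fin.sum_univ_succ, s1n, s2n, r2n, hτ₀, hτ₄] at h2 h3
    exact ⟨h2, h3⟩
  have c35 : v 3 = 0 ∧ v 5 = 0 := by
    have h1 := sum_M5_mul_F5 (v := ![0, 0, 0, v 3, 0, v 5]) fun τ => by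
      simpa [Fin.sum_univ_succ] using (separate h τ).2.2.2
    have h2 := (separate h1 τ₀).1
    have h3 := (separate h1 τ₄).2.2.1
    simp [M5, Matrix.vecMul, dotProduct, Fin.sum_univ_succ, s1n, s2n, r2n, hτ₀, hτ₄] at h2 h3
    exact ⟨h2, h3⟩
  ext i
  fin_cases i
  exacts [c0, c1, c24.1, c35.1, c24.2, c35.2]

lemma matrix_eq_of_mulVec_F5 {A B : Matrix (Fin 6) (Fin 6) ℂ}
    (h : ∀ τ, A *ᵥ F5 τ = B *ᵥ F5 τ) : A = B := by
  ext i j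
  have h1 := eq_zero_of_forall_sum_F5 (v := A i - B i) fun τ => by
    have h2 : A i ⬝ᵥ F5 τ = B i ⬝ᵥ F5 τ := congrFun (h τ) i
    have h3 : (A i - B i) ⬝ᵥ F5 τ = 0 := by rw [sub_dotProduct, h2, sub_self]
    exact h3
  exact sub_eq_zero.1 (congrFun h1 j)

/-! ### The factor `(c τ + d) ^ (1/2)` -/

lemma denom_ne_zero_SL (γ : SL(2, ℤ)) (τ : ℍ) :
    ((γ 1 0 : ℤ) : ℂ) * (τ : ℂ) + ((γ 1 1 : ℤ) : ℂ) ≠ 0 := by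
  intro h
  have hdet := γ.det_coe
  rw [Matrix.det_fin_two] at hdet
  have him := congrArg Complex.im h
  have hC : ((γ 1 0 : ℤ) : ℝ) = 0 := by simpa [τ.im_pos.ne'] using him
  have hC0 : γ 1 0 = 0 := by exact_mod_cast hC
  rw [hC0] at h hdet
  have hD : γ 1 1 = 0 := by simpa using h
  rw [hD] at hdet
  simp at hdet

lemma halfFactor_sq (γ : SL(2, ℤ)) (τ : ℍ) :
    halfFactor γ τ ^ 2 = ((γ 1 0 : ℤ) : ℂ) * (τ : ℂ) + ((γ 1 1 : ℤ) : ℂ) := by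
  rw [halfFactor, ← Complex.cpow_nat_mul]; simp

lemma halfFactor_ne_zero (γ : SL(2, ℤ)) (τ : ℍ) : halfFactor γ τ ≠ 0 := by
  intro h
  have := halfFactor_sq γ τ
  rw [h] at this
  exact denom_ne_zero_SL γ τ (by rw [← this]; simp)

lemma continuous_halfFactor (γ : SL(2, ℤ)) : Continuous (halfFactor γ) := by
  by_cases hC : γ 1 0 = 0
  · unfold halfFactor
    simp only [hC, Int.cast_zero, zero_mul, zero_add]
    exact continuous_const
  · refine Continuous.cpow (by fun_prop) continuous_const fun τ => ?_
    rw [Complex.mem_slitPlane_iff]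
    right
    simpa using ⟨hC, τ.im_pos.ne'⟩

lemma coe_smul_SL (γ : SL(2, ℤ)) (τ : ℍ) : ((γ • τ : ℍ) : ℂ) =
    (((γ 0 0 : ℤ) : ℂ) * τ + ((γ 0 1 : ℤ) : ℂ)) / (((γ 1 0 : ℤ) : ℂ) * τ + ((γ 1 1 : ℤ) : ℂ)) := by
  rw [UpperHalfPlane.coe_specialLinearGroup_apply]
  simp

lemma eq_or_eq_neg_of_sq {f g : ℍ → ℂ} (hf : Continuous f) (hg : Continuous g)
    (hg0 : ∀ τ, g τ ≠ 0) (h : ∀ τ, f τ ^ 2 = g τ ^ 2) :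
    ∃ ε : ℂ, ε * ε = 1 ∧ ∀ τ, f τ = ε * g τ := by
  rcases isPreconnected_univ.eq_or_eq_neg_of_sq_eq hf.continuousOn hg.continuousOn
    (fun τ _ => h τ) (fun _ => hg0 _) with h | h
  · exact ⟨1, by simp, fun τ => by simpa using h (Set.mem_univ τ)⟩
  · exact ⟨-1, by simp, fun τ => by simpa using h (Set.mem_univ τ)⟩

/-- The squares satisfy the cocycle relation of cτ + d. Both sides are continuous and the right hand
factor is nowhere zero on the connected half plane, so the sign is constant. -/
lemma halfFactor_cocycle (γ δ : SL(2, ℤ)) : ∃ ε : ℂ, ε * ε = 1 ∧ ∀ τ : ℍ,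
    halfFactor γ (δ • τ) * halfFactor δ τ = ε * halfFactor (γ * δ) τ := by
  have hδ : Continuous fun τ : ℍ => δ • τ := by
    rw [UpperHalfPlane.isEmbedding_coe.continuous_iff]
    simp only [Function.comp_def, coe_smul_SL]
    exact Continuous.div (by fun_prop) (by fun_prop) (denom_ne_zero_SL δ)
  refine eq_or_eq_neg_of_sq (((continuous_halfFactor γ).comp hδ).mul
    (continuous_halfFactor δ)) (continuous_halfFactor _) (halfFactor_ne_zero _) fun τ => ?_
  have h := denom_ne_zero_SL δ τ
  rw [mul_pow, halfFactor_sq, halfFactor_sq, halfFactor_sq, coe_smul_SL]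
  simp only [Matrix.SpecialLinearGroup.coe_mul, Matrix.mul_apply, Fin.sum_univ_two]
  rw [add_mul, mul_div_assoc', div_mul_cancel₀ _ h]
  push_cast
  ring

lemma sqrtI_eq_halfFactor_S : ∃ c : ℂ, c ≠ 0 ∧ ∀ τ : ℍ,
    sqrtI τ = c * halfFactor ModularGroup.S τ := by
  have hc : (-Complex.I) ^ (1 / 2 : ℂ) ≠ 0 := by simp [Complex.cpow_def]
  have hcont : Continuous fun τ : ℍ => sqrtI τ := by
    refine Continuous.cpow (by fun_prop) continuous_const fun τ => ?_
    rw [Complex.mem_slitPlane_iff]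
    left
    simpa using τ.im_pos
  obtain ⟨ε, hε, h⟩ := eq_or_eq_neg_of_sq hcont
    ((continuous_halfFactor ModularGroup.S).const_mul ((-Complex.I) ^ (1 / 2 : ℂ)))
    (fun τ => mul_ne_zero hc (halfFactor_ne_zero _ τ)) fun τ => by
      rw [sqrtI_sq, mul_pow, halfFactor_sq, ← Complex.cpow_nat_mul]
      simp [ModularGroup.S]
  refine ⟨ε * (-Complex.I) ^ (1 / 2 : ℂ), mul_ne_zero ?_ hc, fun τ => by rw [h, mul_assoc]⟩
  rintro rfl
  simp at hε

/-! ### The representation -/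

/-- `γ` acts on `F₅` through the matrix `A`, in weight `1/2`. -/
def TransformsBy (γ : SL(2, ℤ)) (A : GL (Fin 6) ℂ) : Prop :=
  ∀ τ : ℍ, F5 (γ • τ) = halfFactor γ τ • ((A : Matrix (Fin 6) (Fin 6) ℂ) *ᵥ F5 τ)

/-- M₅² is the scalar sin²(π/5) + sin²(2π/5), which is positive. -/
lemma det_M5_ne_zero : M5.det ≠ 0 := by
  have h1 : M5 * M5 = (s1 ^ 2 + s2 ^ 2) • (1 : Matrix (Fin 6) (Fin 6) ℂ) := by
    have := r2_ne_zero
    ext i j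
    fin_cases i <;> fin_cases j <;>
      simp [M5, Matrix.mul_apply, Fin.sum_univ_succ] <;> field_simp <;> ring
  have h2 : s1 ^ 2 + s2 ^ 2 ≠ 0 := by
    have h3 : 0 < Real.sin (Real.pi / 5) :=
      Real.sin_pos_of_pos_of_lt_pi (by positivity) (by linarith [Real.pi_pos])
    rw [s1, s2, ← Complex.ofReal_pow, ← Complex.ofReal_pow, ← Complex.ofReal_add,
      Complex.ofReal_ne_zero]
    positivity
  intro h0
  have h3 := congrArg Matrix.det h1
  rw [Matrix.det_mul, h0, Matrix.det_smul, Matrix.det_one, mul_one, mul_zero] at h3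
  exact pow_ne_zero _ h2 h3.symm

lemma det_T5_ne_zero : T5.det ≠ 0 := by
  have h60 : zeta 60 ≠ 0 := Complex.exp_ne_zero _
  have h240 : zeta 240 ≠ 0 := Complex.exp_ne_zero _
  refine Matrix.det_ne_zero_of_right_inverse (B := !![zeta 60, 0, 0, 0, 0, 0;
     0, zeta 60 ^ (-11 : ℤ), 0, 0, 0, 0;
     0, 0, 0, 0, zeta 240, 0;
     0, 0, 0, 0, 0, zeta 240 ^ (-71 : ℤ);
     0, 0, zeta 240, 0, 0, 0;
     0, 0, 0, zeta 240 ^ (-71 : ℤ), 0, 0]) ?_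
  ext i j
  fin_cases i <;> fin_cases j <;>
    simp [T5, Matrix.mul_apply, Fin.sum_univ_succ, h60, h240, zpow_neg]

lemma transformsBy_T : ∃ A, TransformsBy ModularGroup.T A := by
  refine ⟨Matrix.GeneralLinearGroup.mkOfDetNeZero T5 det_T5_ne_zero, fun τ => ?_⟩
  rw [UpperHalfPlane.modular_T_smul, F5_vadd_one]
  simp [halfFactor, ModularGroup.T, Matrix.GeneralLinearGroup.mkOfDetNeZero]

lemma transformsBy_S : ∃ A, TransformsBy ModularGroup.S A := by
  obtain ⟨c, hc, h⟩ := sqrtI_eq_halfFactor_S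
  have h5 : (2 / (√5 : ℝ) : ℂ) ≠ 0 := by
    refine div_ne_zero two_ne_zero ?_
    rw [Complex.ofReal_ne_zero]; positivity
  refine ⟨Matrix.GeneralLinearGroup.mkOfDetNeZero ((c * (2 / (√5 : ℝ) : ℂ)) • M5) ?_, fun τ => ?_⟩
  · rw [Matrix.det_smul]
    exact mul_ne_zero (pow_ne_zero _ (mul_ne_zero hc h5)) det_M5_ne_zero
  · rw [F5_S_smul, ← sqrtI, h]
    change _ = halfFactor ModularGroup.S τ • (((c * (2 / (√5 : ℝ) : ℂ)) • M5) *ᵥ F5 τ)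
    rw [Matrix.smul_mulVec, smul_smul]
    ring_nf

lemma TransformsBy.mul {γ δ : SL(2, ℤ)} {A B : GL (Fin 6) ℂ} (hA : TransformsBy γ A)
    (hB : TransformsBy δ B) (τ : ℍ) : F5 ((γ * δ) • τ) =
      (halfFactor γ (δ • τ) * halfFactor δ τ) • ((A * B : Matrix (Fin 6) (Fin 6) ℂ) *ᵥ F5 τ) := by
  rw [mul_smul, hA, hB, Matrix.mulVec_smul, smul_smul, Matrix.mulVec_mulVec]

/-- Induction over words in S and T; the sign ambiguity of the half integral factor is absorbed into
the matrix. -/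
theorem exists_transformsBy (γ : SL(2, ℤ)) : ∃ A, TransformsBy γ A := by
  have : γ ∈ Subgroup.closure {ModularGroup.S, ModularGroup.T} := by
    simp [SpecialLinearGroup.SL2Z_generators]
  induction this using Subgroup.closure_induction with
  | mem x hx =>
    rcases hx with rfl | rfl
    · exact transformsBy_S
    · exact transformsBy_T
  | one => exact ⟨1, fun τ => by simp [halfFactor]⟩
  | mul γ δ _ _ hγ hδ =>
    obtain ⟨A, hA⟩ := hγ
    obtain ⟨B, hB⟩ := hδ
    obtain ⟨ε, hε, h⟩ := halfFactor_cocycle γ δ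
    let e : ℂˣ := ⟨ε, ε, hε, hε⟩
    refine ⟨e • (A * B), fun τ => ?_⟩
    rw [hA.mul hB, h, mul_comm ε, mul_smul]
    simp [e, Units.smul_def, Matrix.smul_mulVec]
  | inv γ _ hγ =>
    obtain ⟨A, hA⟩ := hγ
    obtain ⟨ε, hε, h⟩ := halfFactor_cocycle γ γ⁻¹
    let e : ℂˣ := ⟨ε, ε, hε, hε⟩
    refine ⟨e • A⁻¹, fun τ => ?_⟩
    have h1 := hA (γ⁻¹ • τ)
    have h2 := h τ
    rw [mul_inv_cancel] at h2
    rw [smul_inv_smul] at h1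
    have h3 : halfFactor 1 τ = 1 := by simp [halfFactor]
    have h4 : ((A⁻¹ : GL (Fin 6) ℂ) : Matrix (Fin 6) (Fin 6) ℂ) * (A : Matrix (Fin 6) (Fin 6) ℂ) = 1 :=
      A.inv_mul
    have h5 : ((e • A⁻¹ : GL (Fin 6) ℂ) : Matrix (Fin 6) (Fin 6) ℂ) =
      ε • ((A⁻¹ : GL (Fin 6) ℂ) : Matrix (Fin 6) (Fin 6) ℂ) := rfl
    rw [h3, mul_one] at h2
    rw [h1, h5, Matrix.mulVec_smul, Matrix.smul_mulVec, Matrix.mulVec_mulVec, h4, Matrix.one_mulVec,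
      smul_smul, smul_smul, mul_comm (halfFactor γ⁻¹ τ), h2, hε, one_smul]

/-- The matrices are picked independently for each γ. The cocycle relation nevertheless holds, since
a matrix is determined by its action on the linearly independent components of `F5`. -/
theorem exists_isVectorModularForm : ∃ ρ : SL(2, ℤ) → GL (Fin 6) ℂ, IsVectorModularForm ρ F5 := by
  choose ρ hρ using exists_transformsBy
  refine ⟨ρ, ⟨fun γ δ τ => ?_, mdifferentiable_F5, hρ, Real.pi, isBigO_F5⟩⟩
  obtain ⟨ε, hε, h⟩ := halfFactor_cocycle γ δ
  have h1 : (ρ (γ * δ) : Matrix (Fin 6) (Fin 6) ℂ) = ε • (ρ γ * ρ δ : Matrix (Fin 6) (Fin 6) ℂ) := by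
    refine matrix_eq_of_mulVec_F5 fun τ => ?_
    have h2 := (hρ γ).mul (hρ δ) τ
    rw [hρ, h, mul_comm ε, mul_smul] at h2
    rw [Matrix.smul_mulVec]
    exact smul_right_injective _ (halfFactor_ne_zero _ _) h2
  rw [h1, h, smul_smul, mul_comm ε]

theorem isModularFormHalf_F5 (i : Fin 6) :
    IsModularFormHalf (CongruenceSubgroup.Gamma 3600) (fun τ => F5 τ i) where
  congruence := CongruenceSubgroup.Gamma_is_cong_sub 3600
  le_Gamma0 := Gamma_le_Gamma0
  holo := mdifferentiable_F5 i
  transform _ hγ τ := F5_smul_mul_theta hγ τ i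
  meromorphic_cusps σ := by
    obtain ⟨A, hA⟩ := exists_transformsBy σ
    refine ⟨Real.pi, ?_⟩
    -- Growth at any cusp reduces to growth at infinity, because σ mixes the components by a
    -- constant matrix.
    have h1 : (fun τ => (halfFactor σ τ)⁻¹ * F5 (σ • τ) i) = fun τ => ∑ j, A i j * F5 τ j := by
      funext τ
      rw [hA, Pi.smul_apply, smul_eq_mul, inv_mul_cancel_left₀ (halfFactor_ne_zero σ τ)]
      rfl
    rw [h1]
    exact Asymptotics.IsBigO.fun_sum fun j _ => (isBigO_F5 j).const_mul_left _

end MockTheta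
end

/-! ### The proposition assembled. -/

theorem mainTheorem7 :
    (∃ ρ : SL(2, ℤ) → GL (Fin 6) ℂ, MockTheta.IsVectorModularForm ρ MockTheta.F5) ∧
    (∀ τ : ℍ, MockTheta.F5 ((1 : ℝ) +ᵥ τ) = MockTheta.T5 *ᵥ MockTheta.F5 τ) ∧
    (∀ τ : ℍ, MockTheta.F5 (ModularGroup.S • τ) =
      ((-Complex.I * (τ : ℂ)) ^ (1 / 2 : ℂ) * (2 / (Real.sqrt 5 : ℝ) : ℂ)) •
        (MockTheta.M5 *ᵥ MockTheta.F5 τ)) ∧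
    (∀ i : Fin 6, ∃ Γ : Subgroup SL(2, ℤ),
      MockTheta.IsModularFormHalf Γ (fun τ => MockTheta.F5 τ i)) :=
  ⟨MockTheta.exists_isVectorModularForm, MockTheta.F5_vadd_one, MockTheta.F5_S_smul,
    fun i => ⟨_, MockTheta.isModularFormHalf_F5 i⟩⟩
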